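/- **Theorem 4.5.** The following sentence of the language of second-order arithmetic (Arrow's theorem for countable societies) is provable in $\mathsf{RCA}_0$, the theory consisting of the axioms of a commutative discrete ordered semiring, $\Sigma^0_1$ induction and $\Delta^0_1$ comprehension: *If $\mathcal S=\langle V,X,\mathcal A,\mathcal F\rangle$ is a finite society and $\sigma$ is a social welfare function for $\mathcal S$, then $\sigma$ is dictatorial.* Here the notions are formalised in second-order arithmetic as follows. Pairs are coded by $(m,n)=(m+n)^2+m$; a function is a set of pairs; a sequence of sets $\langle Y_i\rangle_{i\in\mathbb N}$ is a set $Y$ with $(i,v)\in Y\leftrightarrow v\in Y_i$; a set is finite if it is bounded; finite sets and finite sequences are coded by numbers, the code of a finite set being the least number $(k,m,n)=((k,m),n)$ such that the set is $\{i<k: m(i+1)+1 \text{ divides } n\}$, and the code of a finite sequence $s$ being that of $\{(i,s(i)):i<\mathrm{lh}(s)\}$, where $\mathrm{lh}(s)$ is the length of $s$. A *countable society* consists of a nonempty set $V\subseteq\mathbb N$, a finite set $X\subseteq\mathbb N$ with at least three elements, a sequence $\mathcal A=\langle A_i\rangle_{i\in\mathbb N}$ of subsets of $V$, and a sequence $\mathcal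 F=\langle f_i\rangle_{i\in\mathbb N}$ of functions $f_i:V\to W$, where $W$ is the set of codes of weak orders (transitive, strongly connected relations) on $X$, such that: 1. $\mathcal A$ contains $V$, is closed under union, intersection and complement relative to $V$, and contains $\{v\}$ for every $v\in V$; 2. there is $\mu:\mathbb N\times X\times X\to\mathbb N$ such that for all $n\in\mathbb N$, $x,y\in X$ and $v\in V$, $x\lesssim_{f_n(v)}y\leftrightarrow v\in A_{\mu(n,x,y)}$; 3. there is a function $e$, defined on all pairs $(p,s)$ where $p$ is a finite sequence of elements of $W$ in which each element of $W$ occurs exactly once and $s$ is a finite sequence of natural numbers with $1\le \mathrm{lh}(s)\le |W|=\mathrm{lh}(p)$, with values in $\mathbb N$, such that for all $v\in V$, $f_{e(p,s)}(v)=p(i)$ if $i$ is the unique number $<\mathrm{lh}(s)-1$ with $v\in A_{s(i)}$, and $f_{e(p,s)}(v)=p(\mathrm{lh}(s)-1)$ if there is no unique such number. The society is *finite* if $V$ is finite. Write $x<_R y$ for $x\lesssim_R y\wedge y\not\lesssim_R x$. A *social welfare function* for $\mathcal S$ is a function $\sigma:\mathbb N\to W$ such that for all $x,y\in X$ and $i,j\in\mathbb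 N$: (unanimity) if $x<_{f_i(v)}y$ for all $v\in V$, then $x<_{\sigma(i)}y$; (independence) if $f_i(v)$ and $f_j(v)$ agree on $\{x,y\}$ for all $v\in V$, then $\sigma(i)$ and $\sigma(j)$ agree on $\{x,y\}$. It is *non-dictatorial* if for all $v\in V$ there are $i\in\mathbb N$ and $x,y\in X$ with $x<_{f_i(v)}y$ and $y\lesssim_{\sigma(i)}x$, and *dictatorial* otherwise. -/

import Mathlib

/-!
Second-order arithmetic: syntax, a classical natural deduction calculus, the axioms of RCA₀, and
the formal sentence of the language of second-order arithmetic which expresses Arrow's theorem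
for countable societies.
-/

namespace SOA

/-! ### The two-sorted language

Variables are de Bruijn indices, separately for the two sorts: number variable `k` refers to the
`k`-th enclosing number quantifier, counted from the inside (or to a free variable if there are
not that many), and likewise for set variables and set quantifiers. -/

/-- Number terms. -/
inductive Term : Type
  | var : ℕ → Term
  | zero : Term
  | one : Term
  | add : Term → Term → Term
  | mul : Term → Term → Term

instance : Zero Term := ⟨Term.zero⟩
instance : One Term := ⟨Term.one⟩
instance : Add Term := ⟨Term.add⟩
instance : Mul Term := ⟨Term.mul⟩

/-- Formulas. The atomic formulas are `t = u`, `t < u` and `t ∈ X`; the other connectives and the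
existential quantifiers are defined classically from `⊥`, `→` and the two `∀`. -/
inductive Formula : Type
  | eq : Term → Term → Formula
  | lt : Term → Term → Formula
  | mem : Term → ℕ → Formula
  | bot : Formula
  | imp : Formula → Formula → Formula
  | allN : Formula → Formula
  | allS : Formula → Formula

namespace Formula

def neg (φ : Formula) : Formula := imp φ bot
def and (φ ψ : Formula) : Formula := neg (imp φ (neg ψ))
def or (φ ψ : Formula) : Formula := imp (neg φ) ψ
def iff (φ ψ : Formula) : Formula := and (imp φ ψ) (imp ψ φ)
def exN (φ : Formula) : Formula := neg (allN (neg φ))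
def exS (φ : Formula) : Formula := neg (allS (neg φ))

end Formula

/-! ### Substitution -/

/-- Simultaneous substitution in a term. -/
def Term.subst (σ : ℕ → Term) : Term → Term
  | .var k => σ k
  | .zero => .zero
  | .one => .one
  | .add t u => .add (t.subst σ) (u.subst σ)
  | .mul t u => .mul (t.subst σ) (u.subst σ)

/-- Rename every free variable `k` to `k + 1`. -/
def Term.shift (t : Term) : Term := t.subst fun k => .var (k + 1)

/-- Prepend an element to a sequence. -/
def cons {α : Type} (a : α) (σ : ℕ → α) : ℕ → α
  | 0 => a
  | k + 1 => σ k

/-- Simultaneous capture-avoiding substitution of terms for number variables and of set variables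
for set variables. -/
def Formula.subst : (ℕ → Term) → (ℕ → ℕ) → Formula → Formula
  | σ, _, .eq t u => .eq (t.subst σ) (u.subst σ)
  | σ, _, .lt t u => .lt (t.subst σ) (u.subst σ)
  | σ, τ, .mem t X => .mem (t.subst σ) (τ X)
  | _, _, .bot => .bot
  | σ, τ, .imp φ ψ => .imp (φ.subst σ τ) (ψ.subst σ τ)
  | σ, τ, .allN φ => .allN (φ.subst (cons (.var 0) fun k => (σ k).shift) τ)
  | σ, τ, .allS φ => .allS (φ.subst σ (cons 0 fun k => τ k + 1))

namespace Formula

/-- Make room for a new number variable `0`. -/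
def shiftN (φ : Formula) : Formula := φ.subst (fun k => .var (k + 1)) id

/-- Make room for a new set variable `0`. -/
def shiftS (φ : Formula) : Formula := φ.subst .var (fun k => k + 1)

/-- Replace number variable `0` by the term `t` and lower the other number variables. -/
def instN (t : Term) (φ : Formula) : Formula := φ.subst (cons t .var) id

/-- Replace set variable `0` by the set variable `X` and lower the other set variables. -/
def instS (X : ℕ) (φ : Formula) : Formula := φ.subst .var (cons X id)

end Formula

/-! ### Derivability -/

/-- `Proves Γ φ`: the formula `φ` is derivable from the set `Γ` of formulas in classical two-sorted
natural deduction with equality. In the two introduction rules for `∀`, the shift of `Γ` expresses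
that the eigenvariable does not occur in `Γ`. -/
inductive Proves : Set Formula → Formula → Prop
  | ax {Γ : Set Formula} {φ : Formula} : φ ∈ Γ → Proves Γ φ
  | impI {Γ : Set Formula} {φ ψ : Formula} : Proves (insert φ Γ) ψ → Proves Γ (.imp φ ψ)
  | impE {Γ : Set Formula} {φ ψ : Formula} : Proves Γ (.imp φ ψ) → Proves Γ φ → Proves Γ ψ
  | raa {Γ : Set Formula} {φ : Formula} : Proves (insert φ.neg Γ) .bot → Proves Γ φ
  | allNI {Γ : Set Formula} {φ : Formula} :
      Proves (Formula.shiftN '' Γ) φ → Proves Γ (.allN φ)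
  | allNE {Γ : Set Formula} {φ : Formula} (t : Term) :
      Proves Γ (.allN φ) → Proves Γ (φ.instN t)
  | allSI {Γ : Set Formula} {φ : Formula} :
      Proves (Formula.shiftS '' Γ) φ → Proves Γ (.allS φ)
  | allSE {Γ : Set Formula} {φ : Formula} (X : ℕ) :
      Proves Γ (.allS φ) → Proves Γ (φ.instS X)
  | eqRefl {Γ : Set Formula} (t : Term) : Proves Γ (.eq t t)
  | eqSubst {Γ : Set Formula} {φ : Formula} {t u : Term} :
      Proves Γ (.eq t u) → Proves Γ (φ.instN t) → Proves Γ (φ.instN u)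

/-! ### Universal closure -/

/-- The least `n` such that all variables of the term are below `n`. -/
def Term.bound : Term → ℕ
  | .var k => k + 1
  | .zero => 0
  | .one => 0
  | .add t u => max t.bound u.bound
  | .mul t u => max t.bound u.bound

/-- The least `n` such that all free number variables are below `n`. -/
def Formula.boundN : Formula → ℕ
  | .eq t u => max t.bound u.bound
  | .lt t u => max t.bound u.bound
  | .mem t _ => t.bound
  | .bot => 0
  | .imp φ ψ => max φ.boundN ψ.boundN
  | .allN φ => φ.boundN - 1
  | .allS φ => φ.boundN

/-- The least `n` such that all free set variables are below `n`. -/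
def Formula.boundS : Formula → ℕ
  | .eq _ _ => 0
  | .lt _ _ => 0
  | .mem _ X => X + 1
  | .bot => 0
  | .imp φ ψ => max φ.boundS ψ.boundS
  | .allN φ => φ.boundS
  | .allS φ => φ.boundS - 1

/-- The universal closure. -/
def Formula.closure (φ : Formula) : Formula :=
  Formula.allN^[φ.boundN] (Formula.allS^[φ.boundS] φ)

/-! ### Writing formulas with bound names

To write concrete sentences legibly, an expression is represented as a function of the number `a`
of number quantifiers and the number `b` of set quantifiers above it. A quantifier is then applied
to a function of the variable which it binds: the variable bound at depth `a` has, at depth `a'`,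
the index `a' - (a + 1)`. A sentence is obtained by evaluation at depth zero. -/

/-- Number terms, as functions of the number of enclosing number quantifiers. -/
abbrev Tm := ℕ → Term

/-- Set variables, as functions of the number of enclosing set quantifiers. -/
abbrev Sv := ℕ → ℕ

/-- Formulas, as functions of the numbers of enclosing number and set quantifiers. -/
abbrev Fm := ℕ → ℕ → Formula

def fEq (t u : Tm) : Fm := fun a _ => .eq (t a) (u a)
def fLt (t u : Tm) : Fm := fun a _ => .lt (t a) (u a)
def fMem (t : Tm) (X : Sv) : Fm := fun a b => .mem (t a) (X b)
def fNot (φ : Fm) : Fm := fun a b => (φ a b).neg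
def fImp (φ ψ : Fm) : Fm := fun a b => .imp (φ a b) (ψ a b)
def fAnd (φ ψ : Fm) : Fm := fun a b => (φ a b).and (ψ a b)
def fOr (φ ψ : Fm) : Fm := fun a b => (φ a b).or (ψ a b)
def fIff (φ ψ : Fm) : Fm := fun a b => (φ a b).iff (ψ a b)

/-- For all numbers. -/
def all (φ : Tm → Fm) : Fm :=
  fun a b => .allN (φ (fun a' => .var (a' - (a + 1))) (a + 1) b)

/-- There is a number. -/
def ex (φ : Tm → Fm) : Fm :=
  fun a b => .exN (φ (fun a' => .var (a' - (a + 1))) (a + 1) b)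

/-- For all sets. -/
def allSet (φ : Sv → Fm) : Fm :=
  fun a b => .allS (φ (fun b' => b' - (b + 1)) a (b + 1))

/-- There is a set. -/
def exSet (φ : Sv → Fm) : Fm :=
  fun a b => .exS (φ (fun b' => b' - (b + 1)) a (b + 1))

infix:60 " =ₙ " => fEq
infix:60 " <ₙ " => fLt
infix:60 " ∈ₛ " => fMem
prefix:max "∼ₗ" => fNot
infixr:55 " ∧ₗ " => fAnd
infixr:54 " ∨ₗ " => fOr
infixr:53 " ⇒ₗ " => fImp
infix:52 " ⇔ₗ " => fIff

/-- There is exactly one number. -/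
def exUnique (φ : Tm → Fm) : Fm :=
  ex fun x => φ x ∧ₗ all fun y => φ y ⇒ₗ y =ₙ x

def leN (t u : Tm) : Fm := t <ₙ u ∨ₗ t =ₙ u

/-! ### The axioms of RCA₀ -/

/-- The basic axioms: those of a commutative discrete ordered semiring. -/
def basicAxioms : List Fm :=
  [ all fun x => all fun y => all fun z => (x + y) + z =ₙ x + (y + z),
    all fun x => all fun y => x + y =ₙ y + x,
    all fun x => all fun y => all fun z => (x * y) * z =ₙ x * (y * z),
    all fun x => all fun y => x * y =ₙ y * x,
    all fun x => all fun y => all fun z => x * (y + z) =ₙ x * y + x * z,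
    all fun x => x + 0 =ₙ x,
    all fun x => x * 0 =ₙ 0,
    all fun x => x * 1 =ₙ x,
    all fun x => all fun y => all fun z => x <ₙ y ∧ₗ y <ₙ z ⇒ₗ x <ₙ z,
    all fun x => ∼ₗ(x <ₙ x),
    all fun x => all fun y => x <ₙ y ∨ₗ x =ₙ y ∨ₗ y <ₙ x,
    all fun x => all fun y => all fun z => x <ₙ y ⇒ₗ x + z <ₙ y + z,
    all fun x => all fun y => all fun z => 0 <ₙ z ∧ₗ x <ₙ y ⇒ₗ x * z <ₙ y * z,
    all fun x => all fun y => x <ₙ y ⇒ₗ ex fun z => x + z =ₙ y,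
    0 <ₙ 1,
    all fun x => 0 <ₙ x ⇒ₗ leN 1 x,
    all fun x => leN 0 x ]

/-- Formulas all of whose quantifiers are bounded number quantifiers `∀ x < t` or `∃ x < t`,
where `x` does not occur in `t`. -/
inductive IsBounded : Formula → Prop
  | eq (t u : Term) : IsBounded (.eq t u)
  | lt (t u : Term) : IsBounded (.lt t u)
  | mem (t : Term) (X : ℕ) : IsBounded (.mem t X)
  | bot : IsBounded .bot
  | imp {φ ψ : Formula} : IsBounded φ → IsBounded ψ → IsBounded (.imp φ ψ)
  | ball (t : Term) {φ : Formula} :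
      IsBounded φ → IsBounded (.allN (.imp (.lt (.var 0) t.shift) φ))
  | bex (t : Term) {φ : Formula} :
      IsBounded φ → IsBounded (.exN (.and (.lt (.var 0) t.shift) φ))

def IsSigma01 (φ : Formula) : Prop := ∃ θ : Formula, IsBounded θ ∧ φ = .exN θ

def IsPi01 (φ : Formula) : Prop := ∃ θ : Formula, IsBounded θ ∧ φ = .allN θ

/-- `φ(0) ∧ ∀ n (φ(n) → φ(n + 1)) → ∀ n φ(n)`, where `n` is the number variable `0` of `φ`. -/
def induction (φ : Formula) : Formula :=
  .imp
    (.and (φ.instN 0)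
      (.allN (.imp φ (φ.subst (cons (.var 0 + 1) fun k => .var (k + 1)) id))))
    (.allN φ)

/-- `∀ n (φ(n) ↔ ψ(n)) → ∃ X ∀ n (n ∈ X ↔ φ(n))`, where `n` is the number variable `0` of `φ`
and `ψ`; the set variable `X` does not occur in `φ`. -/
def comprehension (φ ψ : Formula) : Formula :=
  .imp (.allN (.iff φ ψ)) (.exS (.allN (.iff (.mem (.var 0) 0) φ.shiftS)))

/-- The axioms of RCA₀: basic axioms, `Σ⁰₁` induction and `Δ⁰₁` comprehension. -/
def RCA0 : Set Formula :=
  { χ | (∃ φ ∈ basicAxioms, χ = φ 0 0) ∨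
    (∃ φ, IsSigma01 φ ∧ χ = (induction φ).closure) ∨
    (∃ φ ψ, IsSigma01 φ ∧ IsPi01 ψ ∧ χ = (comprehension φ ψ).closure) }

/-! ### Coding of pairs, functions, finite sets and finite sequences -/

/-- The pair `(m, n) = (m + n)² + m`. -/
def pair (m n : Tm) : Tm := (m + n) * (m + n) + m

def triple (k m n : Tm) : Tm := pair (pair k m) n

/-- The class `{u | G u}` is (the graph of) a function from `{x | D x}` to `{y | E y}`. -/
def isFun (G D E : Tm → Fm) : Fm :=
  (all fun u => G u ⇒ₗ ex fun x => ex fun y => u =ₙ pair x y ∧ₗ D x ∧ₗ E y) ∧ₗ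
  (all fun x => D x ⇒ₗ exUnique fun y => G (pair x y))

/-- The set `X` is finite, i.e. bounded. -/
def finiteSet (X : Sv) : Fm := ex fun k => all fun i => i ∈ₛ X ⇒ₗ i <ₙ k

/-- `i` belongs to the finite set `{i < k | m (i + 1) + 1 divides n}` given by the triple
`c = (k, m, n)`. Every finite set has this form. -/
def inCode (i c : Tm) : Fm :=
  ex fun k => ex fun m => ex fun n => c =ₙ triple k m n ∧ₗ i <ₙ k ∧ₗ
    ex fun q => n =ₙ q * (m * (i + 1) + 1)

def isTriple (c : Tm) : Fm := ex fun k => ex fun m => ex fun n => c =ₙ triple k m n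

/-- `c` is the code of a finite set, i.e. the least among the triples which give that set. -/
def finCode (c : Tm) : Fm :=
  isTriple c ∧ₗ
  all fun d => d <ₙ c ∧ₗ isTriple d ⇒ₗ ∼ₗ(all fun i => inCode i d ⇔ₗ inCode i c)

/-- `s(i) = j`, where the finite sequence `s` is coded as the finite set of pairs `(i, s(i))`. -/
def entry (s i j : Tm) : Fm := inCode (pair i j) s

/-- `s` is (the code of) a finite sequence, of length `l`. -/
def isSeq (s l : Tm) : Fm :=
  finCode s ∧ₗ
  (all fun u => inCode u s ⇒ₗ ex fun i => ex fun j => u =ₙ pair i j ∧ₗ i <ₙ l) ∧ₗ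
  (all fun i => i <ₙ l ⇒ₗ exUnique fun j => entry s i j)

/-! ### Countable algebras, weak orders and profiles

A sequence of sets `⟨Y_i⟩` is a set `Y`, with `v ∈ Y_i` standing for `(i, v) ∈ Y`. -/

/-- `v ∈ A_i`. -/
def inSeq (A : Sv) (i v : Tm) : Fm := pair i v ∈ₛ A

/-- `A` is a countable algebra of sets over `V`. -/
def countableAlgebra (V A : Sv) : Fm :=
  (all fun i => all fun v => inSeq A i v ⇒ₗ v ∈ₛ V) ∧ₗ
  (ex fun k => all fun v => inSeq A k v ⇔ₗ v ∈ₛ V) ∧ₗ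
  (all fun i => all fun j => ex fun k => all fun v =>
    inSeq A k v ⇔ₗ (inSeq A i v ∨ₗ inSeq A j v)) ∧ₗ
  (all fun i => all fun j => ex fun k => all fun v =>
    inSeq A k v ⇔ₗ (inSeq A i v ∧ₗ inSeq A j v)) ∧ₗ
  (all fun i => ex fun k => all fun v => inSeq A k v ⇔ₗ (v ∈ₛ V ∧ₗ ∼ₗ(inSeq A i v)))

/-- Every singleton of an element of `V` is in the algebra `A`. -/
def atomic (V A : Sv) : Fm :=
  all fun v => v ∈ₛ V ⇒ₗ ex fun k => all fun u => inSeq A k u ⇔ₗ u =ₙ v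

/-- `R ∈ W`: the number `R` is the code of a weak order on `X`. -/
def weakOrder (X : Sv) (R : Tm) : Fm :=
  finCode R ∧ₗ
  (all fun u => inCode u R ⇒ₗ ex fun x => ex fun y => u =ₙ pair x y ∧ₗ x ∈ₛ X ∧ₗ y ∈ₛ X) ∧ₗ
  (all fun x => all fun y => x ∈ₛ X ∧ₗ y ∈ₛ X ⇒ₗ inCode (pair x y) R ∨ₗ inCode (pair y x) R) ∧ₗ
  (all fun x => all fun y => all fun z =>
    inCode (pair x y) R ∧ₗ inCode (pair y z) R ⇒ₗ inCode (pair x z) R)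

/-- `f_i(v) = R`. -/
def profileVal (F : Sv) (i v R : Tm) : Fm := inSeq F i (pair v R)

/-- `F` is a sequence of profiles `f_i : V → W`. -/
def profiles (V X F : Sv) : Fm :=
  all fun i => isFun (fun u => inSeq F i u) (fun v => v ∈ₛ V) (fun R => weakOrder X R)

/-- `x ≲ y` for voter `v` in the profile `f_i`. -/
def voterLe (F : Sv) (i v x y : Tm) : Fm :=
  ex fun R => profileVal F i v R ∧ₗ inCode (pair x y) R

/-- `x < y` for voter `v` in the profile `f_i`. -/
def voterLt (F : Sv) (i v x y : Tm) : Fm := voterLe F i v x y ∧ₗ ∼ₗ(voterLe F i v y x)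

/-- `F` is uniformly `A`-measurable. -/
def uniformlyMeasurable (V X A F : Sv) : Fm :=
  exSet fun μ =>
    isFun (fun u => u ∈ₛ μ)
      (fun w => ex fun n => ex fun x => ex fun y => w =ₙ triple n x y ∧ₗ x ∈ₛ X ∧ₗ y ∈ₛ X)
      (fun k => k =ₙ k) ∧ₗ
    all fun n => all fun x => all fun y => all fun v => all fun k =>
      x ∈ₛ X ∧ₗ y ∈ₛ X ∧ₗ v ∈ₛ V ∧ₗ pair (triple n x y) k ∈ₛ μ ⇒ₗ
        (voterLe F n v x y ⇔ₗ inSeq A k v)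

/-- `p` is a permutation of `W`, of length `l`; thus `l` is the cardinality of `W`. -/
def isPerm (X : Sv) (p l : Tm) : Fm :=
  isSeq p l ∧ₗ
  (all fun i => all fun R => entry p i R ⇒ₗ weakOrder X R) ∧ₗ
  (all fun R => weakOrder X R ⇒ₗ exUnique fun i => entry p i R)

/-- `p` is a permutation of `W` and `s` is a quasi-partition of length `k`,
`1 ≤ k ≤ |W|`. -/
def permQPart (X : Sv) (p s k : Tm) : Fm :=
  ex fun l => isPerm X p l ∧ₗ isSeq s k ∧ₗ leN 1 k ∧ₗ leN k l

/-- `i < k - 1` and `v ∈ A_{s(i)}`, where `s` is a sequence of length `k`. -/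
def inPart (A : Sv) (s k v i : Tm) : Fm :=
  i + 1 <ₙ k ∧ₗ ex fun n => entry s i n ∧ₗ inSeq A n v

/-- `A` is quasi-partition embedded into `F`: there is a function `e` on pairs of a permutation `p`
and a quasi-partition `s`, such that `f_{e(p, s)}(v)` is `p(i)` if `i` is the only number below
`lh(s) - 1` with `v ∈ A_{s(i)}`, and `p(lh(s) - 1)` if there is not exactly one such number. -/
def qpEmbedded (V X A F : Sv) : Fm :=
  exSet fun e =>
    isFun (fun u => u ∈ₛ e)
      (fun w => ex fun p => ex fun s => ex fun k => w =ₙ pair p s ∧ₗ permQPart X p s k)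
      (fun j => j =ₙ j) ∧ₗ
    all fun p => all fun s => all fun k => all fun j => all fun v =>
      permQPart X p s k ∧ₗ pair (pair p s) j ∈ₛ e ∧ₗ v ∈ₛ V ⇒ₗ
        (all fun i => inPart A s k v i ∧ₗ (all fun i' => inPart A s k v i' ⇒ₗ i' =ₙ i) ⇒ₗ
          ex fun R => entry p i R ∧ₗ profileVal F j v R) ∧ₗ
        (∼ₗ(exUnique fun i => inPart A s k v i) ⇒ₗ
          ex fun m => ex fun R => m + 1 =ₙ k ∧ₗ entry p m R ∧ₗ profileVal F j v R)

/-- `⟨V, X, A, F⟩` is a countable society. -/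
def countableSociety (V X A F : Sv) : Fm :=
  (ex fun v => v ∈ₛ V) ∧ₗ
  finiteSet X ∧ₗ
  (ex fun x => ex fun y => ex fun z => x ∈ₛ X ∧ₗ y ∈ₛ X ∧ₗ z ∈ₛ X ∧ₗ
    ∼ₗ(x =ₙ y) ∧ₗ ∼ₗ(x =ₙ z) ∧ₗ ∼ₗ(y =ₙ z)) ∧ₗ
  countableAlgebra V A ∧ₗ
  atomic V A ∧ₗ
  profiles V X F ∧ₗ
  uniformlyMeasurable V X A F ∧ₗ
  qpEmbedded V X A F

/-! ### Social welfare functions -/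

/-- `x ≲ y` in the order `σ(i)`. -/
def socialLe (σ : Sv) (i x y : Tm) : Fm :=
  ex fun R => pair i R ∈ₛ σ ∧ₗ inCode (pair x y) R

/-- `x < y` in the order `σ(i)`. -/
def socialLt (σ : Sv) (i x y : Tm) : Fm := socialLe σ i x y ∧ₗ ∼ₗ(socialLe σ i y x)

def unanimity (V X F σ : Sv) : Fm :=
  all fun x => all fun y => all fun i => x ∈ₛ X ∧ₗ y ∈ₛ X ⇒ₗ
    (all fun v => v ∈ₛ V ⇒ₗ voterLt F i v x y) ⇒ₗ socialLt σ i x y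

/-- If `f_i = f_j` on `{x, y}`, then `σ(i) = σ(j)` on `{x, y}`. -/
def independence (V X F σ : Sv) : Fm :=
  all fun x => all fun y => all fun i => all fun j => x ∈ₛ X ∧ₗ y ∈ₛ X ⇒ₗ
    (all fun v => all fun a => all fun b =>
      v ∈ₛ V ∧ₗ (a =ₙ x ∨ₗ a =ₙ y) ∧ₗ (b =ₙ x ∨ₗ b =ₙ y) ⇒ₗ
        (voterLe F i v a b ⇔ₗ voterLe F j v a b)) ⇒ₗ
    all fun a => all fun b =>
      (a =ₙ x ∨ₗ a =ₙ y) ∧ₗ (b =ₙ x ∨ₗ b =ₙ y) ⇒ₗ (socialLe σ i a b ⇔ₗ socialLe σ j a b)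

/-- `σ : ℕ → W` is a social welfare function. -/
def socialWelfareFunction (V X F σ : Sv) : Fm :=
  isFun (fun u => u ∈ₛ σ) (fun i => i =ₙ i) (fun R => weakOrder X R) ∧ₗ
  unanimity V X F σ ∧ₗ
  independence V X F σ

def nonDictatorial (V X F σ : Sv) : Fm :=
  all fun v => v ∈ₛ V ⇒ₗ ex fun i => ex fun x => ex fun y =>
    x ∈ₛ X ∧ₗ y ∈ₛ X ∧ₗ voterLt F i v x y ∧ₗ socialLe σ i y x

/-- Arrow's theorem, as a sentence of second-order arithmetic: every social welfare function for a
finite society is dictatorial. -/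
def arrowTheorem : Formula :=
  (allSet fun V => allSet fun X => allSet fun A => allSet fun F => allSet fun σ =>
    countableSociety V X A F ∧ₗ finiteSet V ∧ₗ socialWelfareFunction V X F σ ⇒ₗ
      ∼ₗ(nonDictatorial V X F σ)) 0 0

end SOA

/-!
The derivation is found by semantic means. By the completeness theorem for two-sorted logic
(`exists_model`, proved by a Henkin construction) it suffices to verify the sentence in every model
of `RCA₀`, standard or not. The Henkin model is countable and each of its numbers is the value of
a term with parameters, so that a structure `NamedModel` suffices as its description: a discretely
ordered semiring `M` with a sequence of subsets, and with induction for `Σ⁰₁` formulas, in which all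
parameters have names (`proves_RCA0_of_sat`). The formal sentence is written with bound names and
translated into a statement about subsets of `M` by type class inference (`arrowTheorem_sat`); in
the same way, relations on `M` are recognized as bounded or as `Σ⁰₁` (`IsBdd`, `IsSig`), which makes
`sig_induction` a usable principle.

Inside such a model, Gödel's coding is redone: with `Σ⁰₁` induction there is a common multiple of
`1, …, K`, and hence a product of pairwise coprime moduli, one for each `i < K`. Divisors of this
product code all boundedly definable subsets of `{i | i < K}` (`exists_finCode`), below a bound that
depends only on `K`. So the codes of weak orders on the finite set `X` are bounded, every
boundedly definable weak order has a code (`exists_weakOrder`), and any four weak orders begin some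
enumeration of all of them (`exists_perm`). By the quasi-partition axiom the society therefore
contains every profile in which three alternatives are ordered in four prescribed ways on four sets
of voters from the algebra (`exists_profile`).

This is all that the proof of Arrow's theorem by a pivotal voter needs. For alternatives `x ≠ y`,
consider the profiles in which the voters below `n` have `x < y` and the others `y < x`. By
independence the social ranking of `x` and `y` depends only on `n`; by unanimity it is `y < x` at
`n = 0` and `x < y` when `n` bounds `V`. That society has `x < y` at `n` is a `Σ⁰₁` condition,
because it asks for the existence of a profile; so `Σ⁰₁` induction yields an `n` at which the
ranking turns (`exists_pivot`). Initial segments of `V` belong to the algebra, again by `Σ⁰₁`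
induction, which supplies the profiles for the rest: for a third alternative `z`, the voter `n`
enforces `x < z` against all others (`exists_weaklyDecisive`), and then every strict preference of
`n`, on any pair and in any profile, is that of society (`WeaklyDecisive.decisive`). Hence `n` is a dictator. Comprehension is not used.
-/

set_option linter.unusedSectionVars false

namespace SOA

/-! ### Substitution and free variables -/

theorem cons_comp {α β : Type} (f : α → β) (a : α) (σ : ℕ → α) :
    (fun k => f (cons a σ k)) = cons (f a) fun k => f (σ k) := by
  funext k; cases k <;> rfl

theorem Term.subst_subst (σ σ' : ℕ → Term) (t : Term) :
    (t.subst σ).subst σ' = t.subst fun k => (σ k).subst σ' := by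
  induction t with
  | var k => rfl
  | zero => rfl
  | one => rfl
  | add t u iht ihu => simp only [Term.subst, iht, ihu]
  | mul t u iht ihu => simp only [Term.subst, iht, ihu]

theorem Term.subst_var (t : Term) : t.subst .var = t := by
  induction t with
  | var k => rfl
  | zero => rfl
  | one => rfl
  | add t u iht ihu => simp only [Term.subst, iht, ihu]
  | mul t u iht ihu => simp only [Term.subst, iht, ihu]

theorem Term.shift_subst (t u : Term) (σ : ℕ → Term) :
    t.shift.subst (cons u σ) = t.subst σ := by
  rw [Term.shift, Term.subst_subst]; rfl

theorem Term.shift_subst_var (t u : Term) : t.shift.subst (cons u .var) = t := by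
  rw [Term.shift_subst, Term.subst_var]

theorem Term.subst_shift (t : Term) (σ : ℕ → Term) :
    (t.subst σ).shift = t.shift.subst (cons (.var 0) fun k => (σ k).shift) := by
  rw [Term.shift_subst]; exact Term.subst_subst _ _ _

theorem Formula.subst_subst (φ : Formula) (σ σ' : ℕ → Term) (τ τ' : ℕ → ℕ) :
    (φ.subst σ τ).subst σ' τ' = φ.subst (fun k => (σ k).subst σ') fun k => τ' (τ k) := by
  induction φ generalizing σ σ' τ τ' with
  | eq t u => simp only [Formula.subst, Term.subst_subst]
  | lt t u => simp only [Formula.subst, Term.subst_subst]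
  | mem t X => simp only [Formula.subst, Term.subst_subst]
  | bot => rfl
  | imp φ ψ ihφ ihψ => simp only [Formula.subst, ihφ, ihψ]
  | allN φ ih =>
    simp only [Formula.subst, ih, Formula.allN.injEq]
    congr 1
    funext k
    cases k with
    | zero => rfl
    | succ k => exact (Term.shift_subst _ _ _).trans (Term.subst_subst _ _ _).symm
  | allS φ ih =>
    simp only [Formula.subst, ih, Formula.allS.injEq]
    congr 1
    funext k
    cases k <;> rfl

theorem cons_var_shift : (cons (.var 0) fun k => (Term.var k).shift) = Term.var := by
  funext k; cases k <;> rfl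

theorem cons_zero_succ : (cons 0 fun k => k + 1 : ℕ → ℕ) = id := by
  funext k; cases k <;> rfl

theorem Term.subst_congr {t : Term} {σ σ' : ℕ → Term} (h : ∀ k < t.bound, σ k = σ' k) :
    t.subst σ = t.subst σ' := by
  induction t with
  | var k => exact h k (Nat.lt_succ_self k)
  | zero => rfl
  | one => rfl
  | add t u iht ihu =>
    simp only [Term.subst, iht fun k hk => h k (lt_max_of_lt_left hk),
      ihu fun k hk => h k (lt_max_of_lt_right hk)]
  | mul t u iht ihu =>
    simp only [Term.subst, iht fun k hk => h k (lt_max_of_lt_left hk),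
      ihu fun k hk => h k (lt_max_of_lt_right hk)]

theorem Formula.subst_congr {φ : Formula} {σ σ' : ℕ → Term} {τ τ' : ℕ → ℕ}
    (h : ∀ k < φ.boundN, σ k = σ' k) (h' : ∀ k < φ.boundS, τ k = τ' k) :
    φ.subst σ τ = φ.subst σ' τ' := by
  induction φ generalizing σ σ' τ τ' with
  | eq t u =>
    simp only [Formula.subst, Term.subst_congr fun k hk => h k (lt_max_of_lt_left hk),
      Term.subst_congr fun k hk => h k (lt_max_of_lt_right hk)]
  | lt t u =>
    simp only [Formula.subst, Term.subst_congr fun k hk => h k (lt_max_of_lt_left hk),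
      Term.subst_congr fun k hk => h k (lt_max_of_lt_right hk)]
  | mem t X => simp only [Formula.subst, Term.subst_congr h, h' X (Nat.lt_succ_self X)]
  | bot => rfl
  | imp φ ψ ihφ ihψ =>
    simp only [Formula.subst,
      ihφ (fun k hk => h k (lt_max_of_lt_left hk)) (fun k hk => h' k (lt_max_of_lt_left hk)),
      ihψ (fun k hk => h k (lt_max_of_lt_right hk)) (fun k hk => h' k (lt_max_of_lt_right hk))]
  | allN φ ih =>
    simp only [Formula.subst, Formula.allN.injEq]
    refine ih (fun k hk => ?_) h'
    cases k with
    | zero => rfl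
    | succ k => exact congrArg Term.shift (h k (Nat.lt_sub_of_add_lt hk))
  | allS φ ih =>
    simp only [Formula.subst, Formula.allS.injEq]
    refine ih h (fun k hk => ?_)
    cases k with
    | zero => rfl
    | succ k => exact congrArg (· + 1) (h' k (Nat.lt_sub_of_add_lt hk))

theorem Formula.subst_id (φ : Formula) : φ.subst .var id = φ := by
  induction φ with
  | eq t u => simp only [Formula.subst, Term.subst_var]
  | lt t u => simp only [Formula.subst, Term.subst_var]
  | mem t X => simp only [Formula.subst, Term.subst_var, id]
  | bot => rfl
  | imp φ ψ ihφ ihψ => simp only [Formula.subst, ihφ, ihψ]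
  | allN φ ih => simp only [Formula.subst, cons_var_shift, ih]
  | allS φ ih => simp only [Formula.subst, id, cons_zero_succ, ih]

theorem Formula.instN_subst (φ : Formula) (t : Term) (σ : ℕ → Term) (τ : ℕ → ℕ) :
    (φ.instN t).subst σ τ =
      (φ.subst (cons (.var 0) fun k => (σ k).shift) τ).instN (t.subst σ) := by
  simp only [Formula.instN, Formula.subst_subst]
  congr 1
  funext k
  cases k with
  | zero => rfl
  | succ k => exact (Term.shift_subst_var _ _).symm

theorem Formula.instS_subst (φ : Formula) (X : ℕ) (σ : ℕ → Term) (τ : ℕ → ℕ) :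
    (φ.instS X).subst σ τ = (φ.subst σ (cons 0 fun k => τ k + 1)).instS (τ X) := by
  simp only [Formula.instS, Formula.subst_subst, Term.subst_var, Term.subst]
  congr 1
  funext k
  cases k <;> rfl

theorem Formula.shiftN_subst (φ : Formula) (σ : ℕ → Term) (τ : ℕ → ℕ) :
    φ.shiftN.subst (cons (.var 0) fun k => (σ k).shift) τ = (φ.subst σ τ).shiftN := by
  simp only [Formula.shiftN, Formula.subst_subst]; rfl

theorem Formula.shiftS_subst (φ : Formula) (σ : ℕ → Term) (τ : ℕ → ℕ) :
    φ.shiftS.subst σ (cons 0 fun k => τ k + 1) = (φ.subst σ τ).shiftS := by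
  simp only [Formula.shiftS, Formula.subst_subst, Term.subst_var]; rfl

/-- A formula without free variables, in the form used below: no substitution changes it. -/
def Formula.IsClosed (φ : Formula) : Prop := ∀ σ τ, φ.subst σ τ = φ

theorem Formula.isClosed_of_bound {φ : Formula} (h : φ.boundN = 0) (h' : φ.boundS = 0) :
    φ.IsClosed := fun σ τ =>
  (Formula.subst_congr (by simp [h]) (by simp [h'])).trans φ.subst_id

theorem Formula.bound_iterate_allS (n : ℕ) (φ : Formula) :
    (Formula.allS^[n] φ).boundN = φ.boundN ∧ (Formula.allS^[n] φ).boundS = φ.boundS - n := by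
  induction n generalizing φ with
  | zero => exact ⟨rfl, rfl⟩
  | succ n ih =>
    rw [Function.iterate_succ_apply, (ih _).1, (ih _).2]
    exact ⟨rfl, by simp only [Formula.boundS]; omega⟩

theorem Formula.bound_iterate_allN (n : ℕ) (φ : Formula) :
    (Formula.allN^[n] φ).boundS = φ.boundS ∧ (Formula.allN^[n] φ).boundN = φ.boundN - n := by
  induction n generalizing φ with
  | zero => exact ⟨rfl, rfl⟩
  | succ n ih =>
    rw [Function.iterate_succ_apply, (ih _).1, (ih _).2]
    exact ⟨rfl, by simp only [Formula.boundN]; omega⟩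

theorem Formula.closure_isClosed (φ : Formula) : φ.closure.IsClosed := by
  apply Formula.isClosed_of_bound
  · rw [Formula.closure, (Formula.bound_iterate_allN _ _).2, (Formula.bound_iterate_allS _ _).1,
      Nat.sub_self]
  · rw [Formula.closure, (Formula.bound_iterate_allN _ _).1, (Formula.bound_iterate_allS _ _).2,
      Nat.sub_self]

theorem isClosed_of_mem_RCA0 {χ : Formula} (h : χ ∈ RCA0) : χ.IsClosed := by
  rcases h with ⟨φ, hφ, rfl⟩ | ⟨φ, -, rfl⟩ | ⟨φ, ψ, -, -, rfl⟩
  · have key : ∀ φ ∈ basicAxioms, (φ 0 0).boundN = 0 ∧ (φ 0 0).boundS = 0 := by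
      simp only [basicAxioms, List.forall_mem_cons]
      refine ⟨?_, ?_, ?_, ?_, ?_, ?_, ?_, ?_, ?_, ?_, ?_, ?_, ?_, ?_, ?_, ?_, ?_, ?_⟩
      all_goals first | exact ⟨rfl, rfl⟩ | simp
    exact Formula.isClosed_of_bound (key φ hφ).1 (key φ hφ).2
  · exact Formula.closure_isClosed _
  · exact Formula.closure_isClosed _

/-! ### Admissible rules of the calculus -/

theorem Proves.weaken {Γ Δ : Set Formula} {φ : Formula} (h : Proves Γ φ) (hΓ : Γ ⊆ Δ) :
    Proves Δ φ := by
  induction h generalizing Δ with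
  | ax h => exact .ax (hΓ h)
  | impI _ ih => exact .impI (ih (Set.insert_subset_insert hΓ))
  | impE _ _ ih₁ ih₂ => exact .impE (ih₁ hΓ) (ih₂ hΓ)
  | raa _ ih => exact .raa (ih (Set.insert_subset_insert hΓ))
  | allNI _ ih => exact .allNI (ih (Set.image_mono hΓ))
  | allNE t _ ih => exact .allNE t (ih hΓ)
  | allSI _ ih => exact .allSI (ih (Set.image_mono hΓ))
  | allSE X _ ih => exact .allSE X (ih hΓ)
  | eqRefl t => exact .eqRefl t
  | eqSubst _ _ ih₁ ih₂ => exact .eqSubst (ih₁ hΓ) (ih₂ hΓ)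

theorem Proves.subst {Γ : Set Formula} {φ : Formula} (h : Proves Γ φ) (σ : ℕ → Term)
    (τ : ℕ → ℕ) : Proves ((fun χ => χ.subst σ τ) '' Γ) (φ.subst σ τ) := by
  induction h generalizing σ τ with
  | ax h => exact .ax ⟨_, h, rfl⟩
  | impI _ ih =>
    refine .impI ?_
    have := ih σ τ
    rwa [Set.image_insert_eq] at this
  | impE _ _ ih₁ ih₂ => exact .impE (ih₁ σ τ) (ih₂ σ τ)
  | raa _ ih =>
    refine .raa ?_
    have := ih σ τ
    rwa [Set.image_insert_eq] at this
  | allNI _ ih =>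
    refine .allNI ?_
    have := ih (cons (.var 0) fun k => (σ k).shift) τ
    rw [Set.image_image] at this ⊢
    simpa only [Formula.shiftN_subst] using this
  | allNE t _ ih => rw [Formula.instN_subst]; exact .allNE _ (ih σ τ)
  | allSI _ ih =>
    refine .allSI ?_
    have := ih σ (cons 0 fun k => τ k + 1)
    rw [Set.image_image] at this ⊢
    simpa only [Formula.shiftS_subst] using this
  | allSE X _ ih => rw [Formula.instS_subst]; exact .allSE _ (ih σ τ)
  | eqRefl t => exact .eqRefl _
  | eqSubst _ _ ih₁ ih₂ =>
    have h₂ := ih₂ σ τ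
    rw [Formula.instN_subst] at h₂ ⊢
    exact .eqSubst (ih₁ σ τ) h₂

theorem Proves.cut {Γ : Set Formula} {φ ψ : Formula} (h : Proves Γ φ)
    (h' : Proves (insert φ Γ) ψ) : Proves Γ ψ := .impE (.impI h') h

theorem Proves.exfalso {Γ : Set Formula} (φ : Formula) (h : Proves Γ .bot) : Proves Γ φ :=
  .raa (h.weaken (Set.subset_insert _ _))

/-- Generalization on a fresh number variable, over a closed theory and one further formula. -/
theorem Proves.allN_of_fresh {Γ : Set Formula} (hΓ : ∀ χ ∈ Γ, χ.IsClosed) {ψ θ : Formula}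
    {k : ℕ} (hψ : ψ.boundN ≤ k) (hθ : θ.boundN ≤ k)
    (h : Proves (insert ψ Γ) (θ.instN (.var k))) : Proves (insert ψ Γ) (.allN θ) := by
  refine .allNI ?_
  have h' := h.subst (fun j => if j = k then .var 0 else .var (j + 1)) id
  have e₁ : (θ.instN (.var k)).subst (fun j => if j = k then .var 0 else .var (j + 1)) id = θ := by
    rw [Formula.instN, Formula.subst_subst]
    refine (Formula.subst_congr (fun j hj => ?_) fun _ _ => rfl).trans θ.subst_id
    cases j with
    | zero => simp [cons, Term.subst]
    | succ j => simp only [cons, Term.subst]; rw [if_neg (by omega)]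
  rw [e₁] at h'
  refine h'.weaken ?_
  rintro _ ⟨χ, rfl | hχ, rfl⟩
  · refine ⟨χ, Set.mem_insert _ _, Formula.subst_congr (fun j hj => ?_) fun _ _ => rfl⟩
    rw [if_neg (by omega)]
  · exact ⟨χ, Set.mem_insert_of_mem _ hχ, (hΓ χ hχ _ _).trans (hΓ χ hχ _ _).symm⟩

/-- Generalization on a fresh set variable, over a closed theory and one further formula. -/
theorem Proves.allS_of_fresh {Γ : Set Formula} (hΓ : ∀ χ ∈ Γ, χ.IsClosed) {ψ θ : Formula}
    {k : ℕ} (hψ : ψ.boundS ≤ k) (hθ : θ.boundS ≤ k)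
    (h : Proves (insert ψ Γ) (θ.instS k)) : Proves (insert ψ Γ) (.allS θ) := by
  refine .allSI ?_
  have h' := h.subst .var (fun j => if j = k then 0 else j + 1)
  have e₁ : (θ.instS k).subst .var (fun j => if j = k then 0 else j + 1) = θ := by
    rw [Formula.instS, Formula.subst_subst]
    refine (Formula.subst_congr (fun _ _ => rfl) fun j hj => ?_).trans θ.subst_id
    cases j with
    | zero => simp [cons]
    | succ j => exact if_neg (show ¬ j = k by omega)
  rw [e₁] at h'
  refine h'.weaken ?_
  rintro _ ⟨χ, rfl | hχ, rfl⟩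
  · refine ⟨χ, Set.mem_insert _ _, Formula.subst_congr (fun _ _ => rfl) fun j hj => ?_⟩
    rw [if_neg (by omega)]
  · exact ⟨χ, Set.mem_insert_of_mem _ hχ, (hΓ χ hχ _ _).trans (hΓ χ hχ _ _).symm⟩

/-! ### The Henkin construction -/

/-- An injective numbering of the terms. -/
def Term.code : Term → ℕ
  | .var k => Nat.pair 0 k
  | .zero => Nat.pair 1 0
  | .one => Nat.pair 2 0
  | .add t u => Nat.pair 3 (Nat.pair t.code u.code)
  | .mul t u => Nat.pair 4 (Nat.pair t.code u.code)

theorem Term.code_injective : Function.Injective Term.code := by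
  intro t
  induction t with
  | add t u iht ihu =>
    intro t' h
    cases t' <;> simp [Term.code] at h
    rw [iht h.1, ihu h.2]
  | mul t u iht ihu =>
    intro t' h
    cases t' <;> simp [Term.code] at h
    rw [iht h.1, ihu h.2]
  | _ => intro t' h; cases t' <;> simp_all [Term.code]

/-- An injective numbering of the formulas. -/
def Formula.code : Formula → ℕ
  | .eq t u => Nat.pair 0 (Nat.pair t.code u.code)
  | .lt t u => Nat.pair 1 (Nat.pair t.code u.code)
  | .mem t X => Nat.pair 2 (Nat.pair t.code X)
  | .bot => Nat.pair 3 0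
  | .imp φ ψ => Nat.pair 4 (Nat.pair φ.code ψ.code)
  | .allN φ => Nat.pair 5 φ.code
  | .allS φ => Nat.pair 6 φ.code

theorem Formula.code_injective : Function.Injective Formula.code := by
  intro φ
  induction φ with
  | imp φ ψ ihφ ihψ =>
    intro φ' h
    cases φ' <;> simp [Formula.code] at h
    rw [ihφ h.1, ihψ h.2]
  | allN φ ih =>
    intro φ' h
    cases φ' <;> simp [Formula.code] at h
    rw [ih h]
  | allS φ ih =>
    intro φ' h
    cases φ' <;> simp [Formula.code] at h
    rw [ih h]
  | _ => intro φ' h; cases φ' <;> simp_all [Formula.code, Term.code_injective.eq_iff]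

instance : Countable Formula := Formula.code_injective.countable

instance : Nonempty Formula := ⟨.bot⟩

/-- `ψ'` strengthens `ψ`, decides `χ`, and if it refutes a universal formula `χ` then it refutes
one of the instances of `χ`. -/
structure Decides (Γ : Set Formula) (ψ χ ψ' : Formula) : Prop where
  consistent : ¬ Proves (insert ψ' Γ) .bot
  stronger : Proves (insert ψ' Γ) ψ
  decides : Proves (insert ψ' Γ) χ ∨ Proves (insert ψ' Γ) χ.neg ∧
    (∀ θ, χ = .allN θ → ∃ t, Proves (insert ψ' Γ) (θ.instN t).neg) ∧
    (∀ θ, χ = .allS θ → ∃ X, Proves (insert ψ' Γ) (θ.instS X).neg)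

theorem Proves.and_left {Γ : Set Formula} {φ ψ : Formula} (h : Proves Γ (φ.and ψ)) :
    Proves Γ φ := by
  refine .raa (.impE (h.weaken (Set.subset_insert _ _)) (.impI (.exfalso _ ?_)))
  exact .impE (φ := φ) (.ax (by simp [Formula.neg])) (.ax (by simp))

theorem Proves.and_right {Γ : Set Formula} {φ ψ : Formula} (h : Proves Γ (φ.and ψ)) :
    Proves Γ ψ := by
  refine .raa (.impE (h.weaken (Set.subset_insert _ _)) (.impI ?_))
  exact .ax (by simp)

/-- If `ψ` is consistent and `ψ ∧ χ` is inconsistent, then `ψ` refutes `χ`. -/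
theorem Proves.neg_of_and_inconsistent {Γ : Set Formula} {ψ χ : Formula}
    (h : Proves (insert (ψ.and χ) Γ) .bot) : Proves (insert ψ Γ) χ.neg := by
  have h₁ : Proves (insert χ (insert ψ Γ)) (ψ.and χ) := by
    refine .impI (.impE (φ := χ) (.impE (φ := ψ) (.ax (Set.mem_insert _ _)) (.ax (by simp)))
      (.ax (by simp)))
  refine .impI (h₁.cut (h.weaken (Set.insert_subset_insert ?_)))
  exact (Set.subset_insert _ _).trans (Set.subset_insert _ _)

/-- One step of the Henkin construction. As `ψ` and `χ` are finite, fresh variables serve as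
witnesses, and no new constants are needed. -/
theorem exists_decides {Γ : Set Formula} (hΓ : ∀ χ ∈ Γ, χ.IsClosed) {ψ : Formula}
    (hψ : ¬ Proves (insert ψ Γ) .bot) (χ : Formula) : ∃ ψ', Decides Γ ψ χ ψ' := by
  have self (φ : Formula) : Proves (insert φ Γ) φ := .ax (Set.mem_insert _ _)
  by_cases h : Proves (insert (ψ.and χ) Γ) .bot
  swap
  · exact ⟨_, h, (self _).and_left, .inl (self _).and_right⟩
  have hχ := Proves.neg_of_and_inconsistent h
  have lift {δ θ : Formula} (hδ : Proves (insert ψ Γ) θ) : Proves (insert (ψ.and δ) Γ) θ :=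
    (self _).and_left.cut (hδ.weaken (Set.insert_subset_insert (Set.subset_insert _ _)))
  -- A witness for the negation of a refuted universal formula can be added consistently.
  have wit {θ δ : Formula} (e : χ = θ) (hd : Proves (insert ψ Γ) δ → Proves (insert ψ Γ) θ) :
      ¬ Proves (insert (ψ.and δ.neg) Γ) .bot := by
    intro hbot
    refine hψ (.impE hχ (e ▸ hd ?_))
    exact .raa (.impE (φ := δ.neg)
      ((Proves.neg_of_and_inconsistent hbot).weaken (Set.subset_insert _ _)) (.ax (by simp)))
  cases χ with
  | allN θ =>
    refine ⟨ψ.and (θ.instN (.var (max ψ.boundN θ.boundN))).neg, wit rfl fun hd => ?_,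
      (self _).and_left, .inr ⟨lift hχ, ?_, by simp⟩⟩
    · exact hd.allN_of_fresh hΓ (le_max_left _ _) (le_max_right _ _)
    · rintro _ ⟨rfl⟩
      exact ⟨_, (self _).and_right⟩
  | allS θ =>
    refine ⟨ψ.and (θ.instS (max ψ.boundS θ.boundS)).neg, wit rfl fun hd => ?_,
      (self _).and_left, .inr ⟨lift hχ, by simp, ?_⟩⟩
    · exact hd.allS_of_fresh hΓ (le_max_left _ _) (le_max_right _ _)
    · rintro _ ⟨rfl⟩
      exact ⟨_, (self _).and_right⟩
  | _ => exact ⟨ψ, hψ, self _, .inr ⟨hχ, by simp, by simp⟩⟩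

/-- A deductively closed, consistent and complete set of formulas with witnesses for the negations
of universal formulas. -/
structure Henkin (T : Set Formula) : Prop where
  closed {φ : Formula} : Proves T φ → φ ∈ T
  consistent : Formula.bot ∉ T
  complete (φ : Formula) : φ ∈ T ∨ φ.neg ∈ T
  witnessN {θ : Formula} : Formula.allN θ ∉ T → ∃ t, θ.instN t ∉ T
  witnessS {θ : Formula} : Formula.allS θ ∉ T → ∃ X, θ.instS X ∉ T

/-- Derivations use finitely many premises. -/
theorem Proves.finite {Γ : Set Formula} {φ : Formula} (h : Proves Γ φ) :
    ∃ Δ ⊆ Γ, Δ.Finite ∧ Proves Δ φ := by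
  induction h with
  | @ax Γ φ h => exact ⟨{φ}, by simpa using h, Set.finite_singleton _, .ax rfl⟩
  | @impI Γ φ ψ _ ih =>
    obtain ⟨Δ, hs, hf, hp⟩ := ih
    refine ⟨Δ \ {φ}, by simpa [Set.sdiff_singleton_subset_iff] using hs, hf.sdiff, .impI ?_⟩
    exact hp.weaken (by simp)
  | impE _ _ ih₁ ih₂ =>
    obtain ⟨Δ, hs, hf, hp⟩ := ih₁
    obtain ⟨Δ', hs', hf', hp'⟩ := ih₂
    exact ⟨Δ ∪ Δ', Set.union_subset hs hs', hf.union hf',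
      .impE (hp.weaken Set.subset_union_left) (hp'.weaken Set.subset_union_right)⟩
  | @raa Γ φ _ ih =>
    obtain ⟨Δ, hs, hf, hp⟩ := ih
    refine ⟨Δ \ {φ.neg}, by simpa [Set.sdiff_singleton_subset_iff] using hs, hf.sdiff, .raa ?_⟩
    exact hp.weaken (by simp)
  | allNI _ ih =>
    obtain ⟨Δ, hs, hf, hp⟩ := ih
    obtain ⟨Δ', hs', hf', rfl⟩ := Set.exists_subset_image_finite_and.1 ⟨Δ, hs, hf, rfl⟩
    exact ⟨Δ', hs', hf', .allNI hp⟩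
  | allNE t _ ih =>
    obtain ⟨Δ, hs, hf, hp⟩ := ih
    exact ⟨Δ, hs, hf, .allNE t hp⟩
  | allSI _ ih =>
    obtain ⟨Δ, hs, hf, hp⟩ := ih
    obtain ⟨Δ', hs', hf', rfl⟩ := Set.exists_subset_image_finite_and.1 ⟨Δ, hs, hf, rfl⟩
    exact ⟨Δ', hs', hf', .allSI hp⟩
  | allSE X _ ih =>
    obtain ⟨Δ, hs, hf, hp⟩ := ih
    exact ⟨Δ, hs, hf, .allSE X hp⟩
  | eqRefl t => exact ⟨∅, Set.empty_subset _, Set.finite_empty, .eqRefl t⟩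
  | eqSubst _ _ ih₁ ih₂ =>
    obtain ⟨Δ, hs, hf, hp⟩ := ih₁
    obtain ⟨Δ', hs', hf', hp'⟩ := ih₂
    exact ⟨Δ ∪ Δ', Set.union_subset hs hs', hf.union hf',
      .eqSubst (hp.weaken Set.subset_union_left) (hp'.weaken Set.subset_union_right)⟩

/-- If every member of a finite set `Δ` is derivable from `Γ`, then so is what follows from `Δ`. -/
theorem Proves.trans_finite {Γ Δ : Set Formula} (hΔ : Δ.Finite) {φ : Formula}
    (h : ∀ δ ∈ Δ, Proves Γ δ) (hφ : Proves Δ φ) : Proves Γ φ := by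
  induction Δ, hΔ using Set.Finite.induction_on generalizing φ with
  | empty => exact hφ.weaken (Set.empty_subset _)
  | @insert δ Δ _ _ ih =>
    exact .impE (ih (fun δ' h' => h δ' (Set.mem_insert_of_mem _ h')) (.impI hφ))
      (h δ (Set.mem_insert _ _))

/-- The Henkin set is the theory of an increasing sequence of formulas `ψ n` over `Γ`, each of which
decides the formula with number `n - 1`. -/
theorem exists_henkin {Γ : Set Formula} (hΓ : ∀ χ ∈ Γ, χ.IsClosed) {φ : Formula}
    (hφ : ¬ Proves Γ φ) : ∃ T, Γ ⊆ T ∧ φ ∉ T ∧ Henkin T := by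
  have h₀ : ¬ Proves (insert φ.neg Γ) .bot := fun h => hφ (.raa h)
  obtain ⟨enum, henum⟩ := exists_surjective_nat Formula
  choose! next hnext using fun ψ (hψ : ¬ Proves (insert ψ Γ) .bot) χ => exists_decides hΓ hψ χ
  let ψ : ℕ → Formula := fun n => Nat.rec φ.neg (fun n ψ => next ψ (enum n)) n
  have hcon (n : ℕ) : ¬ Proves (insert (ψ n) Γ) .bot := by
    induction n with
    | zero => exact h₀
    | succ n ih => exact (hnext _ ih _).consistent
  have hstep (n : ℕ) : Decides Γ (ψ n) (enum n) (ψ (n + 1)) := hnext _ (hcon n) _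
  have mono {m n : ℕ} (hmn : m ≤ n) {χ : Formula} (h : Proves (insert (ψ m) Γ) χ) :
      Proves (insert (ψ n) Γ) χ := by
    induction n, hmn using Nat.le_induction with
    | base => exact h
    | succ n _ ih =>
      exact (hstep n).stronger.cut (ih.weaken (Set.insert_subset_insert (Set.subset_insert _ _)))
  let T : Set Formula := {χ | ∃ n, Proves (insert (ψ n) Γ) χ}
  have hT {χ : Formula} (h : Proves T χ) : χ ∈ T := by
    obtain ⟨Δ, hs, hf, hp⟩ := h.finite
    choose! N hN using hs
    obtain ⟨n, hn⟩ := (hf.image N).bddAbove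
    exact ⟨n, hp.trans_finite hf fun δ hδ => mono (hn ⟨δ, hδ, rfl⟩) (hN hδ)⟩
  have hbot : Formula.bot ∉ T := fun ⟨n, hn⟩ => hcon n hn
  have hneg {χ : Formula} (h : χ.neg ∈ T) : χ ∉ T := fun h' =>
    hbot (hT (.impE (.ax h) (.ax h')))
  refine ⟨T, fun χ hχ => ⟨0, .ax (Set.mem_insert_of_mem _ hχ)⟩,
    hneg ⟨0, .ax (Set.mem_insert _ _)⟩, hT, hbot, fun χ => ?_, fun {θ} h => ?_, fun {θ} h => ?_⟩
  · obtain ⟨n, rfl⟩ := henum χ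
    exact (hstep n).decides.imp (fun h => ⟨n + 1, h⟩) fun h => ⟨n + 1, h.1⟩
  · obtain ⟨n, hn⟩ := henum (.allN θ)
    rcases (hstep n).decides with h' | h'
    · exact absurd ⟨n + 1, hn ▸ h'⟩ h
    · obtain ⟨t, ht⟩ := h'.2.1 θ hn
      exact ⟨t, hneg ⟨n + 1, ht⟩⟩
  · obtain ⟨n, hn⟩ := henum (.allS θ)
    rcases (hstep n).decides with h' | h'
    · exact absurd ⟨n + 1, hn ▸ h'⟩ h
    · obtain ⟨t, ht⟩ := h'.2.2 θ hn
      exact ⟨t, hneg ⟨n + 1, ht⟩⟩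


/-! ### Structures and satisfaction -/

section Semantics

variable {M : Type} [Zero M] [One M] [Add M] [Mul M]

/-- The value of a number term. -/
def Term.eval (ρ : ℕ → M) : Term → M
  | .var k => ρ k
  | .zero => 0
  | .one => 1
  | .add t u => t.eval ρ + u.eval ρ
  | .mul t u => t.eval ρ * u.eval ρ

theorem Term.eval_subst (t : Term) (σ : ℕ → Term) (ρ : ℕ → M) :
    (t.subst σ).eval ρ = t.eval fun k => (σ k).eval ρ := by
  induction t with
  | var k => rfl
  | zero => rfl
  | one => rfl
  | add t u iht ihu => simp only [Term.subst, Term.eval, iht, ihu]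
  | mul t u iht ihu => simp only [Term.subst, Term.eval, iht, ihu]

theorem Term.eval_shift (t : Term) (x : M) (ρ : ℕ → M) :
    t.shift.eval (cons x ρ) = t.eval ρ := Term.eval_subst _ _ _

variable [LT M]

/-- Satisfaction in the structure with number domain `M` and with the sets `sets k`, under the
assignments `ρ` and `s`. -/
def Formula.Sat (sets : ℕ → Set M) : (ℕ → M) → (ℕ → Set M) → Formula → Prop
  | ρ, _, .eq t u => t.eval ρ = u.eval ρ
  | ρ, _, .lt t u => t.eval ρ < u.eval ρ
  | ρ, s, .mem t X => t.eval ρ ∈ s X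
  | _, _, .bot => False
  | ρ, s, .imp φ ψ => φ.Sat sets ρ s → ψ.Sat sets ρ s
  | ρ, s, .allN φ => ∀ x : M, φ.Sat sets (cons x ρ) s
  | ρ, s, .allS φ => ∀ k : ℕ, φ.Sat sets ρ (cons (sets k) s)

variable {sets : ℕ → Set M} {ρ : ℕ → M} {s : ℕ → Set M}

theorem Formula.sat_neg {φ : Formula} : φ.neg.Sat sets ρ s ↔ ¬ φ.Sat sets ρ s := Iff.rfl

theorem Formula.sat_imp {φ ψ : Formula} :
    (φ.imp ψ).Sat sets ρ s ↔ (φ.Sat sets ρ s → ψ.Sat sets ρ s) := Iff.rfl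

theorem Formula.sat_and {φ ψ : Formula} :
    (φ.and ψ).Sat sets ρ s ↔ φ.Sat sets ρ s ∧ ψ.Sat sets ρ s := by
  simp only [Formula.and, Formula.sat_neg, Formula.sat_imp, Classical.not_imp, not_not]

theorem Formula.sat_or {φ ψ : Formula} :
    (φ.or ψ).Sat sets ρ s ↔ φ.Sat sets ρ s ∨ ψ.Sat sets ρ s := by
  simp only [Formula.or, Formula.sat_neg, Formula.sat_imp, or_iff_not_imp_left]

theorem Formula.sat_iff {φ ψ : Formula} :
    (φ.iff ψ).Sat sets ρ s ↔ (φ.Sat sets ρ s ↔ ψ.Sat sets ρ s) := by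
  simp only [Formula.iff, Formula.sat_and, Formula.sat_imp, iff_iff_implies_and_implies]

theorem Formula.sat_allN {φ : Formula} :
    φ.allN.Sat sets ρ s ↔ ∀ x, φ.Sat sets (cons x ρ) s := Iff.rfl

theorem Formula.sat_allS {φ : Formula} :
    φ.allS.Sat sets ρ s ↔ ∀ k, φ.Sat sets ρ (cons (sets k) s) := Iff.rfl

theorem Formula.sat_exN {φ : Formula} :
    φ.exN.Sat sets ρ s ↔ ∃ x, φ.Sat sets (cons x ρ) s := by
  simp only [Formula.exN, Formula.sat_neg, Formula.sat_allN, not_forall, not_not]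

theorem Formula.sat_exS {φ : Formula} :
    φ.exS.Sat sets ρ s ↔ ∃ k, φ.Sat sets ρ (cons (sets k) s) := by
  simp only [Formula.exS, Formula.sat_neg, Formula.sat_allS, not_forall, not_not]

theorem Formula.sat_subst (φ : Formula) (σ : ℕ → Term) (τ : ℕ → ℕ) :
    (φ.subst σ τ).Sat sets ρ s ↔ φ.Sat sets (fun k => (σ k).eval ρ) fun k => s (τ k) := by
  induction φ generalizing σ τ ρ s with
  | eq t u => simp only [Formula.subst, Formula.Sat, Term.eval_subst]
  | lt t u => simp only [Formula.subst, Formula.Sat, Term.eval_subst]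
  | mem t X => simp only [Formula.subst, Formula.Sat, Term.eval_subst]
  | bot => rfl
  | imp φ ψ ihφ ihψ => simp only [Formula.subst, Formula.Sat, ihφ, ihψ]
  | allN φ ih =>
    simp only [Formula.subst, Formula.Sat, ih]
    refine forall_congr' fun x => iff_of_eq ?_
    congr 1
    rw [cons_comp (fun t : Term => t.eval (cons x ρ))]
    simp only [Term.eval_shift]
    rfl
  | allS φ ih =>
    simp only [Formula.subst, Formula.Sat, ih]
    refine forall_congr' fun k => iff_of_eq ?_
    congr 1
    rw [cons_comp (cons (sets k) s)]
    rfl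

/-- A universal closure entails its matrix under every assignment that continues the variables
quantified by the closure by the given assignment. -/
theorem Formula.sat_of_sat_closure {φ : Formula} (h : ∀ (ρ : ℕ → M) (τ : ℕ → ℕ),
    φ.closure.Sat sets ρ fun k => sets (τ k)) (ρ : ℕ → M) : φ.Sat sets ρ sets := by
  have hN (n : ℕ) (ψ : Formula) (s : ℕ → Set M) (ρ : ℕ → M)
      (h : (Formula.allN^[n] ψ).Sat sets (fun k => ρ (k + n)) s) : ψ.Sat sets ρ s := by
    induction n generalizing ρ ψ with
    | zero => exact h
    | succ n ih =>
      rw [Function.iterate_succ_apply'] at h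
      refine ih ψ ρ ?_
      convert h (ρ n) using 1
      funext k
      cases k with
      | zero => simp [cons]
      | succ k => exact congrArg ρ (show k + 1 + n = k + (n + 1) by omega)
  have hS (n : ℕ) (ψ : Formula) (ρ : ℕ → M) (τ : ℕ → ℕ)
      (h : (Formula.allS^[n] ψ).Sat sets ρ fun k => sets (τ (k + n))) :
      ψ.Sat sets ρ fun k => sets (τ k) := by
    induction n generalizing τ ψ with
    | zero => exact h
    | succ n ih =>
      rw [Function.iterate_succ_apply'] at h
      refine ih ψ τ ?_
      convert h (τ n) using 1
      funext k
      cases k with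
      | zero => simp [cons]
      | succ k => exact congrArg (fun k => sets (τ k)) (show k + 1 + n = k + (n + 1) by omega)
  exact hS _ _ _ id (hN _ _ _ _ (h (fun k => ρ (k + φ.boundN)) fun k => id (k + φ.boundS)))

end Semantics

/-! ### The model of a Henkin set -/

namespace Henkin

variable {T : Set Formula}

theorem imp_mem (hT : Henkin T) {φ ψ : Formula} : φ.imp ψ ∈ T ↔ (φ ∈ T → ψ ∈ T) := by
  refine ⟨fun h h' => hT.closed (.impE (.ax h) (.ax h')), fun h => ?_⟩
  rcases hT.complete φ with hφ | hφ
  · exact hT.closed (.impI (.ax (Set.mem_insert_of_mem _ (h hφ))))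
  · exact hT.closed (.impI (.exfalso _ (.impE (φ := φ) (.ax (Set.mem_insert_of_mem _ hφ))
      (.ax (Set.mem_insert _ _)))))

theorem allN_mem (hT : Henkin T) {φ : Formula} : φ.allN ∈ T ↔ ∀ t, φ.instN t ∈ T :=
  ⟨fun h t => hT.closed (.allNE t (.ax h)), fun h => by
    by_contra h'
    obtain ⟨t, ht⟩ := hT.witnessN h'
    exact ht (h t)⟩

theorem allS_mem (hT : Henkin T) {φ : Formula} : φ.allS ∈ T ↔ ∀ X, φ.instS X ∈ T :=
  ⟨fun h X => hT.closed (.allSE X (.ax h)), fun h => by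
    by_contra h'
    obtain ⟨X, hX⟩ := hT.witnessS h'
    exact hX (h X)⟩

theorem eq_subst (hT : Henkin T) {t u : Term} (φ : Formula) (h : Formula.eq t u ∈ T)
    (h' : φ.instN t ∈ T) :
    φ.instN u ∈ T := hT.closed (.eqSubst (.ax h) (.ax h'))

theorem eq_symm (hT : Henkin T) {t u : Term} (h : Formula.eq t u ∈ T) : Formula.eq u t ∈ T := by
  have := hT.eq_subst (.eq (.var 0) t.shift) h
  simp only [Formula.instN, Formula.subst, Term.shift_subst_var] at this
  exact this (hT.closed (.eqRefl t))

theorem eq_trans (hT : Henkin T) {t u v : Term} (h : Formula.eq t u ∈ T) (h' : Formula.eq u v ∈ T) :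
    Formula.eq t v ∈ T := by
  have := hT.eq_subst (.eq t.shift (.var 0)) h'
  simp only [Formula.instN, Formula.subst, Term.shift_subst_var] at this
  exact this h

/-- Terms up to provable equality. -/
def setoid (hT : Henkin T) : Setoid Term where
  r t u := Formula.eq t u ∈ T
  iseqv := ⟨fun t => hT.closed (.eqRefl t), hT.eq_symm, hT.eq_trans⟩

theorem eq_congr₂ (hT : Henkin T) (f : Term → Term → Term)
    (hf : ∀ t u σ, (f t u).subst σ = f (t.subst σ) (u.subst σ)) {t t' u u' : Term}
    (h : Formula.eq t t' ∈ T) (h' : Formula.eq u u' ∈ T) :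
    Formula.eq (f t u) (f t' u') ∈ T := by
  have h₁ := hT.eq_subst (.eq (f t u).shift (f (.var 0) u.shift)) h
  have h₂ := hT.eq_subst (.eq (f t u).shift (f t'.shift (.var 0))) h'
  simp only [Formula.instN, Formula.subst, Term.shift_subst_var, hf] at h₁ h₂
  exact h₂ (h₁ (hT.closed (.eqRefl _)))

theorem lt_congr (hT : Henkin T) {t t' u u' : Term} (h : Formula.eq t t' ∈ T)
    (h' : Formula.eq u u' ∈ T)
    (hlt : Formula.lt t u ∈ T) : Formula.lt t' u' ∈ T := by
  have h₁ := hT.eq_subst (.lt (.var 0) u.shift) h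
  have h₂ := hT.eq_subst (.lt t'.shift (.var 0)) h'
  simp only [Formula.instN, Formula.subst, Term.shift_subst_var] at h₁ h₂
  exact h₂ (h₁ hlt)

theorem mem_congr (hT : Henkin T) {t t' : Term} (X : ℕ) (h : Formula.eq t t' ∈ T)
    (hmem : Formula.mem t X ∈ T) : Formula.mem t' X ∈ T :=
  hT.eq_subst (.mem (.var 0) X) h hmem

end Henkin

/-- **Completeness**: a formula that is not derivable from a set of closed formulas fails in a
structure in which these formulas hold. Moreover every element of the structure is the value of a
term under a fixed assignment `nums`, and `sets` enumerates the sets of the structure; so all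
parameters are available to formulas without further ado. -/
theorem exists_model {Γ : Set Formula} (hΓ : ∀ χ ∈ Γ, χ.IsClosed) {φ : Formula}
    (hφ : ¬ Proves Γ φ) :
    ∃ (M : Type) (_ : Zero M) (_ : One M) (_ : Add M) (_ : Mul M) (_ : LT M)
      (nums : ℕ → M) (sets : ℕ → Set M),
      (∀ m, ∃ t : Term, t.eval nums = m) ∧
      (∀ χ ∈ Γ, ∀ (ρ : ℕ → M) (τ : ℕ → ℕ), χ.Sat sets ρ fun k => sets (τ k)) ∧
      ¬ φ.Sat sets nums sets := by
  obtain ⟨T, hΓT, hφT, hT⟩ := exists_henkin hΓ hφ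
  let M : Type := Quotient hT.setoid
  let mk : Term → M := Quotient.mk hT.setoid
  let _ : Zero M := ⟨mk .zero⟩
  let _ : One M := ⟨mk .one⟩
  let _ : Add M := ⟨Quotient.map₂ .add fun _ _ h _ _ h' =>
    hT.eq_congr₂ .add (fun _ _ _ => rfl) h h'⟩
  let _ : Mul M := ⟨Quotient.map₂ .mul fun _ _ h _ _ h' =>
    hT.eq_congr₂ .mul (fun _ _ _ => rfl) h h'⟩
  let _ : LT M := ⟨Quotient.lift₂ (fun t u => Formula.lt t u ∈ T) fun _ _ _ _ h h' =>
    propext ⟨hT.lt_congr h h', hT.lt_congr (hT.eq_symm h) (hT.eq_symm h')⟩⟩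
  let sets : ℕ → Set M := fun X => {m | Quotient.lift (fun t => Formula.mem t X ∈ T)
    (fun _ _ h => propext ⟨hT.mem_congr X h, hT.mem_congr X (hT.eq_symm h)⟩) m}
  have heval (t : Term) (σ : ℕ → Term) : t.eval (fun k => mk (σ k)) = mk (t.subst σ) := by
    induction t with
    | var k => rfl
    | zero => rfl
    | one => rfl
    | add t u iht ihu => simp only [Term.eval, iht, ihu]; rfl
    | mul t u iht ihu => simp only [Term.eval, iht, ihu]; rfl
  have truth (χ : Formula) (σ : ℕ → Term) (τ : ℕ → ℕ) :
      χ.Sat sets (fun k => mk (σ k)) (fun k => sets (τ k)) ↔ χ.subst σ τ ∈ T := by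
    induction χ generalizing σ τ with
    | eq t u => simp only [Formula.Sat, heval]; exact Quotient.eq
    | lt t u => simp only [Formula.Sat, heval]; rfl
    | mem t X => simp only [Formula.Sat, heval]; rfl
    | bot => exact ⟨False.elim, hT.consistent⟩
    | imp φ ψ ihφ ihψ => simp only [Formula.Sat, Formula.subst, hT.imp_mem, ihφ, ihψ]
    | allN φ ih =>
      simp only [Formula.Sat, Formula.subst, hT.allN_mem]
      have hx (t : Term) : φ.Sat sets (cons (mk t) fun k => mk (σ k)) (fun k => sets (τ k)) ↔
          (φ.subst (cons (.var 0) fun k => (σ k).shift) τ).instN t ∈ T := by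
        rw [← cons_comp mk, ih, Formula.instN, Formula.subst_subst]
        refine iff_of_eq (congrArg (· ∈ T) ?_)
        congr 1
        funext k
        cases k with
        | zero => rfl
        | succ k => exact (Term.shift_subst_var _ _).symm
      exact ⟨fun h t => (hx t).1 (h _), fun h x => Quotient.inductionOn x fun t => (hx t).2 (h t)⟩
    | allS φ ih =>
      simp only [Formula.Sat, Formula.subst, hT.allS_mem]
      refine forall_congr' fun X => ?_
      rw [← cons_comp sets, ih, Formula.instS, Formula.subst_subst]
      refine iff_of_eq (congrArg (· ∈ T) ?_)
      congr 1
      · funext k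
        exact (Term.subst_var _).symm
      · funext k
        cases k <;> rfl
  refine ⟨M, inferInstance, inferInstance, inferInstance, inferInstance, inferInstance,
    fun k => mk (.var k), sets, fun m => ?_, fun χ hχ ρ τ => ?_, fun h => hφT ?_⟩
  · obtain ⟨t, rfl⟩ := Quotient.exists_rep m
    exact ⟨t, (heval t .var).trans (congrArg mk t.subst_var)⟩
  · obtain ⟨σ, rfl⟩ : ∃ σ : ℕ → Term, ρ = fun k => mk (σ k) :=
      ⟨fun k => (ρ k).out, funext fun k => (Quotient.out_eq _).symm⟩
    rw [truth, hΓ χ hχ]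
    exact hΓT hχ
  · have := (truth φ .var id).1 h
    rwa [Formula.subst_id] at this


/-! ### The meaning of formulas with bound names -/

/-- A point of evaluation: the numbers of quantifiers passed so far, and the current assignments. -/
structure World (M : Type) where
  depthN : ℕ
  nums : ℕ → M
  depthS : ℕ
  sets : ℕ → Set M

/-- `w ≤ w'` if `w'` is reached from `w` by passing further quantifiers. -/
instance {M : Type} : Preorder (World M) where
  le w w' := (∃ d, w'.depthN = w.depthN + d ∧ ∀ k, w'.nums (k + d) = w.nums k) ∧
    ∃ d, w'.depthS = w.depthS + d ∧ ∀ k, w'.sets (k + d) = w.sets k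
  le_refl w := ⟨⟨0, rfl, fun _ => rfl⟩, 0, rfl, fun _ => rfl⟩
  le_trans := by
    rintro w w' w'' ⟨⟨d, h, hd⟩, e, g, he⟩ ⟨⟨d', h', hd'⟩, e', g', he'⟩
    refine ⟨⟨d + d', by omega, fun k => ?_⟩, e + e', by omega, fun k => ?_⟩
    · rw [← add_assoc, hd', hd]
    · rw [← add_assoc, he', he]

section Meaning

variable {M : Type} {S : ℕ → Set M} {w w' : World M} {t u : Tm} {m n : M} {X : Sv} {Y : Set M}
  {φ ψ : Fm} {P Q : Prop}

/-- The point of evaluation below a number quantifier. -/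
def World.consN (w : World M) (x : M) : World M :=
  ⟨w.depthN + 1, cons x w.nums, w.depthS, w.sets⟩

/-- The point of evaluation below a set quantifier. -/
def World.consS (w : World M) (Y : Set M) : World M :=
  ⟨w.depthN, w.nums, w.depthS + 1, cons Y w.sets⟩

theorem World.le_consN (x : M) : w ≤ w.consN x :=
  ⟨⟨1, rfl, fun _ => rfl⟩, 0, rfl, fun _ => rfl⟩

theorem World.le_consS (Y : Set M) : w ≤ w.consS Y :=
  ⟨⟨0, rfl, fun _ => rfl⟩, 1, rfl, fun _ => rfl⟩

/-- The variable bound by a number quantifier that stands at `w`. -/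
def World.varN (w : World M) : Tm := fun a => .var (a - (w.depthN + 1))

/-- The variable bound by a set quantifier that stands at `w`. -/
def World.varS (w : World M) : Sv := fun b => b - (w.depthS + 1)

/-- The expression `X` has the value `Y` at `w` and at all later points of evaluation. -/
class DenS (w : World M) (X : Sv) (Y : Set M) : Prop where
  den : ∀ w', w ≤ w' → w'.sets (X w'.depthS) = Y

instance DenS.consN [h : DenS w X Y] (x : M) : DenS (w.consN x) X Y :=
  ⟨fun _ h' => h.den _ ((World.le_consN x).trans h')⟩

instance DenS.consS [h : DenS w X Y] (Z : Set M) : DenS (w.consS Z) X Y :=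
  ⟨fun _ h' => h.den _ ((World.le_consS Z).trans h')⟩

instance denS_varS (Y : Set M) : DenS (w.consS Y) w.varS Y := by
  refine ⟨?_⟩
  rintro w' ⟨-, d, hd, h⟩
  have : w'.depthS - (w.depthS + 1) = 0 + d := by simp only [hd, World.consS]; omega
  simp only [World.varS, this, h]
  rfl

variable [Zero M] [One M] [Add M] [Mul M]

/-- The expression `t` has the value `m` at `w` and at all later points of evaluation. -/
class DenT (w : World M) (t : Tm) (m : M) : Prop where
  den : ∀ w', w ≤ w' → (t w'.depthN).eval w'.nums = m

instance DenT.consN [h : DenT w t m] (x : M) : DenT (w.consN x) t m :=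
  ⟨fun _ h' => h.den _ ((World.le_consN x).trans h')⟩

instance DenT.consS [h : DenT w t m] (Z : Set M) : DenT (w.consS Z) t m :=
  ⟨fun _ h' => h.den _ ((World.le_consS Z).trans h')⟩

instance denT_add [h : DenT w t m] [h' : DenT w u n] : DenT w (t + u) (m + n) :=
  ⟨fun w' hw => congrArg₂ (· + ·) (h.den w' hw) (h'.den w' hw)⟩

instance denT_mul [h : DenT w t m] [h' : DenT w u n] : DenT w (t * u) (m * n) :=
  ⟨fun w' hw => congrArg₂ (· * ·) (h.den w' hw) (h'.den w' hw)⟩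

instance denT_zero : DenT w 0 (0 : M) := ⟨fun _ _ => rfl⟩

instance denT_one : DenT w 1 (1 : M) := ⟨fun _ _ => rfl⟩

instance denT_varN (x : M) : DenT (w.consN x) w.varN x := by
  refine ⟨?_⟩
  rintro w' ⟨⟨d, hd, h⟩, -⟩
  have : w'.depthN - (w.depthN + 1) = 0 + d := by simp only [hd, World.consN]; omega
  simp only [World.varN, Term.eval, this, h]
  rfl

variable [LT M]

/-- The expression `φ` means `P` at `w`, in the structure with the sets `S k`. -/
class DenF (S : ℕ → Set M) (w : World M) (φ : Fm) (P : Prop) : Prop where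
  den : (φ w.depthN w.depthS).Sat S w.nums w.sets ↔ P

instance den_eq [h : DenT w t m] [h' : DenT w u n] : DenF S w (t =ₙ u) (m = n) :=
  ⟨by simp only [fEq, Formula.Sat, h.den w le_rfl, h'.den w le_rfl]⟩

instance den_lt [h : DenT w t m] [h' : DenT w u n] : DenF S w (t <ₙ u) (m < n) :=
  ⟨by simp only [fLt, Formula.Sat, h.den w le_rfl, h'.den w le_rfl]⟩

instance den_mem [h : DenT w t m] [h' : DenS w X Y] : DenF S w (t ∈ₛ X) (m ∈ Y) :=
  ⟨by simp only [fMem, Formula.Sat, h.den w le_rfl, h'.den w le_rfl]⟩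

instance den_not [h : DenF S w φ P] : DenF S w (∼ₗφ) (¬ P) :=
  ⟨not_congr h.den⟩

instance den_imp [h : DenF S w φ P] [h' : DenF S w ψ Q] : DenF S w (φ ⇒ₗ ψ) (P → Q) :=
  ⟨imp_congr h.den h'.den⟩

instance den_and [h : DenF S w φ P] [h' : DenF S w ψ Q] : DenF S w (φ ∧ₗ ψ) (P ∧ Q) :=
  ⟨Formula.sat_and.trans (and_congr h.den h'.den)⟩

instance den_or [h : DenF S w φ P] [h' : DenF S w ψ Q] : DenF S w (φ ∨ₗ ψ) (P ∨ Q) :=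
  ⟨Formula.sat_or.trans (or_congr h.den h'.den)⟩

instance den_iff [h : DenF S w φ P] [h' : DenF S w ψ Q] : DenF S w (φ ⇔ₗ ψ) (P ↔ Q) :=
  ⟨Formula.sat_iff.trans (iff_congr h.den h'.den)⟩

instance den_all {φ : Tm → Fm} {P : M → Prop} [h : ∀ x, DenF S (w.consN x) (φ w.varN) (P x)] :
    DenF S w (all φ) (∀ x, P x) :=
  ⟨forall_congr' fun x => (h x).den⟩

instance den_ex {φ : Tm → Fm} {P : M → Prop} [h : ∀ x, DenF S (w.consN x) (φ w.varN) (P x)] :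
    DenF S w (ex φ) (∃ x, P x) :=
  ⟨Formula.sat_exN.trans <| exists_congr fun x => (h x).den⟩

instance den_allSet {φ : Sv → Fm} {P : Set M → Prop}
    [h : ∀ Y, DenF S (w.consS Y) (φ w.varS) (P Y)] :
    DenF S w (allSet φ) (∀ Y ∈ Set.range S, P Y) :=
  ⟨(forall_congr' fun k => (h (S k)).den).trans Set.forall_mem_range.symm⟩

instance den_exSet {φ : Sv → Fm} {P : Set M → Prop}
    [h : ∀ Y, DenF S (w.consS Y) (φ w.varS) (P Y)] :
    DenF S w (exSet φ) (∃ Y ∈ Set.range S, P Y) :=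
  ⟨Formula.sat_exS.trans <| (exists_congr fun k => (h (S k)).den).trans Set.exists_range_iff.symm⟩

instance den_exUnique {φ : Tm → Fm} {P : M → Prop} [∀ x, DenF S (w.consN x) (φ w.varN) (P x)]
    [∀ x y, DenF S ((w.consN x).consN y) (φ (w.consN x).varN) (P y)] :
    DenF S w (exUnique φ) (∃! x, P x) := by
  unfold exUnique ExistsUnique
  infer_instance

/-- The basic axioms, read in a structure. -/
theorem basicAxioms_sat (h : ∀ χ ∈ RCA0, ∀ (ρ : ℕ → M) (τ : ℕ → ℕ), χ.Sat S ρ fun k => S (τ k)) :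
    (∀ x y z : M, x + y + z = x + (y + z)) ∧ (∀ x y : M, x + y = y + x) ∧
    (∀ x y z : M, x * y * z = x * (y * z)) ∧ (∀ x y : M, x * y = y * x) ∧
    (∀ x y z : M, x * (y + z) = x * y + x * z) ∧ (∀ x : M, x + 0 = x) ∧ (∀ x : M, x * 0 = 0) ∧
    (∀ x : M, x * 1 = x) ∧ (∀ x y z : M, x < y ∧ y < z → x < z) ∧ (∀ x : M, ¬ x < x) ∧
    (∀ x y : M, x < y ∨ x = y ∨ y < x) ∧ (∀ x y z : M, x < y → x + z < y + z) ∧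
    (∀ x y z : M, 0 < z ∧ x < y → x * z < y * z) ∧ (∀ x y : M, x < y → ∃ z, x + z = y) ∧
    (0 : M) < 1 ∧ (∀ x : M, 0 < x → 1 < x ∨ 1 = x) ∧ (∀ x : M, 0 < x ∨ 0 = x) := by
  have key : ∀ φ ∈ basicAxioms, ∀ P, (∀ w : World M, DenF S w φ P) → P := fun φ hφ P hP =>
    (hP ⟨0, fun _ => 0, 0, S⟩).den.1 (h _ (.inl ⟨φ, hφ, rfl⟩) _ id)
  simp only [basicAxioms, List.forall_mem_cons, leN] at key
  obtain ⟨k₁, k₂, k₃, k₄, k₅, k₆, k₇, k₈, k₉, k₁₀, k₁₁, k₁₂, k₁₃, k₁₄, k₁₅, k₁₆, k₁₇, -⟩ := key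
  refine ⟨k₁ _ fun w => ?_, k₂ _ fun w => ?_, k₃ _ fun w => ?_, k₄ _ fun w => ?_,
    k₅ _ fun w => ?_, k₆ _ fun w => ?_, k₇ _ fun w => ?_, k₈ _ fun w => ?_, k₉ _ fun w => ?_,
    k₁₀ _ fun w => ?_, k₁₁ _ fun w => ?_, k₁₂ _ fun w => ?_, k₁₃ _ fun w => ?_,
    k₁₄ _ fun w => ?_, k₁₅ _ fun w => ?_, k₁₆ _ fun w => ?_, k₁₇ _ fun w => ?_⟩
  all_goals infer_instance

end Meaning


/-! ### The notions of the sentence, read in a structure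

Each definition repeats the formal definition of the corresponding name, with the quantifiers
ranging over a structure. -/

/-- `(m, n) = (m + n)² + m`. -/
def cpair {M : Type} [Add M] [Mul M] (m n : M) : M := (m + n) * (m + n) + m

section Notions

variable {M : Type} [CommSemiring M] [LinearOrder M]

/-- The number `i` belongs to the finite set given by the triple `c`. -/
def InCode (i c : M) : Prop :=
  ∃ k m n, c = cpair (cpair k m) n ∧ i < k ∧ ∃ q, n = q * (m * (i + 1) + 1)

/-- The number `c` is a triple, and so gives a finite set. -/
def IsTriple (c : M) : Prop := ∃ k m n, c = cpair (cpair k m) n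

/-- The number `c` is the code of a finite set: the least triple that gives this set. -/
def FinCode (c : M) : Prop :=
  IsTriple c ∧ ∀ d, d < c ∧ IsTriple d → ¬ ∀ i, InCode i d ↔ InCode i c

/-- The number `s` codes a sequence of length `l`. -/
def IsSeq (s l : M) : Prop :=
  FinCode s ∧ (∀ u, InCode u s → ∃ i j, u = cpair i j ∧ i < l) ∧
  ∀ i, i < l → ∃! j, InCode (cpair i j) s

/-- The set of pairs `G` is a function from `D` to `E`. -/
def IsFun (G D E : M → Prop) : Prop :=
  (∀ u, G u → ∃ x y, u = cpair x y ∧ D x ∧ E y) ∧ ∀ x, D x → ∃! y, G (cpair x y)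

/-- The set `X` is finite in the sense of the structure. -/
def Bounded (X : Set M) : Prop := ∃ k, ∀ i, i ∈ X → i < k

/-- The number `v` belongs to the term with index `i` of the sequence of sets `A`. -/
def InSeq (A : Set M) (i v : M) : Prop := cpair i v ∈ A

/-- The sequence `A` enumerates an algebra of subsets of `V`. -/
def CountableAlgebra (V A : Set M) : Prop :=
  (∀ i v, InSeq A i v → v ∈ V) ∧ (∃ k, ∀ v, InSeq A k v ↔ v ∈ V) ∧
  (∀ i j, ∃ k, ∀ v, InSeq A k v ↔ (InSeq A i v ∨ InSeq A j v)) ∧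
  (∀ i j, ∃ k, ∀ v, InSeq A k v ↔ (InSeq A i v ∧ InSeq A j v)) ∧
  ∀ i, ∃ k, ∀ v, InSeq A k v ↔ (v ∈ V ∧ ¬ InSeq A i v)

/-- The algebra `A` contains all singletons. -/
def Atomic (V A : Set M) : Prop := ∀ v, v ∈ V → ∃ k, ∀ u, InSeq A k u ↔ u = v

/-- The number `R` codes a weak order on `X`. -/
def WeakOrder (X : Set M) (R : M) : Prop :=
  FinCode R ∧ (∀ u, InCode u R → ∃ x y, u = cpair x y ∧ x ∈ X ∧ y ∈ X) ∧
  (∀ x y, x ∈ X ∧ y ∈ X → InCode (cpair x y) R ∨ InCode (cpair y x) R) ∧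
  ∀ x y z, InCode (cpair x y) R ∧ InCode (cpair y z) R → InCode (cpair x z) R

/-- In the profile with index `i`, the voter `v` has the weak order coded by `R`. -/
def ProfileVal (F : Set M) (i v R : M) : Prop := InSeq F i (cpair v R)

/-- The sequence `F` consists of functions from voters to weak orders. -/
def Profiles (V X F : Set M) : Prop :=
  ∀ i, IsFun (fun u => InSeq F i u) (fun v => v ∈ V) fun R => WeakOrder X R

/-- In the profile with index `i`, the voter `v` ranks `y` at least as high as `x`. -/
def VoterLe (F : Set M) (i v x y : M) : Prop := ∃ R, ProfileVal F i v R ∧ InCode (cpair x y) R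

/-- In the profile with index `i`, the voter `v` ranks `y` above `x`. -/
def VoterLt (F : Set M) (i v x y : M) : Prop := VoterLe F i v x y ∧ ¬ VoterLe F i v y x

/-- Some function `μ` in the structure gives, for every profile and every two alternatives, the
index of the set of those voters who rank the second at least as high as the first. -/
def UniformlyMeasurable (S : ℕ → Set M) (V X A F : Set M) : Prop :=
  ∃ μ ∈ Set.range S, IsFun (fun u => u ∈ μ)
      (fun w => ∃ n x y, w = cpair (cpair n x) y ∧ x ∈ X ∧ y ∈ X) (fun k => k = k) ∧
    ∀ n x y v k, x ∈ X ∧ y ∈ X ∧ v ∈ V ∧ cpair (cpair (cpair n x) y) k ∈ μ →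
      (VoterLe F n v x y ↔ InSeq A k v)

/-- The number `p` codes an enumeration without repetitions, of length `l`, of the weak orders on
`X`. -/
def IsPerm (X : Set M) (p l : M) : Prop :=
  IsSeq p l ∧ (∀ i R, InCode (cpair i R) p → WeakOrder X R) ∧
  ∀ R, WeakOrder X R → ∃! i, InCode (cpair i R) p

/-- The pair of `p` and `s` is an argument of the function in `QPEmbedded`: an enumeration of
the weak orders and a sequence of at most as many indices of sets of voters. -/
def PermQPart (X : Set M) (p s k : M) : Prop := ∃ l, IsPerm X p l ∧ IsSeq s k ∧ 1 ≤ k ∧ k ≤ l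

/-- The voter `v` belongs to the set given by the entry `i` of `s`, which is not the last entry. -/
def InPart (A : Set M) (s k v i : M) : Prop :=
  i + 1 < k ∧ ∃ n, InCode (cpair i n) s ∧ InSeq A n v

/-- Some function `e` in the structure turns every quasi-partition of the voters into a profile
which is constant on its parts. -/
def QPEmbedded (S : ℕ → Set M) (V X A F : Set M) : Prop :=
  ∃ e ∈ Set.range S, IsFun (fun u => u ∈ e) (fun w => ∃ p s k, w = cpair p s ∧ PermQPart X p s k)
      (fun j => j = j) ∧
    ∀ p s k j v, PermQPart X p s k ∧ cpair (cpair p s) j ∈ e ∧ v ∈ V →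
      (∀ i, (InPart A s k v i ∧ ∀ i', InPart A s k v i' → i' = i) →
        ∃ R, InCode (cpair i R) p ∧ ProfileVal F j v R) ∧
      (¬ (∃! i, InPart A s k v i) →
        ∃ m R, m + 1 = k ∧ InCode (cpair m R) p ∧ ProfileVal F j v R)

/-- The sets `V`, `X`, `A`, `F` form a countable society in the structure with the sets `S k`. -/
def CountableSociety (S : ℕ → Set M) (V X A F : Set M) : Prop :=
  (∃ v, v ∈ V) ∧ Bounded X ∧
  (∃ x y z, x ∈ X ∧ y ∈ X ∧ z ∈ X ∧ ¬ x = y ∧ ¬ x = z ∧ ¬ y = z) ∧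
  CountableAlgebra V A ∧ Atomic V A ∧ Profiles V X F ∧ UniformlyMeasurable S V X A F ∧
  QPEmbedded S V X A F

/-- In the profile with index `i`, the society ranks `y` at least as high as `x`. -/
def SocialLe (σ : Set M) (i x y : M) : Prop := ∃ R, cpair i R ∈ σ ∧ InCode (cpair x y) R

/-- In the profile with index `i`, the society ranks `y` above `x`. -/
def SocialLt (σ : Set M) (i x y : M) : Prop := SocialLe σ i x y ∧ ¬ SocialLe σ i y x

/-- What all voters strictly prefer, society strictly prefers. -/
def Unanimity (V X F σ : Set M) : Prop :=
  ∀ x y i, x ∈ X ∧ y ∈ X → (∀ v, v ∈ V → VoterLt F i v x y) → SocialLt σ i x y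

/-- The social ranking of two alternatives depends only on how the voters rank these two. -/
def Independence (V X F σ : Set M) : Prop :=
  ∀ x y i j, x ∈ X ∧ y ∈ X →
    (∀ v a b, v ∈ V ∧ (a = x ∨ a = y) ∧ (b = x ∨ b = y) →
      (VoterLe F i v a b ↔ VoterLe F j v a b)) →
    ∀ a b, (a = x ∨ a = y) ∧ (b = x ∨ b = y) → (SocialLe σ i a b ↔ SocialLe σ j a b)

/-- The set `σ` is a social welfare function for the society. -/
def SocialWelfareFunction (V X F σ : Set M) : Prop :=
  IsFun (fun u => u ∈ σ) (fun i => i = i) (fun R => WeakOrder X R) ∧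
  Unanimity V X F σ ∧ Independence V X F σ

/-- Every voter has, in some profile, a strict preference that society does not share. -/
def NonDictatorial (V X F σ : Set M) : Prop :=
  ∀ v, v ∈ V → ∃ i x y, x ∈ X ∧ y ∈ X ∧ VoterLt F i v x y ∧ SocialLe σ i y x

end Notions

section Meaning

variable {M : Type} [CommSemiring M] [LinearOrder M] {S : ℕ → Set M} {w : World M}
  {t u v x : Tm} {k l m n : M} {V X A F σ : Sv} {V' X' A' F' σ' : Set M}

set_option synthInstance.maxSize 4096
set_option synthInstance.maxHeartbeats 400000

instance denT_pair [DenT w t m] [DenT w u n] : DenT w (pair t u) (cpair m n) := by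
  unfold pair cpair
  infer_instance

instance denT_triple [DenT w t m] [DenT w u n] [DenT w v k] :
    DenT w (triple t u v) (cpair (cpair m n) k) := by
  unfold triple
  infer_instance

instance den_leN [DenT w t m] [DenT w u n] : DenF S w (leN t u) (m ≤ n) := by
  unfold leN
  rw [le_iff_lt_or_eq]
  infer_instance

instance den_inCode [DenT w t m] [DenT w u n] : DenF S w (inCode t u) (InCode m n) := by
  unfold inCode InCode
  infer_instance

instance den_isTriple [DenT w t m] : DenF S w (isTriple t) (IsTriple m) := by
  unfold isTriple IsTriple
  infer_instance

instance den_finCode [DenT w t m] : DenF S w (finCode t) (FinCode m) := by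
  unfold finCode FinCode
  infer_instance

instance den_isSeq [DenT w t m] [DenT w u n] : DenF S w (isSeq t u) (IsSeq m n) := by
  unfold isSeq IsSeq entry
  infer_instance

instance den_finiteSet [DenS w V V'] : DenF S w (finiteSet V) (Bounded V') := by
  unfold finiteSet Bounded
  infer_instance

instance den_inSeq [DenS w A A'] [DenT w t m] [DenT w u n] :
    DenF S w (inSeq A t u) (InSeq A' m n) := by
  unfold inSeq InSeq
  infer_instance

instance den_countableAlgebra [DenS w V V'] [DenS w A A'] :
    DenF S w (countableAlgebra V A) (CountableAlgebra V' A') := by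
  unfold countableAlgebra CountableAlgebra
  infer_instance

instance den_atomic [DenS w V V'] [DenS w A A'] : DenF S w (atomic V A) (Atomic V' A') := by
  unfold atomic Atomic
  infer_instance

instance den_weakOrder [DenS w X X'] [DenT w t m] :
    DenF S w (weakOrder X t) (WeakOrder X' m) := by
  unfold weakOrder WeakOrder
  infer_instance

instance den_profileVal [DenS w F F'] [DenT w t m] [DenT w u n] [DenT w v k] :
    DenF S w (profileVal F t u v) (ProfileVal F' m n k) := by
  unfold profileVal ProfileVal
  infer_instance

instance den_profiles [DenS w V V'] [DenS w X X'] [DenS w F F'] :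
    DenF S w (profiles V X F) (Profiles V' X' F') := by
  unfold profiles Profiles isFun IsFun
  infer_instance

instance den_voterLe [DenS w F F'] [DenT w t m] [DenT w u n] [DenT w v k] [DenT w x l] :
    DenF S w (voterLe F t u v x) (VoterLe F' m n k l) := by
  unfold voterLe VoterLe
  infer_instance

instance den_voterLt [DenS w F F'] [DenT w t m] [DenT w u n] [DenT w v k] [DenT w x l] :
    DenF S w (voterLt F t u v x) (VoterLt F' m n k l) := by
  unfold voterLt VoterLt
  infer_instance

instance den_uniformlyMeasurable [DenS w V V'] [DenS w X X'] [DenS w A A'] [DenS w F F'] :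
    DenF S w (uniformlyMeasurable V X A F) (UniformlyMeasurable S V' X' A' F') := by
  unfold uniformlyMeasurable UniformlyMeasurable isFun IsFun
  infer_instance

instance den_isPerm [DenS w X X'] [DenT w t m] [DenT w u n] :
    DenF S w (isPerm X t u) (IsPerm X' m n) := by
  unfold isPerm IsPerm entry
  infer_instance

instance den_permQPart [DenS w X X'] [DenT w t m] [DenT w u n] [DenT w v k] :
    DenF S w (permQPart X t u v) (PermQPart X' m n k) := by
  unfold permQPart PermQPart
  infer_instance

instance den_inPart [DenS w A A'] [DenT w t m] [DenT w u n] [DenT w v k] [DenT w x l] :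
    DenF S w (inPart A t u v x) (InPart A' m n k l) := by
  unfold inPart InPart entry
  infer_instance

instance den_qpEmbedded [DenS w V V'] [DenS w X X'] [DenS w A A'] [DenS w F F'] :
    DenF S w (qpEmbedded V X A F) (QPEmbedded S V' X' A' F') := by
  unfold qpEmbedded QPEmbedded isFun IsFun entry
  infer_instance

instance den_countableSociety [DenS w V V'] [DenS w X X'] [DenS w A A'] [DenS w F F'] :
    DenF S w (countableSociety V X A F) (CountableSociety S V' X' A' F') := by
  unfold countableSociety CountableSociety
  infer_instance

instance den_socialLe [DenS w σ σ'] [DenT w t m] [DenT w u n] [DenT w v k] :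
    DenF S w (socialLe σ t u v) (SocialLe σ' m n k) := by
  unfold socialLe SocialLe
  infer_instance

instance den_socialLt [DenS w σ σ'] [DenT w t m] [DenT w u n] [DenT w v k] :
    DenF S w (socialLt σ t u v) (SocialLt σ' m n k) := by
  unfold socialLt SocialLt
  infer_instance

instance den_unanimity [DenS w V V'] [DenS w X X'] [DenS w F F'] [DenS w σ σ'] :
    DenF S w (unanimity V X F σ) (Unanimity V' X' F' σ') := by
  unfold unanimity Unanimity
  infer_instance

instance den_independence [DenS w V V'] [DenS w X X'] [DenS w F F'] [DenS w σ σ'] :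
    DenF S w (independence V X F σ) (Independence V' X' F' σ') := by
  unfold independence Independence
  infer_instance

instance den_socialWelfareFunction [DenS w V V'] [DenS w X X'] [DenS w F F'] [DenS w σ σ'] :
    DenF S w (socialWelfareFunction V X F σ) (SocialWelfareFunction V' X' F' σ') := by
  unfold socialWelfareFunction SocialWelfareFunction isFun IsFun
  infer_instance

instance den_nonDictatorial [DenS w V V'] [DenS w X X'] [DenS w F F'] [DenS w σ σ'] :
    DenF S w (nonDictatorial V X F σ) (NonDictatorial V' X' F' σ') := by
  unfold nonDictatorial NonDictatorial
  infer_instance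

/-- The formal sentence expresses Arrow's theorem in the structure. -/
theorem arrowTheorem_sat {nums : ℕ → M} : arrowTheorem.Sat S nums S ↔
    ∀ V ∈ Set.range S, ∀ X ∈ Set.range S, ∀ A ∈ Set.range S, ∀ F ∈ Set.range S,
      ∀ σ ∈ Set.range S, CountableSociety S V X A F ∧ Bounded V ∧
        SocialWelfareFunction V X F σ → ¬ NonDictatorial V X F σ :=
  DenF.den (S := S) (w := ⟨0, nums, 0, S⟩) (φ := allSet fun V => allSet fun X => allSet fun A =>
    allSet fun F => allSet fun σ => countableSociety V X A F ∧ₗ finiteSet V ∧ₗ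
      socialWelfareFunction V X F σ ⇒ₗ ∼ₗ(nonDictatorial V X F σ))

end Meaning


/-! ### Models of induction in which every element is named -/

/-- A discretely ordered semiring with a sequence of sets that satisfies `Σ⁰₁` induction, and in
which every element is named by a term under the assignment `nums`. -/
class NamedModel (M : Type) [CommSemiring M] [LinearOrder M] where
  nums : ℕ → M
  sets : ℕ → Set M
  named (m : M) : ∃ t : Term, t.eval nums = m
  one_le {x : M} : 0 < x → 1 ≤ x
  sat_induction {φ : Formula} : IsSigma01 φ → (SOA.induction φ).Sat sets nums sets

/-- To derive a formula in `RCA₀` it suffices to verify it in all named models. -/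
theorem proves_RCA0_of_sat {φ : Formula}
    (h : ∀ (M : Type) [CommSemiring M] [LinearOrder M] [IsStrictOrderedRing M]
      [CanonicallyOrderedAdd M] [N : NamedModel M], φ.Sat N.sets N.nums N.sets) :
    Proves RCA0 φ := by
  by_contra hφ
  obtain ⟨M, _, _, _, _, _, nums, sets, hnamed, hsat, hneg⟩ :=
    exists_model (fun _ => isClosed_of_mem_RCA0) hφ
  obtain ⟨add_assoc, add_comm, mul_assoc, mul_comm, mul_add, add_zero, mul_zero, mul_one,
    lt_trans, lt_irrefl, lt_tri, add_lt, mul_lt, sub, zero_lt_one, one_le, zero_le⟩ :=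
    basicAxioms_sat hsat
  let _ : CommSemiring M :=
    { add_assoc := add_assoc
      add_comm := add_comm
      add_zero := add_zero
      zero_add := fun x => (add_comm _ _).trans (add_zero x)
      mul_assoc := mul_assoc
      mul_comm := mul_comm
      mul_one := mul_one
      one_mul := fun x => (mul_comm _ _).trans (mul_one x)
      mul_zero := mul_zero
      zero_mul := fun x => (mul_comm _ _).trans (mul_zero x)
      left_distrib := mul_add
      right_distrib := fun x y z => by rw [mul_comm, mul_add, mul_comm z, mul_comm z]
      nsmul := nsmulRec
      npow := @npowRec M ⟨1⟩ ⟨(· * ·)⟩ }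
  let _ : LinearOrder M :=
    { le := fun x y => x < y ∨ x = y
      lt := (· < ·)
      le_refl := fun x => .inr rfl
      le_trans := by
        rintro x y z (hxy | rfl) (hyz | rfl)
        exacts [.inl (lt_trans _ _ _ ⟨hxy, hyz⟩), .inl hxy, .inl hyz, .inr rfl]
      le_antisymm := by
        rintro x y (hxy | rfl) (hyx | h)
        exacts [(lt_irrefl _ (lt_trans _ _ _ ⟨hxy, hyx⟩)).elim, h.symm, rfl, rfl]
      lt_iff_le_not_ge := fun x y => ⟨fun h => ⟨.inl h, by
          rintro (h' | rfl)
          exacts [lt_irrefl _ (lt_trans _ _ _ ⟨h, h'⟩), lt_irrefl _ h]⟩, by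
        rintro ⟨h | rfl, h'⟩
        exacts [h, (h' (.inr rfl)).elim]⟩
      le_total := fun x y => by
        rcases lt_tri x y with h | h | h
        exacts [.inl (.inl h), .inl (.inr h), .inr (.inl h)]
      toDecidableLE := Classical.decRel _ }
  have hadd (x y : M) (hxy : x ≤ y) (z : M) : x + z ≤ y + z := by
    rcases hxy with h | rfl
    exacts [.inl (add_lt _ _ _ h), le_rfl]
  have hcancel (x y z : M) (h : x + y ≤ x + z) : y ≤ z := by
    by_contra h'
    have := add_lt _ _ x (not_le.1 h')
    rw [add_comm z, add_comm y] at this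
    exact not_le_of_gt this h
  have : IsOrderedCancelAddMonoid M :=
    { add_le_add_left := hadd
      le_of_add_le_add_left := hcancel }
  have hmul (x y z : M) (h : 0 < z) (h' : x < y) : z * x < z * y := by
    rw [mul_comm z, mul_comm z]
    exact mul_lt _ _ _ ⟨h, h'⟩
  have : IsStrictOrderedRing M :=
    { zero_le_one := .inl zero_lt_one
      exists_pair_ne := ⟨0, 1, ne_of_lt zero_lt_one⟩
      mul_lt_mul_of_pos_left := fun z hz x y h => hmul x y z hz h
      mul_lt_mul_of_pos_right := fun z hz x y h => mul_lt x y z ⟨hz, h⟩ }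
  have : CanonicallyOrderedAdd M :=
    { exists_add_of_le := by
        rintro x y (h | rfl)
        · obtain ⟨z, hz⟩ := sub _ _ h
          exact ⟨z, hz.symm⟩
        · exact ⟨0, (add_zero _).symm⟩
      le_add_self := fun x y => by
        rcases zero_le y with h | h
        · have := add_lt _ _ x h
          rw [add_comm 0, add_zero] at this
          exact .inl this
        · rw [← h, add_comm, add_zero]
      le_self_add := fun x y => by
        rcases zero_le y with h | h
        · have := add_lt _ _ x h
          rw [add_comm 0, add_zero, add_comm y] at this
          exact .inl this
        · rw [← h, add_zero] }
  let N : NamedModel M :=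
    { nums := nums
      sets := sets
      named := hnamed
      one_le := fun {x} => one_le x
      sat_induction := fun hφ =>
        Formula.sat_of_sat_closure (hsat _ (.inr (.inl ⟨_, hφ, rfl⟩))) nums }
  exact hneg (h M (N := N))

/-! ### Definability -/

section Definability

variable {M : Type} [CommSemiring M] [LinearOrder M] [N : NamedModel M]

/-- A type of finite tuples of numbers. A tuple gives an assignment: its entries, read from the
right, followed by `nums`. -/
class Tuple (M : Type) [CommSemiring M] [LinearOrder M] [NamedModel M] (α : Type) where
  env : α → ℕ → M
  length : ℕ
  env_add (a : α) (k : ℕ) : env a (k + length) = NamedModel.nums k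

instance : Tuple M Unit := ⟨fun _ => N.nums, 0, fun _ _ => rfl⟩

instance {α : Type} [T : Tuple M α] : Tuple M (α × M) :=
  ⟨fun a => cons a.2 (T.env a.1), T.length + 1, fun a k => T.env_add a.1 k⟩

variable {α β : Type} [T : Tuple M α] [Tuple M β]

/-- The function `f` is given by a term, with parameters. -/
class IsTerm (f : α → M) : Prop where
  out : ∃ t : Term, ∀ a, t.eval (T.env a) = f a

/-- The relation `P` is defined by a bounded formula, with parameters. -/
class IsBdd (M : Type) [CommSemiring M] [LinearOrder M] [N : NamedModel M] {α : Type}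
    [T : Tuple M α] (P : α → Prop) : Prop where
  out : ∃ θ, IsBounded θ ∧ ∀ a, θ.Sat N.sets (T.env a) N.sets ↔ P a

/-- The relation `P` is `Σ⁰₁`, with parameters. -/
class IsSig (M : Type) [CommSemiring M] [LinearOrder M] [NamedModel M] {α : Type}
    [Tuple M α] (P : α → Prop) : Prop where
  out : ∃ Q : α × M → Prop, IsBdd M Q ∧ ∀ a, P a ↔ ∃ x, Q (a, x)

instance isTerm_const (m : M) : IsTerm (fun _ : α => m) := by
  obtain ⟨t, ht⟩ := N.named m
  refine ⟨t.subst fun k => .var (k + T.length), fun a => ?_⟩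
  rw [Term.eval_subst, ← ht]
  exact congrArg (fun ρ => t.eval ρ) (funext fun k => T.env_add a k)

instance isTerm_var₀ : IsTerm (fun q : α × M => q.2) := ⟨.var 0, fun _ => rfl⟩

instance isTerm_fst₁ {f : α → M} [hf : IsTerm f] : IsTerm (fun q : α × M => f q.1) := by
  obtain ⟨t, ht⟩ := hf.out
  exact ⟨t.shift, fun q => (Term.eval_shift t q.2 _).trans (ht q.1)⟩

instance isTerm_fst₂ {f : α → M} [hf : IsTerm f] : IsTerm (fun q : (α × M) × M => f q.1.1) :=
  isTerm_fst₁ (f := fun q : α × M => f q.1)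

instance isTerm_fst₃ {f : α → M} [hf : IsTerm f] :
    IsTerm (fun q : ((α × M) × M) × M => f q.1.1.1) :=
  isTerm_fst₁ (f := fun q : (α × M) × M => f q.1.1)

instance isTerm_fst₄ {f : α → M} [hf : IsTerm f] :
    IsTerm (fun q : (((α × M) × M) × M) × M => f q.1.1.1.1) :=
  isTerm_fst₁ (f := fun q : ((α × M) × M) × M => f q.1.1.1)

instance isTerm_fst₅ {f : α → M} [hf : IsTerm f] :
    IsTerm (fun q : ((((α × M) × M) × M) × M) × M => f q.1.1.1.1.1) :=
  isTerm_fst₁ (f := fun q : (((α × M) × M) × M) × M => f q.1.1.1.1)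

instance isTerm_add {f g : α → M} [hf : IsTerm f] [hg : IsTerm g] :
    IsTerm (fun a => f a + g a) := by
  obtain ⟨t, ht⟩ := hf.out
  obtain ⟨u, hu⟩ := hg.out
  exact ⟨.add t u, fun a => by simp only [Term.eval, ht, hu]⟩

instance isTerm_mul {f g : α → M} [hf : IsTerm f] [hg : IsTerm g] :
    IsTerm (fun a => f a * g a) := by
  obtain ⟨t, ht⟩ := hf.out
  obtain ⟨u, hu⟩ := hg.out
  exact ⟨.mul t u, fun a => by simp only [Term.eval, ht, hu]⟩

instance isTerm_cpair {f g : α → M} [IsTerm f] [IsTerm g] :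
    IsTerm (fun a => cpair (f a) (g a)) := by
  unfold cpair
  infer_instance

theorem IsBdd.congr {P Q : α → Prop} (hP : IsBdd M P) (h : ∀ a, Q a ↔ P a) : IsBdd M Q :=
  (funext fun a => propext (h a) : Q = P) ▸ hP

instance isBdd_eq {f g : α → M} [hf : IsTerm f] [hg : IsTerm g] :
    IsBdd M (fun a => f a = g a) := by
  obtain ⟨t, ht⟩ := hf.out
  obtain ⟨u, hu⟩ := hg.out
  exact ⟨_, .eq t u, fun a => by simp only [Formula.Sat, ht, hu]⟩

instance isBdd_lt {f g : α → M} [hf : IsTerm f] [hg : IsTerm g] :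
    IsBdd M (fun a => f a < g a) := by
  obtain ⟨t, ht⟩ := hf.out
  obtain ⟨u, hu⟩ := hg.out
  exact ⟨_, .lt t u, fun a => by simp only [Formula.Sat, ht, hu]⟩

instance isBdd_imp {P Q : α → Prop} [hP : IsBdd M P] [hQ : IsBdd M Q] :
    IsBdd M (fun a => P a → Q a) := by
  obtain ⟨φ, hφ, h⟩ := hP.out
  obtain ⟨ψ, hψ, h'⟩ := hQ.out
  exact ⟨_, .imp hφ hψ, fun a => imp_congr (h a) (h' a)⟩

instance isBdd_false : IsBdd M (fun _ : α => False) := ⟨_, .bot, fun _ => Iff.rfl⟩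

instance isBdd_not {P : α → Prop} [IsBdd M P] : IsBdd M (fun a => ¬ P a) := by
  unfold Not
  infer_instance

instance isBdd_and {P Q : α → Prop} [IsBdd M P] [IsBdd M Q] : IsBdd M (fun a => P a ∧ Q a) :=
  IsBdd.congr (P := fun a => ¬ (P a → ¬ Q a)) inferInstance fun a => by tauto

instance isBdd_or {P Q : α → Prop} [IsBdd M P] [IsBdd M Q] : IsBdd M (fun a => P a ∨ Q a) :=
  IsBdd.congr (P := fun a => ¬ P a → Q a) inferInstance fun a => by tauto

instance isBdd_iff {P Q : α → Prop} [IsBdd M P] [IsBdd M Q] : IsBdd M (fun a => P a ↔ Q a) :=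
  IsBdd.congr (P := fun a => (P a → Q a) ∧ (Q a → P a)) inferInstance fun a => by tauto

instance isBdd_le {f g : α → M} [IsTerm f] [IsTerm g] : IsBdd M (fun a => f a ≤ g a) :=
  IsBdd.congr (P := fun a => ¬ g a < f a) inferInstance fun _ => not_lt.symm

instance isBdd_forall {t : α → M} {P : α → M → Prop} [ht : IsTerm t]
    [hP : IsBdd M (fun q : α × M => P q.1 q.2)] : IsBdd M (fun a => ∀ x, x < t a → P a x) := by
  obtain ⟨u, hu⟩ := ht.out
  obtain ⟨φ, hφ, h⟩ := hP.out
  refine ⟨_, .ball u hφ, fun a => forall_congr' fun x => imp_congr ?_ (h (a, x))⟩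
  simp only [Formula.Sat, Term.eval_shift, hu]
  rfl

instance isBdd_exists {t : α → M} {P : α → M → Prop} [IsTerm t]
    [IsBdd M (fun q : α × M => P q.1 q.2)] : IsBdd M (fun a => ∃ x, x < t a ∧ P a x) :=
  IsBdd.congr (P := fun a => ¬ ∀ x, x < t a → ¬ P a x) inferInstance fun a => by
    push Not; rfl

theorem isBdd_mem {Y : Set M} (hY : Y ∈ Set.range N.sets) {f : α → M} [hf : IsTerm f] :
    IsBdd M (fun a => f a ∈ Y) := by
  obtain ⟨k, rfl⟩ := hY
  obtain ⟨t, ht⟩ := hf.out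
  exact ⟨_, .mem t k, fun a => by simp only [Formula.Sat, ht]⟩

theorem IsBounded.subst {θ : Formula} (h : IsBounded θ) (σ : ℕ → Term) (τ : ℕ → ℕ) :
    IsBounded (θ.subst σ τ) := by
  induction h generalizing σ τ with
  | eq t u => exact .eq _ _
  | lt t u => exact .lt _ _
  | mem t X => exact .mem _ _
  | bot => exact .bot
  | imp _ _ ih₁ ih₂ => exact .imp (ih₁ σ τ) (ih₂ σ τ)
  | ball t _ ih =>
    simp only [Formula.subst, ← Term.subst_shift]
    exact .ball _ (ih _ _)
  | bex t _ ih =>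
    simp only [Formula.exN, Formula.and, Formula.neg, Formula.subst, ← Term.subst_shift]
    exact .bex _ (ih _ _)

/-- Bounded definability is preserved under substitution of terms. -/
theorem IsBdd.comp {Q : β → Prop} (hQ : IsBdd M Q) (g : α → β)
    (hg : ∀ k, IsTerm fun a => Tuple.env (M := M) (g a) k) : IsBdd M fun a => Q (g a) := by
  obtain ⟨θ, hθ, h⟩ := hQ.out
  choose σ hσ using fun k => (hg k).out
  refine ⟨θ.subst σ id, hθ.subst σ id, fun a => ?_⟩
  rw [Formula.sat_subst, ← h]
  simp only [hσ]
  rfl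

theorem isTerm_env (k : ℕ) : IsTerm fun a : α => T.env a k := ⟨.var k, fun _ => rfl⟩

theorem IsBdd.comp_unary {Y : M → Prop} (hY : IsBdd M fun q : Unit × M => Y q.2) {f : α → M}
    [IsTerm f] : IsBdd M fun a => Y (f a) :=
  hY.comp (fun a => ((), f a)) fun k => by
    cases k with
    | zero => exact (inferInstance : IsTerm f)
    | succ k => exact isTerm_const (N.nums k)

instance isSig_of_isBdd {P : α → Prop} [hP : IsBdd M P] : IsSig M P :=
  ⟨fun q => P q.1, hP.comp Prod.fst fun k => isTerm_env (k + 1), fun _ => by simp⟩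

/-- `Σ⁰₁` induction. -/
theorem sig_induction {P : M → Prop} (hP : IsSig M fun q : Unit × M => P q.2) (h₀ : P 0)
    (h₁ : ∀ n, P n → P (n + 1)) (n : M) : P n := by
  obtain ⟨Q, hQ, hPQ⟩ := hP.out
  obtain ⟨θ, hθ, h⟩ := hQ.out
  have hs (ρ : ℕ → M) (m : M) (hρ : ρ = cons m N.nums) :
      (Formula.exN θ).Sat N.sets ρ N.sets ↔ P m := by
    subst hρ
    rw [Formula.sat_exN, hPQ ((), m)]
    exact exists_congr fun x => h (((), m), x)
  have := N.sat_induction ⟨θ, hθ, rfl⟩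
  refine (hs _ n rfl).1 (this (Formula.sat_and.2 ⟨?_, fun m hm => ?_⟩) n)
  · rw [Formula.instN, Formula.sat_subst]
    refine (hs _ 0 ?_).2 h₀
    funext k
    cases k <;> rfl
  · rw [Formula.sat_subst]
    refine (hs _ (m + 1) ?_).2 (h₁ m ((hs _ m rfl).1 hm))
    funext k
    cases k <;> rfl

end Definability


section Arithmetic

variable {M : Type} [CommSemiring M] [LinearOrder M] [IsStrictOrderedRing M]
  [CanonicallyOrderedAdd M]

/-! ### Arithmetic in a discretely ordered semiring -/

theorem dvd_of_dvd_add {p a b : M} (h : p ∣ a + b) (h' : p ∣ a) : p ∣ b := by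
  obtain ⟨c, hc⟩ := h
  obtain ⟨d, rfl⟩ := h'
  rcases le_total d c with hdc | hcd
  · obtain ⟨e, rfl⟩ := exists_add_of_le hdc
    exact ⟨e, by grind⟩
  · have : b = 0 := by
      have h₁ := mul_le_mul_of_nonneg_left hcd (zero_le : 0 ≤ p)
      have h₂ : 0 ≤ b := zero_le
      grind
    exact this ▸ dvd_zero p

variable [N : NamedModel M]

theorem lt_add_one_iff' {x y : M} : x < y + 1 ↔ x ≤ y := by
  refine ⟨fun h => ?_, fun h => h.trans_lt (lt_add_one y)⟩
  by_contra h'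
  obtain ⟨z, rfl⟩ := exists_add_of_le (not_le.1 h').le
  have : 0 < z := by grind
  have := N.one_le this
  grind

theorem eq_zero_or_succ (x : M) : x = 0 ∨ ∃ y, x = y + 1 := by
  rcases eq_or_ne x 0 with h | h
  · exact .inl h
  · obtain ⟨y, hy⟩ := exists_add_of_le (N.one_le (pos_iff_ne_zero.2 h))
    exact .inr ⟨y, by rw [hy, add_comm]⟩

theorem le_mul_self' (x : M) : x ≤ x * x := by
  rcases eq_zero_or_succ x with rfl | ⟨y, rfl⟩
  · simp
  · exact le_mul_of_one_le_right zero_le le_add_self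

theorem le_of_dvd' {a b : M} (h : a ∣ b) (hb : b ≠ 0) : a ≤ b := by
  obtain ⟨c, rfl⟩ := h
  exact le_mul_of_one_le_right zero_le (N.one_le (pos_iff_ne_zero.2 (right_ne_zero_of_mul hb)))

theorem le_cpair_left (m n : M) : m ≤ cpair m n := le_add_self

theorem le_cpair_right (m n : M) : n ≤ cpair m n := by
  have h₁ := le_mul_self' (m + n)
  have h₂ : 0 ≤ m := zero_le
  unfold cpair
  grind

theorem cpair_le_cpair {m m' n n' : M} (h : m ≤ m') (h' : n ≤ n') : cpair m n ≤ cpair m' n' := by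
  unfold cpair
  gcongr

theorem cpair_inj {a b c d : M} : cpair a b = cpair c d ↔ a = c ∧ b = d := by
  refine ⟨fun h => ?_, by rintro ⟨rfl, rfl⟩; rfl⟩
  -- The pair lies between the square of the sum and the next square, which gives the sum.
  have key (a b c d : M) (h : a + b < c + d) : cpair a b < cpair c d := by
    have h₁ : a + b + 1 ≤ c + d := by
      rw [← lt_add_one_iff']; exact add_lt_add_left h 1
    have h₂ : (a + b) * (a + b) + (a + b + (a + b) + 1) ≤ (c + d) * (c + d) :=
      (mul_le_mul h₁ h₁ zero_le zero_le).trans' (by ring_nf; rfl)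
    refine (lt_of_lt_of_le ?_ h₂).trans_le le_self_add
    refine add_lt_add_right (lt_add_one_iff'.2 ?_) _
    rw [add_assoc]
    exact le_self_add
  have hs : a + b = c + d := by
    rcases lt_trichotomy (a + b) (c + d) with h' | h' | h'
    · exact absurd h (key _ _ _ _ h').ne
    · exact h'
    · exact absurd h (key _ _ _ _ h').ne'
  unfold cpair at h
  rw [hs] at h
  grind

theorem inCode_triple {i k m n : M} :
    InCode i (cpair (cpair k m) n) ↔ i < k ∧ m * (i + 1) + 1 ∣ n := by
  constructor
  · rintro ⟨k', m', n', h, hi, q, hq⟩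
    obtain ⟨h', rfl⟩ := cpair_inj.1 h
    obtain ⟨rfl, rfl⟩ := cpair_inj.1 h'
    exact ⟨hi, q, by rw [hq, mul_comm]⟩
  · rintro ⟨hi, q, hq⟩
    exact ⟨k, m, n, rfl, hi, q, by rw [hq, mul_comm]⟩

theorem InCode.lt {i c : M} (h : InCode i c) : i < c := by
  obtain ⟨k, m, n, rfl, hi, -⟩ := h
  exact hi.trans_le ((le_cpair_left k m).trans (le_cpair_left _ n))

/-! ### Bounded definability of the coding notions -/

variable {α : Type} [T : Tuple M α]

instance isBdd_dvd {f g : α → M} [IsTerm f] [IsTerm g] : IsBdd M (fun a => f a ∣ g a) := by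
  refine IsBdd.congr (P := fun a => ∃ q, q < g a + 1 ∧ g a = f a * q) inferInstance fun a =>
    ⟨fun ⟨q, hq⟩ => ?_, fun ⟨q, _, hq⟩ => ⟨q, hq⟩⟩
  rcases eq_or_ne (g a) 0 with h | h
  · exact ⟨0, by simp [h], by simp [h]⟩
  · exact ⟨q, lt_add_one_iff'.2 (le_of_dvd' ⟨f a, by rw [hq, mul_comm]⟩ h), hq⟩

set_option synthInstance.maxSize 4096

instance isBdd_isTriple {f : α → M} [IsTerm f] : IsBdd M (fun a => IsTriple (f a)) := by
  refine IsBdd.congr (P := fun a => ∃ k, k < f a + 1 ∧ ∃ m, m < f a + 1 ∧ ∃ n, n < f a + 1 ∧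
    f a = cpair (cpair k m) n) inferInstance fun a => ⟨?_, ?_⟩
  · rintro ⟨k, m, n, h⟩
    simp only [lt_add_one_iff']
    refine ⟨k, ?_, m, ?_, n, ?_, h⟩
    · exact h ▸ (le_cpair_left k m).trans (le_cpair_left _ n)
    · exact h ▸ (le_cpair_right k m).trans (le_cpair_left _ n)
    · exact h ▸ le_cpair_right _ n
  · rintro ⟨k, -, m, -, n, -, h⟩
    exact ⟨k, m, n, h⟩

instance isBdd_inCode {f g : α → M} [IsTerm f] [IsTerm g] :
    IsBdd M (fun a => InCode (f a) (g a)) := by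
  refine IsBdd.congr (P := fun a => ∃ k, k < g a + 1 ∧ ∃ m, m < g a + 1 ∧ ∃ n, n < g a + 1 ∧
    g a = cpair (cpair k m) n ∧ f a < k ∧ m * (f a + 1) + 1 ∣ n) inferInstance fun a => ⟨?_, ?_⟩
  · rintro ⟨k, m, n, h, hi, q, hq⟩
    simp only [lt_add_one_iff']
    refine ⟨k, ?_, m, ?_, n, ?_, h, hi, q, by rw [hq, mul_comm]⟩
    · exact h ▸ (le_cpair_left k m).trans (le_cpair_left _ n)
    · exact h ▸ (le_cpair_right k m).trans (le_cpair_left _ n)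
    · exact h ▸ le_cpair_right _ n
  · rintro ⟨k, -, m, -, n, -, h, hi, q, hq⟩
    exact ⟨k, m, n, h, hi, q, by rw [hq, mul_comm]⟩

instance isBdd_finCode {f : α → M} [IsTerm f] : IsBdd M (fun a => FinCode (f a)) := by
  refine IsBdd.congr (P := fun a => IsTriple (f a) ∧ ∀ d, d < f a → IsTriple d →
    ¬ ∀ i, i < f a → (InCode i d ↔ InCode i (f a))) inferInstance fun a => ?_
  refine and_congr_right fun _ => forall_congr' fun d => and_imp.trans ?_
  refine forall_congr' fun hd => forall_congr' fun _ => not_congr ?_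
  exact ⟨fun h i _ => h i, fun h i =>
    ⟨fun hi => (h i (hi.lt.trans hd)).1 hi, fun hi => (h i hi.lt).2 hi⟩⟩

instance isSig_exists {P : α → M → Prop} [hP : IsSig M fun q : α × M => P q.1 q.2] :
    IsSig M (fun a => ∃ x, P a x) := by
  obtain ⟨Q, hQ, h⟩ := hP.out
  -- Two unbounded quantifiers are contracted to one quantifier over a common bound.
  have hQ' : IsBdd M fun q : ((α × M) × M) × M => Q ((q.1.1.1, q.1.2), q.2) :=
    hQ.comp (fun q : ((α × M) × M) × M => ((q.1.1.1, q.1.2), q.2)) fun k => by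
      match k with
      | 0 => exact isTerm_env 0
      | 1 => exact isTerm_env 1
      | k + 2 => exact isTerm_env (α := ((α × M) × M) × M) (k + 3)
  refine ⟨fun q => ∃ x, x < q.2 + 1 ∧ ∃ y, y < q.2 + 1 ∧ Q ((q.1, x), y), inferInstance,
    fun a => ⟨?_, ?_⟩⟩
  · rintro ⟨x, hx⟩
    obtain ⟨y, hy⟩ := (h (a, x)).1 hx
    exact ⟨x + y, x, lt_add_one_iff'.2 le_self_add, y, lt_add_one_iff'.2 le_add_self, hy⟩
  · rintro ⟨_, x, -, y, -, hxy⟩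
    exact ⟨x, (h (a, x)).2 ⟨y, hxy⟩⟩

/-! ### Codes of finite sets -/

theorem bdd_induction {P : M → Prop} (hP : IsBdd M fun q : Unit × M => P q.2) (h₀ : P 0)
    (h₁ : ∀ n, P n → P (n + 1)) (n : M) : P n :=
  sig_induction inferInstance h₀ h₁ n

/-- The least number principle. -/
theorem exists_least {P : M → Prop} (hP : IsBdd M fun q : Unit × M => P q.2) {n : M} (hn : P n) :
    ∃ m, P m ∧ ∀ k, k < m → ¬ P k := by
  by_contra! h
  have : IsBdd M fun q : (Unit × M) × M => P q.2 := hP.comp_unary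
  have key (n : M) : ∀ k, k < n → ¬ P k := by
    refine bdd_induction (P := fun n => ∀ k, k < n → ¬ P k) inferInstance
      (fun k hk => absurd hk not_lt_zero) (fun n ih k hk hPk => ?_) n
    obtain ⟨j, hj, hPj⟩ := h k hPk
    exact ih j (hj.trans_le (lt_add_one_iff'.1 hk)) hPj
  exact key (n + 1) n (lt_add_one n) hn

theorem exists_common_multiple (K : M) : ∃ m : M, m ≠ 0 ∧ ∀ i, i < K → i + 1 ∣ m := by
  refine sig_induction (P := fun K => ∃ m : M, m ≠ 0 ∧ ∀ i, i < K → i + 1 ∣ m) inferInstance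
    ⟨1, one_ne_zero, fun i hi => absurd hi not_lt_zero⟩ ?_ K
  · rintro k ⟨m, hm, h⟩
    refine ⟨m * (k + 1), mul_ne_zero hm (by positivity), fun i hi => ?_⟩
    rcases (lt_add_one_iff'.1 hi).lt_or_eq with hi | rfl
    · exact (h i hi).mul_right _
    · exact dvd_mul_left _ _

/-- If `m` is a multiple of `1, …, K`, then the moduli `m (i + 1) + 1` for `i < K` are relatively
prime in pairs. -/
theorem modulus_coprime {K m : M} (hm : ∀ i, i < K → i + 1 ∣ m) {i j : M} (hi : i < K) (hj : j < K)
    (hij : i ≠ j) {n : M} (h : m * (i + 1) + 1 ∣ n * (m * (j + 1) + 1)) :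
    m * (i + 1) + 1 ∣ n := by
  -- A combination of the two moduli is the difference of `i` and `j`, a divisor of `m`.
  have fin {d : M} (hd : d + 1 ∣ m) (h : m * (i + 1) + 1 ∣ n * (d + 1)) :
      m * (i + 1) + 1 ∣ n := by
    obtain ⟨f, hf⟩ := hd
    have h₁ : m * (i + 1) + 1 ∣ n * m * (i + 1) := by
      refine Dvd.dvd.mul_right ?_ _
      rw [hf, ← mul_assoc, ← hf]
      exact h.mul_right f
    refine dvd_of_dvd_add (a := n * m * (i + 1)) ?_ h₁
    exact ⟨n, by ring⟩
  rcases hij.lt_or_gt with hlt | hlt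
  · obtain ⟨d, rfl⟩ := exists_add_of_le hlt.le
    rcases eq_zero_or_succ d with rfl | ⟨d, rfl⟩
    · simp at hlt
    refine fin (hm d (lt_of_le_of_lt ?_ hj)) ?_
    · rw [← add_assoc]; exact le_self_add.trans' le_add_self
    · refine dvd_of_dvd_add (a := (i + 1) * (n * (m * (i + (d + 1) + 1) + 1))) ?_ (h.mul_left _)
      exact ⟨n * (i + (d + 1) + 1), by ring⟩
  · obtain ⟨d, rfl⟩ := exists_add_of_le hlt.le
    rcases eq_zero_or_succ d with rfl | ⟨d, rfl⟩
    · simp at hlt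
    refine fin (hm d (lt_of_le_of_lt ?_ hi)) ?_
    · rw [← add_assoc]; exact le_self_add.trans' le_add_self
    · refine dvd_of_dvd_add (a := n * (j + 1) * (m * (j + (d + 1) + 1) + 1)) ?_
        (dvd_mul_left _ _)
      obtain ⟨q, hq⟩ := h
      refine ⟨(j + (d + 1) + 1) * q, ?_⟩
      calc _ = (j + (d + 1) + 1) * (n * (m * (j + 1) + 1)) := by ring
        _ = _ := by rw [hq]; ring

/-- A product of the moduli: each of them divides it exactly once. -/
theorem exists_modulus_product {K m : M} (hm₀ : m ≠ 0) (hm : ∀ i, i < K → i + 1 ∣ m) :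
    ∃ n : M, n ≠ 0 ∧ ∀ i, i < K →
      m * (i + 1) + 1 ∣ n ∧ ¬ (m * (i + 1) + 1) * (m * (i + 1) + 1) ∣ n := by
  have hpos (i : M) : m * (i + 1) + 1 ≠ 0 := by positivity
  have key (k : M) : ∃ n : M, n ≠ 0 ∧ ∀ i, i < K →
      (i < k → m * (i + 1) + 1 ∣ n ∧ ¬ (m * (i + 1) + 1) * (m * (i + 1) + 1) ∣ n) ∧
      (k ≤ i → ¬ m * (i + 1) + 1 ∣ n) := by
    refine sig_induction (P := fun k => ∃ n : M, n ≠ 0 ∧ ∀ i, i < K →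
      (i < k → m * (i + 1) + 1 ∣ n ∧ ¬ (m * (i + 1) + 1) * (m * (i + 1) + 1) ∣ n) ∧
      (k ≤ i → ¬ m * (i + 1) + 1 ∣ n)) inferInstance ?_ ?_ k
    · refine ⟨1, one_ne_zero, fun i _ => ⟨fun h => absurd h not_lt_zero, fun _ h => ?_⟩⟩
      have h₁ := le_of_dvd' h one_ne_zero
      have h₂ : 0 < m * (i + 1) := pos_iff_ne_zero.2 (mul_ne_zero hm₀ (by positivity))
      grind
    · rintro k ⟨n, hn, h⟩
      by_cases hk : k < K
      swap
      · exact ⟨n, hn, fun i hi => ⟨fun _ => (h i hi).1 (hi.trans_le (not_lt.1 hk)),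
          fun h' => absurd ((lt_add_one k).trans_le (h'.trans hi.le)) hk⟩⟩
      refine ⟨n * (m * (k + 1) + 1), mul_ne_zero hn (hpos k), fun i hi => ⟨fun hik => ?_,
        fun hki hd => ?_⟩⟩
      · rcases (lt_add_one_iff'.1 hik).lt_or_eq with hik | rfl
        · obtain ⟨h₁, h₂⟩ := (h i hi).1 hik
          refine ⟨h₁.mul_right _, fun h₃ => h₂ ?_⟩
          obtain ⟨a, rfl⟩ := h₁
          rw [mul_assoc] at h₃
          exact mul_dvd_mul_left _ (modulus_coprime hm hi hk hik.ne
            ((mul_dvd_mul_iff_left (hpos i)).1 h₃))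
        · exact ⟨dvd_mul_left _ _, fun h₃ => (h i hi).2 le_rfl
            ((mul_dvd_mul_iff_right (hpos i)).1 h₃)⟩
      · have hki' : k < i := (lt_add_one k).trans_le hki
        exact (h i hi).2 hki'.le (modulus_coprime hm hi hk hki'.ne' hd)
  obtain ⟨n, hn, h⟩ := key K
  exact ⟨n, hn, fun i hi => (h i hi).1 hi⟩

/-- Every boundedly definable subset of `{i | i < K}` is given by a triple below a bound that
depends only on `K`: the last entry of the triple can be taken among the divisors of the product
of the moduli, by removing the moduli of the elements outside the set one after the other. -/
theorem exists_triple (K : M) : ∃ B : M, ∀ Y : M → Prop, IsBdd M (fun q : Unit × M => Y q.2) →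
    ∃ c, c < B ∧ IsTriple c ∧ ∀ i, InCode i c ↔ i < K ∧ Y i := by
  obtain ⟨m, hm₀, hm⟩ := exists_common_multiple K
  obtain ⟨n, hn₀, hn⟩ := exists_modulus_product hm₀ hm
  refine ⟨cpair (cpair K m) n + 1, fun Y hY => ?_⟩
  have hY₁ : IsBdd M fun q : ((Unit × M) × M) × M => Y q.2 := hY.comp_unary
  have key (k : M) : ∃ n', n' ∣ n ∧ ∀ i, i < K → (m * (i + 1) + 1 ∣ n' ↔ (i < k → Y i)) := by
    refine sig_induction (P := fun k => ∃ n', n' ∣ n ∧ ∀ i, i < K →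
      (m * (i + 1) + 1 ∣ n' ↔ (i < k → Y i))) inferInstance ?_ ?_ k
    · exact ⟨n, dvd_rfl, fun i hi => ⟨fun _ h => absurd h not_lt_zero, fun _ => (hn i hi).1⟩⟩
    · rintro k ⟨n', hn', h⟩
      by_cases hk : k < K ∧ ¬ Y k
      · obtain ⟨hk, hYk⟩ := hk
        obtain ⟨n'', rfl⟩ := (h k hk).2 fun h => absurd h (lt_irrefl k)
        refine ⟨n'', (dvd_mul_left _ _).trans hn', fun i hi => ?_⟩
        rcases eq_or_ne i k with rfl | hik
        · refine iff_of_false (fun hd => (hn i hi).2 ?_) fun h => hYk (h (lt_add_one i))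
          exact (mul_dvd_mul_left _ hd).trans hn'
        · have h₁ : m * (i + 1) + 1 ∣ n'' ↔ m * (i + 1) + 1 ∣ (m * (k + 1) + 1) * n'' :=
            ⟨fun h => h.mul_left _, fun h =>
              modulus_coprime hm hi hk hik (mul_comm _ n'' ▸ h)⟩
          rw [h₁, h i hi, lt_add_one_iff', le_iff_lt_or_eq, or_iff_left hik]
      · refine ⟨n', hn', fun i hi => ?_⟩
        rw [h i hi, lt_add_one_iff', le_iff_lt_or_eq]
        refine ⟨fun h h' => h'.elim h ?_, fun h h' => h (.inl h')⟩
        rintro rfl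
        by_contra hYi
        exact hk ⟨hi, hYi⟩
  obtain ⟨n', hn', h⟩ := key K
  refine ⟨cpair (cpair K m) n', lt_add_one_iff'.2 (cpair_le_cpair le_rfl (le_of_dvd' hn' hn₀)),
    ⟨K, m, n', rfl⟩, fun i => ?_⟩
  rw [inCode_triple]
  exact and_congr_right fun hi => (h i hi).trans ⟨fun h => h hi, fun h _ => h⟩

/-- Every boundedly definable subset of `{i | i < K}` has a code. -/
theorem exists_finCode (K : M) {Y : M → Prop} (hY : IsBdd M fun q : Unit × M => Y q.2) :
    ∃ c, FinCode c ∧ ∀ i, InCode i c ↔ i < K ∧ Y i := by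
  obtain ⟨B, hB⟩ := exists_triple K
  obtain ⟨c₀, -, hc₀, h₀⟩ := hB Y hY
  have hY₁ : IsBdd M fun q : (Unit × M) × M => Y q.2 := hY.comp_unary
  let E : M → Prop := fun c => IsTriple c ∧ (∀ i, i < c → InCode i c → i < K ∧ Y i) ∧
    ∀ i, i < K → Y i → InCode i c
  have hE (c : M) : E c ↔ IsTriple c ∧ ∀ i, InCode i c ↔ i < K ∧ Y i :=
    and_congr_right fun _ => ⟨fun h i => ⟨fun hi => h.1 i hi.lt hi, fun hi => h.2 i hi.1 hi.2⟩,
      fun h => ⟨fun i _ => (h i).1, fun i hi hYi => (h i).2 ⟨hi, hYi⟩⟩⟩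
  obtain ⟨c, hc, hmin⟩ := exists_least (P := E) (by unfold E; infer_instance)
    ((hE c₀).2 ⟨hc₀, h₀⟩)
  have hc' := (hE c).1 hc
  refine ⟨c, ⟨hc'.1, fun d hd h => hmin d hd.1 ((hE d).2 ⟨hd.2, fun i => ?_⟩)⟩, hc'.2⟩
  rw [h, hc'.2]

/-- The codes of the subsets of `{i | i < K}` are bounded. -/
theorem exists_finCode_bound (K : M) :
    ∃ B : M, ∀ c, FinCode c → (∀ i, InCode i c → i < K) → c < B := by
  obtain ⟨B, hB⟩ := exists_triple K
  refine ⟨B, fun c hc h => ?_⟩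
  obtain ⟨d, hd, hd', hdc⟩ := hB (fun i => InCode i c) inferInstance
  by_contra hBc
  refine hc.2 d ⟨hd.trans_le (not_lt.1 hBc), hd'⟩ fun i => ?_
  rw [hdc, and_iff_right_iff_imp]
  exact h i

end Arithmetic


section Enumerations

variable {M : Type} [CommSemiring M] [LinearOrder M] [IsStrictOrderedRing M]
  [CanonicallyOrderedAdd M] [N : NamedModel M]

set_option synthInstance.maxSize 4096
set_option synthInstance.maxHeartbeats 400000

/-! ### Enumerations of finite sets -/

/-- The number `c` codes a bijection from `{i | i < l}` to `{j | Z j}`. -/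
def Enumerates (c l : M) (Z : M → Prop) : Prop :=
  FinCode c ∧ (∀ u, InCode u c → ∃ i j, u = cpair i j ∧ i < l ∧ Z j) ∧
  (∀ i, i < l → ∃ j, InCode (cpair i j) c) ∧ (∀ j, Z j → ∃ i, InCode (cpair i j) c) ∧
  ∀ i j i' j', InCode (cpair i j) c → InCode (cpair i' j') c → (i = i' ↔ j = j')

theorem InCode.left_lt {i j c : M} (h : InCode (cpair i j) c) : i < c :=
  (le_cpair_left i j).trans_lt h.lt

theorem InCode.right_lt {i j c : M} (h : InCode (cpair i j) c) : j < c :=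
  (le_cpair_right i j).trans_lt h.lt

theorem Enumerates.of_mem {c l : M} {Z : M → Prop} (h : Enumerates c l Z) {i j : M}
    (hij : InCode (cpair i j) c) : i < l ∧ Z j := by
  obtain ⟨i', j', he, hi, hj⟩ := h.2.1 _ hij
  obtain ⟨rfl, rfl⟩ := cpair_inj.1 he
  exact ⟨hi, hj⟩

theorem enumerates_empty : ∃ c : M, Enumerates c 0 fun _ => False := by
  obtain ⟨c, hc, h⟩ := exists_finCode (M := M) 0 (Y := fun _ => False) inferInstance
  simp only [and_false, iff_false] at h
  exact ⟨c, hc, fun u hu => absurd hu (h u), fun i hi => absurd hi not_lt_zero,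
    fun _ hj => hj.elim, fun _ _ _ _ hu => absurd hu (h _)⟩

/-- Another element is put at the end of an enumeration. -/
theorem Enumerates.snoc {c l : M} {Z : M → Prop} (h : Enumerates c l Z) {R : M} (hR : ¬ Z R) :
    ∃ c', Enumerates c' (l + 1) (fun j => Z j ∨ j = R) ∧
      ∀ u, InCode u c' ↔ InCode u c ∨ u = cpair l R := by
  obtain ⟨c', hc', h'⟩ := exists_finCode (c + cpair l R + 1)
    (Y := fun u => InCode u c ∨ u = cpair l R) inferInstance
  have h' (u : M) : InCode u c' ↔ InCode u c ∨ u = cpair l R := by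
    rw [h', and_iff_right_iff_imp, lt_add_one_iff']
    rintro (hu | rfl)
    exacts [hu.lt.le.trans le_self_add, le_add_self]
  refine ⟨c', ⟨hc', fun u hu => ?_, fun i hi => ?_, ?_, fun i j i' j' hu hu' => ?_⟩, h'⟩
  · rcases (h' u).1 hu with hu | rfl
    · obtain ⟨i, j, rfl, hi, hj⟩ := h.2.1 u hu
      exact ⟨i, j, rfl, hi.trans (lt_add_one l), .inl hj⟩
    · exact ⟨l, R, rfl, lt_add_one l, .inr rfl⟩
  · rcases (lt_add_one_iff'.1 hi).lt_or_eq with hi | rfl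
    · obtain ⟨j, hj⟩ := h.2.2.1 i hi
      exact ⟨j, (h' _).2 (.inl hj)⟩
    · exact ⟨R, (h' _).2 (.inr rfl)⟩
  · rintro j (hj | rfl)
    · obtain ⟨i, hi⟩ := h.2.2.2.1 j hj
      exact ⟨i, (h' _).2 (.inl hi)⟩
    · exact ⟨l, (h' _).2 (.inr rfl)⟩
  · rw [h', cpair_inj] at hu hu'
    rcases hu with hu | ⟨rfl, rfl⟩ <;> rcases hu' with hu' | ⟨rfl, rfl⟩
    · exact h.2.2.2.2 _ _ _ _ hu hu'
    · have := h.of_mem hu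
      exact iff_of_false this.1.ne fun e => hR (e ▸ this.2)
    · have := h.of_mem hu'
      exact iff_of_false this.1.ne' fun e => hR (e ▸ this.2)
    · exact iff_of_true rfl rfl

/-- An enumeration of a subset of a bounded set is continued to an enumeration of the set. -/
theorem Enumerates.extend {c₀ l₀ B : M} {Z₀ Z : M → Prop} (h₀ : Enumerates c₀ l₀ Z₀)
    (hZ₀ : IsBdd M fun q : Unit × M => Z₀ q.2) (hZ : IsBdd M fun q : Unit × M => Z q.2)
    (hB : ∀ j, Z j → j < B) (hZ₀Z : ∀ j, Z₀ j → Z j) :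
    ∃ c l, Enumerates c l Z ∧ ∀ u, InCode u c₀ → InCode u c := by
  have hZ₀' {β : Type} [Tuple M β] : IsBdd M fun q : β × M => Z₀ q.2 := hZ₀.comp_unary
  have hZ' {β : Type} [Tuple M β] : IsBdd M fun q : β × M => Z q.2 := hZ.comp_unary
  let Q : M → M → M → Prop := fun b c l => FinCode c ∧
    (∀ u, u < c → InCode u c → ∃ i, i < u + 1 ∧ ∃ j, j < u + 1 ∧ u = cpair i j ∧ i < l ∧
      (Z₀ j ∨ Z j ∧ j < b)) ∧
    (∀ i, i < l → ∃ j, j < c ∧ InCode (cpair i j) c) ∧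
    (∀ j, j < B → Z₀ j ∨ Z j ∧ j < b → ∃ i, i < c ∧ InCode (cpair i j) c) ∧
    (∀ i, i < c → ∀ j, j < c → ∀ i', i' < c → ∀ j', j' < c →
      InCode (cpair i j) c → InCode (cpair i' j') c → (i = i' ↔ j = j')) ∧
    ∀ u, u < c₀ → InCode u c₀ → InCode u c
  have hQ (b c l : M) : Q b c l ↔
      Enumerates c l (fun j => Z₀ j ∨ Z j ∧ j < b) ∧ ∀ u, InCode u c₀ → InCode u c := by
    constructor
    · rintro ⟨h₁, h₂, h₃, h₄, h₅, h₆⟩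
      refine ⟨⟨h₁, fun u hu => ?_, fun i hi => ?_, fun j hj => ?_, fun i j i' j' h h' => ?_⟩,
        fun u hu => h₆ u hu.lt hu⟩
      · obtain ⟨i, -, j, -, h⟩ := h₂ u hu.lt hu
        exact ⟨i, j, h⟩
      · obtain ⟨j, -, h⟩ := h₃ i hi
        exact ⟨j, h⟩
      · obtain ⟨i, -, h⟩ := h₄ j (hB j (hj.elim (hZ₀Z j) And.left)) hj
        exact ⟨i, h⟩
      · exact h₅ i h.left_lt j h.right_lt i' h'.left_lt j' h'.right_lt h h'
    · rintro ⟨⟨h₁, h₂, h₃, h₄, h₅⟩, h₆⟩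
      refine ⟨h₁, fun u _ hu => ?_, fun i hi => ?_, fun j _ hj => ?_,
        fun i _ j _ i' _ j' _ h h' => h₅ i j i' j' h h', fun u _ hu => h₆ u hu⟩
      · obtain ⟨i, j, rfl, h⟩ := h₂ u hu
        exact ⟨i, lt_add_one_iff'.2 (le_cpair_left i j), j,
          lt_add_one_iff'.2 (le_cpair_right i j), rfl, h⟩
      · obtain ⟨j, h⟩ := h₃ i hi
        exact ⟨j, h.right_lt, h⟩
      · obtain ⟨i, h⟩ := h₄ j hj
        exact ⟨i, h.left_lt, h⟩
  have key (b : M) : ∃ c l, Q b c l := by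
    refine sig_induction (P := fun b => ∃ c l, Q b c l) (by unfold Q; infer_instance)
      ⟨c₀, l₀, (hQ _ _ _).2 ⟨?_, fun _ => id⟩⟩ ?_ b
    · simpa only [not_lt_zero, and_false, or_false] using h₀
    · rintro b ⟨c, l, h⟩
      obtain ⟨h, h'⟩ := (hQ _ _ _).1 h
      by_cases hb : Z b ∧ ¬ Z₀ b
      · obtain ⟨c', hc', h''⟩ := h.snoc (R := b) (by simp [hb.2])
        refine ⟨c', l + 1, (hQ _ _ _).2 ⟨?_, fun u hu => (h'' u).2 (.inl (h' u hu))⟩⟩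
        convert hc' using 2 with j
        rw [lt_add_one_iff', le_iff_lt_or_eq]
        constructor
        · tauto
        · rintro ((h | h) | rfl)
          exacts [.inl h, .inr ⟨h.1, .inl h.2⟩, .inr ⟨hb.1, .inr rfl⟩]
      · refine ⟨c, l, (hQ _ _ _).2 ⟨?_, h'⟩⟩
        convert h using 2 with j
        rw [lt_add_one_iff', le_iff_lt_or_eq]
        constructor
        · rintro (h | ⟨h, h' | rfl⟩)
          exacts [.inl h, .inr ⟨h, h'⟩, .inl (by tauto)]
        · tauto
  obtain ⟨c, l, h⟩ := key B
  obtain ⟨h, h'⟩ := (hQ _ _ _).1 h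
  refine ⟨c, l, ?_, h'⟩
  convert h using 2 with j
  exact ⟨fun hj => .inr ⟨hj, hB j hj⟩, fun hj => hj.elim (hZ₀Z j) And.left⟩

theorem Enumerates.isSeq {c l : M} {Z : M → Prop} (h : Enumerates c l Z) : IsSeq c l := by
  refine ⟨h.1, fun u hu => ?_, fun i hi => ?_⟩
  · obtain ⟨i, j, hu, hi, -⟩ := h.2.1 u hu
    exact ⟨i, j, hu, hi⟩
  · obtain ⟨j, hj⟩ := h.2.2.1 i hi
    exact ⟨j, hj, fun j' hj' => ((h.2.2.2.2 _ _ _ _ hj' hj).1 rfl)⟩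

theorem Enumerates.isPerm {c l : M} {X : Set M} (h : Enumerates c l (WeakOrder X)) :
    IsPerm X c l := by
  refine ⟨h.isSeq, fun i R hi => (h.of_mem hi).2, fun R hR => ?_⟩
  obtain ⟨i, hi⟩ := h.2.2.2.1 R hR
  exact ⟨i, hi, fun i' hi' => (h.2.2.2.2 _ _ _ _ hi' hi).2 rfl⟩

theorem lt_four {i : M} : i < 4 ↔ i = 0 ∨ i = 1 ∨ i = 2 ∨ i = 3 := by
  have h₁ : i < 1 ↔ i = 0 := by
    rw [← zero_add (1 : M), lt_add_one_iff', nonpos_iff_eq_zero]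
  have h₂ : i < 2 ↔ i = 0 ∨ i = 1 := by
    rw [← one_add_one_eq_two, lt_add_one_iff', le_iff_lt_or_eq, h₁]
  have h₃ : i < 3 ↔ i = 0 ∨ i = 1 ∨ i = 2 := by
    rw [← two_add_one_eq_three, lt_add_one_iff', le_iff_lt_or_eq, h₂, or_assoc]
  rw [← three_add_one_eq_four, lt_add_one_iff', le_iff_lt_or_eq, h₃, or_assoc, or_assoc]

/-- Any four numbers form a coded sequence. -/
theorem exists_seq_four (m₀ m₁ m₂ m₃ : M) : ∃ s, IsSeq s 4 ∧ ∀ i m, InCode (cpair i m) s ↔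
    i = 0 ∧ m = m₀ ∨ i = 1 ∧ m = m₁ ∨ i = 2 ∧ m = m₂ ∨ i = 3 ∧ m = m₃ := by
  obtain ⟨s, hs, h⟩ := exists_finCode (cpair 0 m₀ + cpair 1 m₁ + cpair 2 m₂ + cpair 3 m₃ + 1)
    (Y := fun u => u = cpair 0 m₀ ∨ u = cpair 1 m₁ ∨ u = cpair 2 m₂ ∨ u = cpair 3 m₃)
    inferInstance
  have h (u : M) : InCode u s ↔
      u = cpair 0 m₀ ∨ u = cpair 1 m₁ ∨ u = cpair 2 m₂ ∨ u = cpair 3 m₃ := by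
    rw [h, and_iff_right_iff_imp, lt_add_one_iff']
    rintro (rfl | rfl | rfl | rfl)
    · rw [add_assoc, add_assoc]; exact le_self_add
    · rw [add_assoc, add_assoc]; exact le_self_add.trans le_add_self
    · rw [add_assoc]; exact le_self_add.trans le_add_self
    · exact le_add_self
  have h' (i m : M) : InCode (cpair i m) s ↔
      i = 0 ∧ m = m₀ ∨ i = 1 ∧ m = m₁ ∨ i = 2 ∧ m = m₂ ∨ i = 3 ∧ m = m₃ := by
    simp only [h, cpair_inj]
  refine ⟨s, ⟨hs, fun u hu => ?_, fun i hi => ?_⟩, h'⟩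
  · simp only [lt_four]
    rcases (h u).1 hu with rfl | rfl | rfl | rfl
    exacts [⟨0, m₀, rfl, by simp⟩, ⟨1, m₁, rfl, by simp⟩, ⟨2, m₂, rfl, by simp⟩,
      ⟨3, m₃, rfl, by simp⟩]
  · simp only [h']
    rcases lt_four.1 hi with rfl | rfl | rfl | rfl
    · exact ⟨m₀, by simp, by simp⟩
    · exact ⟨m₁, by simp, by simp⟩
    · exact ⟨m₂, by simp, by simp⟩
    · exact ⟨m₃, by simp, by simp⟩

/-! ### Weak orders -/

variable {X : Set M} (hX : X ∈ Set.range N.sets) (hb : Bounded X)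
include hX hb

theorem isBdd_weakOrder {α : Type} [T : Tuple M α] {f : α → M} [IsTerm f] :
    IsBdd M fun a => WeakOrder X (f a) := by
  obtain ⟨K, hK⟩ := hb
  have {β : Type} [Tuple M β] {f : β → M} [IsTerm f] : IsBdd M fun a => f a ∈ X := isBdd_mem hX
  refine IsBdd.congr (P := fun a => FinCode (f a) ∧
    (∀ u, u < f a → InCode u (f a) → ∃ x, x < u + 1 ∧ ∃ y, y < u + 1 ∧
      u = cpair x y ∧ x ∈ X ∧ y ∈ X) ∧
    (∀ x, x < K → ∀ y, y < K → x ∈ X ∧ y ∈ X →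
      InCode (cpair x y) (f a) ∨ InCode (cpair y x) (f a)) ∧
    ∀ x, x < f a → ∀ y, y < f a → ∀ z, z < f a →
      InCode (cpair x y) (f a) ∧ InCode (cpair y z) (f a) → InCode (cpair x z) (f a))
    inferInstance fun a => ⟨?_, ?_⟩
  · rintro ⟨h₁, h₂, h₃, h₄⟩
    refine ⟨h₁, fun u _ hu => ?_, fun x _ y _ => h₃ x y, fun x _ y _ z _ => h₄ x y z⟩
    obtain ⟨x, y, rfl, h⟩ := h₂ u hu
    exact ⟨x, lt_add_one_iff'.2 (le_cpair_left x y), y,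
      lt_add_one_iff'.2 (le_cpair_right x y), rfl, h⟩
  · rintro ⟨h₁, h₂, h₃, h₄⟩
    refine ⟨h₁, fun u hu => ?_, fun x y h => h₃ x (hK x h.1) y (hK y h.2) h,
      fun x y z h => h₄ x h.1.left_lt y h.1.right_lt z h.2.right_lt h⟩
    obtain ⟨x, -, y, -, h⟩ := h₂ u hu.lt hu
    exact ⟨x, y, h⟩

omit hX in
theorem exists_weakOrder_bound : ∃ B, ∀ R, WeakOrder X R → R < B := by
  obtain ⟨K, hK⟩ := hb
  obtain ⟨B, hB⟩ := exists_finCode_bound (cpair K K + 1)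
  refine ⟨B, fun R hR => hB R hR.1 fun u hu => ?_⟩
  obtain ⟨x, y, rfl, hx, hy⟩ := hR.2.1 u hu
  exact lt_add_one_iff'.2 (cpair_le_cpair (hK x hx).le (hK y hy).le)

/-- There is an enumeration of the weak orders on `X` that begins with four given ones. -/
theorem exists_perm {R₀ R₁ R₂ R₃ : M} (h₀ : WeakOrder X R₀) (h₁ : WeakOrder X R₁)
    (h₂ : WeakOrder X R₂) (h₃ : WeakOrder X R₃) (h₀₁ : R₁ ≠ R₀) (h₀₂ : R₂ ≠ R₀) (h₁₂ : R₂ ≠ R₁)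
    (h₀₃ : R₃ ≠ R₀) (h₁₃ : R₃ ≠ R₁) (h₂₃ : R₃ ≠ R₂) :
    ∃ p l, IsPerm X p l ∧ 4 ≤ l ∧ InCode (cpair 0 R₀) p ∧ InCode (cpair 1 R₁) p ∧
      InCode (cpair 2 R₂) p ∧ InCode (cpair 3 R₃) p := by
  obtain ⟨B, hB⟩ := exists_weakOrder_bound hb
  obtain ⟨c, hc⟩ := enumerates_empty (M := M)
  obtain ⟨c₀, hc₀, e₀⟩ := hc.snoc (R := R₀) id
  obtain ⟨c₁, hc₁, e₁⟩ := hc₀.snoc (R := R₁) (by simpa using h₀₁)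
  obtain ⟨c₂, hc₂, e₂⟩ := hc₁.snoc (R := R₂) (by simpa using ⟨h₀₂, h₁₂⟩)
  obtain ⟨c₃, hc₃, e₃⟩ := hc₂.snoc (R := R₃) (by simpa using ⟨⟨h₀₃, h₁₃⟩, h₂₃⟩)
  rw [zero_add] at e₁ hc₁
  rw [zero_add, one_add_one_eq_two] at e₂
  rw [zero_add, one_add_one_eq_two, two_add_one_eq_three] at e₃
  obtain ⟨p, l, hp, h⟩ := hc₃.extend (B := B) (Z := WeakOrder X) inferInstance
    (isBdd_weakOrder hX hb) hB (by rintro _ ((((h | rfl) | rfl) | rfl) | rfl) <;> tauto)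
  have p₃ : InCode (cpair 3 R₃) p := h _ ((e₃ _).2 (.inr rfl))
  refine ⟨p, l, hp.isPerm, ?_, ?_, ?_, ?_, p₃⟩
  · have := (hp.of_mem p₃).1
    rwa [← not_lt, ← three_add_one_eq_four, lt_add_one_iff', not_le]
  · exact h _ ((e₃ _).2 (.inl ((e₂ _).2 (.inl ((e₁ _).2 (.inl ((e₀ _).2 (.inr rfl))))))))
  · exact h _ ((e₃ _).2 (.inl ((e₂ _).2 (.inl ((e₁ _).2 (.inr rfl))))))
  · exact h _ ((e₃ _).2 (.inl ((e₂ _).2 (.inr rfl))))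

/-- A boundedly definable weak order on `X` has a code. -/
theorem exists_weakOrder {L : M → M → Prop}
    (hL : IsBdd M fun q : (Unit × M) × M => L q.1.2 q.2) (total : ∀ x y, L x y ∨ L y x)
    (trans : ∀ x y z, L x y → L y z → L x z) :
    ∃ R, WeakOrder X R ∧ ∀ x y, InCode (cpair x y) R ↔ x ∈ X ∧ y ∈ X ∧ L x y := by
  obtain ⟨K, hK⟩ := hb
  have {β : Type} [Tuple M β] {f : β → M} [IsTerm f] : IsBdd M fun a => f a ∈ X := isBdd_mem hX
  have {β : Type} [Tuple M β] : IsBdd M fun q : (β × M) × M => L q.1.2 q.2 :=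
    hL.comp (fun q : (β × M) × M => (((), q.1.2), q.2)) fun k => by
      match k with
      | 0 => exact isTerm_env (α := (β × M) × M) 0
      | 1 => exact isTerm_env (α := (β × M) × M) 1
      | k + 2 => exact isTerm_const (N.nums k)
  obtain ⟨R, hR, h⟩ := exists_finCode (cpair K K + 1)
    (Y := fun u => ∃ x, x < u + 1 ∧ ∃ y, y < u + 1 ∧ u = cpair x y ∧ x ∈ X ∧ y ∈ X ∧ L x y)
    inferInstance
  have h' (x y : M) : InCode (cpair x y) R ↔ x ∈ X ∧ y ∈ X ∧ L x y := by
    rw [h]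
    constructor
    · rintro ⟨-, x', -, y', -, he, h⟩
      obtain ⟨rfl, rfl⟩ := cpair_inj.1 he
      exact h
    · exact fun h => ⟨lt_add_one_iff'.2 (cpair_le_cpair (hK x h.1).le (hK y h.2.1).le),
        x, lt_add_one_iff'.2 (le_cpair_left x y), y, lt_add_one_iff'.2 (le_cpair_right x y),
        rfl, h⟩
  refine ⟨R, ⟨hR, fun u hu => ?_, fun x y hxy => ?_, fun x y z hxyz => ?_⟩, h'⟩
  · obtain ⟨-, x, -, y, -, he, hx, hy, -⟩ := (h u).1 hu
    exact ⟨x, y, he, hx, hy⟩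
  · rw [h', h']
    exact (total x y).imp (fun h => ⟨hxy.1, hxy.2, h⟩) fun h => ⟨hxy.2, hxy.1, h⟩
  · simp only [h'] at hxyz ⊢
    exact ⟨hxyz.1.1, hxyz.2.2.1, trans x y z hxyz.1.2.2 hxyz.2.2.2⟩

end Enumerations


section Societies

variable {M : Type} [CommSemiring M] [LinearOrder M] {V X A F : Set M}

/-! ### Measurable sets and profiles of a society -/

/-- The set of the voters in `V` that satisfy `D` belongs to the algebra `A`. -/
def MeasurableIn (V A : Set M) (D : M → Prop) : Prop := ∃ k, ∀ v, InSeq A k v ↔ v ∈ V ∧ D v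

theorem measurableIn_false (hA : CountableAlgebra V A) : MeasurableIn V A fun _ => False := by
  obtain ⟨k, hk⟩ := hA.2.1
  obtain ⟨l, hl⟩ := hA.2.2.2.2 k
  exact ⟨l, fun v => by rw [hl, hk]; tauto⟩

theorem MeasurableIn.or (hA : CountableAlgebra V A) {D E : M → Prop} (hD : MeasurableIn V A D)
    (hE : MeasurableIn V A E) : MeasurableIn V A fun v => D v ∨ E v := by
  obtain ⟨k, hk⟩ := hD
  obtain ⟨l, hl⟩ := hE
  obtain ⟨m, hm⟩ := hA.2.2.1 k l
  exact ⟨m, fun v => by rw [hm, hk, hl]; tauto⟩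

theorem MeasurableIn.and (hA : CountableAlgebra V A) {D E : M → Prop} (hD : MeasurableIn V A D)
    (hE : MeasurableIn V A E) : MeasurableIn V A fun v => D v ∧ E v := by
  obtain ⟨k, hk⟩ := hD
  obtain ⟨l, hl⟩ := hE
  obtain ⟨m, hm⟩ := hA.2.2.2.1 k l
  exact ⟨m, fun v => by rw [hm, hk, hl]; tauto⟩

theorem MeasurableIn.not (hA : CountableAlgebra V A) {D : M → Prop} (hD : MeasurableIn V A D) :
    MeasurableIn V A fun v => ¬ D v := by
  obtain ⟨k, hk⟩ := hD
  obtain ⟨m, hm⟩ := hA.2.2.2.2 k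
  exact ⟨m, fun v => by rw [hm, hk]; tauto⟩

theorem measurableIn_eq (hat : Atomic V A) {v₀ : M} (hv₀ : v₀ ∈ V) :
    MeasurableIn V A fun v => v = v₀ := by
  obtain ⟨k, hk⟩ := hat v₀ hv₀
  exact ⟨k, fun v => by rw [hk, iff_and_self]; rintro rfl; exact hv₀⟩

theorem measurableIn_voterLe {S : ℕ → Set M} (hA : CountableAlgebra V A)
    (h : UniformlyMeasurable S V X A F) (i : M) {x y : M} (hx : x ∈ X) (hy : y ∈ X) :
    MeasurableIn V A fun v => VoterLe F i v x y := by
  obtain ⟨μ, -, hμ, h⟩ := h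
  obtain ⟨k, hk, -⟩ := hμ.2 _ ⟨i, x, y, rfl, hx, hy⟩
  refine ⟨k, fun v => ⟨fun hv => ?_, fun hv => (h i x y v k ⟨hx, hy, hv.1, hk⟩).1 hv.2⟩⟩
  have hvV := hA.1 k v hv
  exact ⟨hvV, (h i x y v k ⟨hx, hy, hvV, hk⟩).2 hv⟩

theorem Profiles.weakOrder_of_profileVal [IsStrictOrderedRing M] [CanonicallyOrderedAdd M]
    [NamedModel M] (hF : Profiles V X F) {i v R : M} (h : ProfileVal F i v R) : WeakOrder X R := by
  obtain ⟨v', R', he, -, h⟩ := (hF i).1 _ h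
  exact (cpair_inj.1 he).2 ▸ h

theorem Profiles.voterLe_iff (hF : Profiles V X F) {i v R : M} (hv : v ∈ V)
    (h : ProfileVal F i v R) {x y : M} : VoterLe F i v x y ↔ InCode (cpair x y) R :=
  ⟨fun ⟨_, hR', h'⟩ => ((hF i).2 v hv).unique hR' h ▸ h', fun h' => ⟨R, h, h'⟩⟩

theorem Profiles.voterLe_total [IsStrictOrderedRing M] [CanonicallyOrderedAdd M] [NamedModel M]
    (hF : Profiles V X F) (i : M) {v : M} (hv : v ∈ V) {x y : M}
    (hx : x ∈ X) (hy : y ∈ X) : VoterLe F i v x y ∨ VoterLe F i v y x := by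
  obtain ⟨R, hR, -⟩ := (hF i).2 v hv
  simp only [hF.voterLe_iff hv hR]
  exact (hF.weakOrder_of_profileVal hR).2.2.1 x y ⟨hx, hy⟩

/-- In the profile with index `i`, the voter `v` orders the three alternatives `x` by the
ranks `r`. -/
def Ranks (F : Set M) (i v : M) (x : Fin 3 → M) (r : Fin 3 → ℕ) : Prop :=
  ∀ s t, VoterLe F i v (x s) (x t) ↔ r s ≤ r t

theorem Ranks.voterLt {i v : M} {x : Fin 3 → M} {r : Fin 3 → ℕ} (h : Ranks F i v x r) (s t : Fin 3)
    (hst : r s < r t) : VoterLt F i v (x s) (x t) :=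
  ⟨(h s t).2 hst.le, fun h' => hst.not_ge ((h t s).1 h')⟩

/-- The rank of an alternative, if those in `x` have the ranks `r`, and all others the
rank 3. -/
noncomputable def rank (x : Fin 3 → M) (r : Fin 3 → ℕ) (z : M) : ℕ :=
  if z = x 0 then r 0 else if z = x 1 then r 1 else if z = x 2 then r 2 else 3

theorem rank_apply {x : Fin 3 → M} (hx : Function.Injective x) (r : Fin 3 → ℕ) (s : Fin 3) :
    rank x r (x s) = r s := by
  simp only [rank, hx.eq_iff]
  fin_cases s <;> simp

variable [N : NamedModel M]

theorem isBdd_const {α : Type} [Tuple M α] (p : Prop) : IsBdd M fun _ : α => p := by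
  by_cases hp : p
  · exact IsBdd.congr (P := fun _ : α => (0 : M) = 0) inferInstance fun _ => by simp [hp]
  · exact IsBdd.congr (P := fun _ : α => False) inferInstance fun _ => by simp [hp]

theorem IsBdd.ite {α : Type} [Tuple M α] {P Q R : α → Prop} [∀ a, Decidable (P a)] (hP : IsBdd M P)
    (hQ : IsBdd M Q) (hR : IsBdd M R) : IsBdd M fun a => if P a then Q a else R a :=
  IsBdd.congr (P := fun a => (P a → Q a) ∧ (¬ P a → R a)) inferInstance fun a => by
    split_ifs with h <;> simp [h]

theorem isBdd_rank {α : Type} [Tuple M α] {f : α → M} [IsTerm f] (x : Fin 3 → M) (r : Fin 3 → ℕ)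
    {p : ℕ → α → Prop} (hp : ∀ n, IsBdd M (p n)) : IsBdd M fun a => p (rank x r (f a)) a :=
  IsBdd.congr (.ite (P := fun a => f a = x 0) inferInstance (hp (r 0))
    (.ite (P := fun a => f a = x 1) inferInstance (hp (r 1))
      (.ite (P := fun a => f a = x 2) inferInstance (hp (r 2)) (hp 3)))) fun a => by
    unfold rank
    split_ifs <;> rfl

variable [IsStrictOrderedRing M] [CanonicallyOrderedAdd M]

theorem exists_weakOrder_ranks (hX : X ∈ Set.range N.sets) (hb : Bounded X) {x : Fin 3 → M}
    (hx : Function.Injective x) (hxX : ∀ s, x s ∈ X) (r : Fin 3 → ℕ) :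
    ∃ R, WeakOrder X R ∧ ∀ s t, InCode (cpair (x s) (x t)) R ↔ r s ≤ r t := by
  obtain ⟨R, hR, h⟩ := exists_weakOrder hX hb (L := fun y z => rank x r y ≤ rank x r z)
    (isBdd_rank x r fun m => isBdd_rank x r fun n => isBdd_const (m ≤ n))
    (fun y z => le_total _ _) fun _ _ _ => le_trans
  refine ⟨R, hR, fun s t => ?_⟩
  rw [h, rank_apply hx, rank_apply hx]
  exact and_iff_right (hxX s) |>.trans (and_iff_right (hxX t))

/-- The profile in which the voters in `D₀`, those in `D₁`, those in `D₂` and the others order three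
alternatives in four different prescribed ways. -/
theorem exists_profile (hS : CountableSociety N.sets V X A F)
    (hX : X ∈ Set.range N.sets) {x : Fin 3 → M} (hx : Function.Injective x) (hxX : ∀ s, x s ∈ X)
    (r : Fin 4 → Fin 3 → ℕ)
    (hr : ∀ p q, p ≠ q → ∃ s t, ¬ (r p s ≤ r p t ↔ r q s ≤ r q t))
    {D₀ D₁ D₂ : M → Prop} (h₀ : MeasurableIn V A D₀) (h₁ : MeasurableIn V A D₁)
    (h₂ : MeasurableIn V A D₂) :
    ∃ j, ∀ v, v ∈ V → (D₀ v → Ranks F j v x (r 0)) ∧ (¬ D₀ v → D₁ v → Ranks F j v x (r 1)) ∧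
      (¬ D₀ v → ¬ D₁ v → D₂ v → Ranks F j v x (r 2)) ∧
      (¬ D₀ v → ¬ D₁ v → ¬ D₂ v → Ranks F j v x (r 3)) := by
  obtain ⟨-, hb, -, hA, -, hF, -, e, -, he, hS⟩ := hS
  choose R hR hRr using fun p => exists_weakOrder_ranks hX hb hx hxX (r p)
  -- Different preferences on the three alternatives have different codes.
  have hne (p q : Fin 4) (hpq : p ≠ q) : R p ≠ R q := fun h => by
    obtain ⟨s, t, hst⟩ := hr p q hpq
    exact hst (by rw [← hRr p, ← hRr q, h])
  obtain ⟨p, l, hp, hl, p₀, p₁, p₂, p₃⟩ := exists_perm hX hb (hR 0) (hR 1) (hR 2) (hR 3)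
    (hne _ _ (by decide)) (hne _ _ (by decide)) (hne _ _ (by decide)) (hne _ _ (by decide))
    (hne _ _ (by decide)) (hne _ _ (by decide))
  obtain ⟨m₀, hm₀⟩ := h₀
  -- The parts are made disjoint, so that membership in one of them is unique. The voters outside
  -- all of them get the last order; the last entry of `s` has no influence.
  obtain ⟨m₁, hm₁⟩ := h₁.and hA (.not hA ⟨m₀, hm₀⟩)
  obtain ⟨m₂, hm₂⟩ := h₂.and hA (.not hA (.or hA ⟨m₀, hm₀⟩ h₁))
  obtain ⟨s, hs, hsm⟩ := exists_seq_four m₀ m₁ m₂ 0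
  have hq : PermQPart X p s 4 := ⟨l, hp, hs, N.one_le four_pos, hl⟩
  obtain ⟨j, hj, -⟩ := he.2 _ ⟨p, s, 4, rfl, hq⟩
  have h12 : (1 : M) < 2 := one_lt_two
  have h23 : (2 : M) < 3 := by rw [← two_add_one_eq_three]; exact lt_add_one 2
  have hpart (v i : M) (hv : v ∈ V) : InPart A s 4 v i ↔ i = 0 ∧ D₀ v ∨
      i = 1 ∧ D₁ v ∧ ¬ D₀ v ∨ i = 2 ∧ D₂ v ∧ ¬ (D₀ v ∨ D₁ v) := by
    unfold InPart
    rw [← three_add_one_eq_four, add_lt_add_iff_right]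
    simp only [hsm]
    constructor
    · rintro ⟨hi, n, ⟨rfl, rfl⟩ | ⟨rfl, rfl⟩ | ⟨rfl, rfl⟩ | ⟨rfl, rfl⟩, h⟩
      exacts [.inl ⟨rfl, ((hm₀ v).1 h).2⟩, .inr (.inl ⟨rfl, ((hm₁ v).1 h).2⟩),
        .inr (.inr ⟨rfl, ((hm₂ v).1 h).2⟩), (lt_irrefl _ hi).elim]
    · rintro (⟨rfl, h⟩ | ⟨rfl, h⟩ | ⟨rfl, h⟩)
      · exact ⟨three_pos, m₀, by simp, (hm₀ v).2 ⟨hv, h⟩⟩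
      · exact ⟨h12.trans h23, m₁, by simp, (hm₁ v).2 ⟨hv, h⟩⟩
      · exact ⟨h23, m₂, by simp, (hm₂ v).2 ⟨hv, h⟩⟩
  have hRanks (v : M) (hv : v ∈ V) (i : M) (q : Fin 4) (hi : InCode (cpair i (R q)) p) (R' : M)
      (hR' : InCode (cpair i R') p) (h : ProfileVal F j v R') : Ranks F j v x (r q) := by
    obtain rfl : R' = R q := by
      obtain ⟨i', R'', he, hi'⟩ := hp.1.2.1 _ hi
      obtain ⟨rfl, rfl⟩ := cpair_inj.1 he
      exact (hp.1.2.2 i hi').unique hR' hi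
    exact fun s t => (hF.voterLe_iff hv h).trans (hRr q s t)
  have key (v : M) (hv : v ∈ V) (i : M) (q : Fin 4) (hi : InCode (cpair i (R q)) p)
      (h : InPart A s 4 v i ∧ ∀ i', InPart A s 4 v i' → i' = i) : Ranks F j v x (r q) := by
    obtain ⟨R', hR', h'⟩ := (hS p s 4 j v ⟨hq, hj, hv⟩).1 i h
    exact hRanks v hv i q hi R' hR' h'
  refine ⟨j, fun v hv => ⟨fun hD => key v hv 0 0 p₀ ?_, fun hD hD₁ => key v hv 1 1 p₁ ?_,
    fun hD hD₁ hD₂ => key v hv 2 2 p₂ ?_, fun hD hD₁ hD₂ => ?_⟩⟩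
  · simp only [hpart v _ hv]
    tauto
  · simp only [hpart v _ hv]
    tauto
  · simp only [hpart v _ hv]
    tauto
  · have hno : ¬ ∃! i, InPart A s 4 v i := by
      rintro ⟨i, hi, -⟩
      rw [hpart v i hv] at hi
      tauto
    obtain ⟨m, R', hm, hR', h⟩ := (hS p s 4 j v ⟨hq, hj, hv⟩).2 hno
    obtain rfl : m = 3 := add_right_cancel (hm.trans three_add_one_eq_four.symm)
    exact hRanks v hv 3 3 p₃ R' hR' h

end Societies


section Arrow

variable {M : Type} [CommSemiring M] [LinearOrder M] [IsStrictOrderedRing M]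
  [CanonicallyOrderedAdd M] [N : NamedModel M] {V X A F σ : Set M}

set_option synthInstance.maxSize 4096
set_option synthInstance.maxHeartbeats 400000

/-! ### Social preferences -/

theorem SocialWelfareFunction.exists_weakOrder (hσ : SocialWelfareFunction V X F σ) (i : M) :
    ∃ R, WeakOrder X R ∧ ∀ x y, SocialLe σ i x y ↔ InCode (cpair x y) R := by
  obtain ⟨R, hR, hR'⟩ := hσ.1.2 i rfl
  obtain ⟨i', R', he, -, h⟩ := hσ.1.1 _ hR
  obtain ⟨rfl, rfl⟩ := cpair_inj.1 he
  exact ⟨R, h, fun x y => ⟨fun ⟨R', h, h'⟩ => hR' R' h ▸ h', fun h' => ⟨R, hR, h'⟩⟩⟩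

theorem SocialWelfareFunction.le_total (hσ : SocialWelfareFunction V X F σ) (i : M) {x y : M}
    (hx : x ∈ X) (hy : y ∈ X) : SocialLe σ i x y ∨ SocialLe σ i y x := by
  obtain ⟨R, hR, h⟩ := hσ.exists_weakOrder i
  rw [h, h]
  exact hR.2.2.1 x y ⟨hx, hy⟩

theorem SocialWelfareFunction.le_trans (hσ : SocialWelfareFunction V X F σ) {i x y z : M}
    (hxy : SocialLe σ i x y) (hyz : SocialLe σ i y z) : SocialLe σ i x z := by
  obtain ⟨R, hR, h⟩ := hσ.exists_weakOrder i
  rw [h] at hxy hyz ⊢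
  exact hR.2.2.2 x y z ⟨hxy, hyz⟩

theorem SocialWelfareFunction.lt_of_le_of_lt (hσ : SocialWelfareFunction V X F σ) {i x y z : M}
    (hxy : SocialLe σ i x y) (hyz : SocialLt σ i y z) : SocialLt σ i x z :=
  ⟨hσ.le_trans hxy hyz.1, fun h => hyz.2 (hσ.le_trans h hxy)⟩

/-- Whether society ranks `x` strictly below `y` depends only on the votes on `x` and `y`. -/
theorem SocialWelfareFunction.lt_of_agree (hσ : SocialWelfareFunction V X F σ)
    (hF : Profiles V X F) {i j x y : M} (hx : x ∈ X) (hy : y ∈ X)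
    (h : ∀ v, v ∈ V → (VoterLe F i v x y ↔ VoterLe F j v x y) ∧
      (VoterLe F i v y x ↔ VoterLe F j v y x)) (hj : SocialLt σ j x y) : SocialLt σ i x y := by
  have := hσ.2.2 x y i j ⟨hx, hy⟩ fun v a b hab => by
    have hrefl (k : M) {z : M} (hz : z ∈ X) : VoterLe F k v z z :=
      or_self_iff.1 (hF.voterLe_total k hab.1 hz hz)
    obtain ⟨hv, rfl | rfl, rfl | rfl⟩ := hab
    exacts [iff_of_true (hrefl i hx) (hrefl j hx), (h v hv).1, (h v hv).2,
      iff_of_true (hrefl i hy) (hrefl j hy)]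
  exact ⟨(this x y ⟨.inl rfl, .inr rfl⟩).2 hj.1,
    fun h => hj.2 ((this y x ⟨.inr rfl, .inl rfl⟩).1 h)⟩

theorem VoterLt.agree {i j v x y : M} (hi : VoterLt F i v x y) (hj : VoterLt F j v x y) :
    (VoterLe F i v x y ↔ VoterLe F j v x y) ∧ (VoterLe F i v y x ↔ VoterLe F j v y x) :=
  ⟨iff_of_true hi.1 hj.1, iff_of_false hi.2 hj.2⟩

/-! ### Decisive voters -/

/-- Whenever the voter `v₀` ranks `x` strictly below `y`, so does society. -/
def Decisive (F σ : Set M) (v₀ x y : M) : Prop := ∀ i, VoterLt F i v₀ x y → SocialLt σ i x y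

/-- Whenever the voter `v₀` ranks `x` strictly below `y` and all other voters rank `y` strictly below
`x`, society agrees with `v₀`. -/
def WeaklyDecisive (V F σ : Set M) (v₀ x y : M) : Prop :=
  ∀ i, VoterLt F i v₀ x y → (∀ v, v ∈ V → v ≠ v₀ → VoterLt F i v y x) → SocialLt σ i x y

theorem Decisive.weaklyDecisive {v₀ x y : M} (h : Decisive F σ v₀ x y) :
    WeaklyDecisive V F σ v₀ x y := fun i hi _ => h i hi

theorem injective_vec {a b c : M} (hab : a ≠ b) (hac : a ≠ c) (hbc : b ≠ c) :
    Function.Injective ![a, b, c] := by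
  intro s t
  fin_cases s <;> fin_cases t <;> simp [hab, hac, hbc, hab.symm, hac.symm, hbc.symm]

theorem vec_mem {a b c : M} (ha : a ∈ X) (hb : b ∈ X) (hc : c ∈ X) (s : Fin 3) :
    ![a, b, c] s ∈ X := by
  fin_cases s
  exacts [ha, hb, hc]

/-- The voter `v₀` puts `b` between `a` and `c`. If all others put `b` below `a` and `c`, weak
decisiveness gives `a < b` and unanimity `b < c`, however they rank `a` and `c`; by independence
their opinion on `b` does not matter. -/
theorem WeaklyDecisive.decisive_right (hS : CountableSociety N.sets V X A F)
    (hX : X ∈ Set.range N.sets) (hσ : SocialWelfareFunction V X F σ) {v₀ : M} (hv₀ : v₀ ∈ V)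
    {a b c : M} (ha : a ∈ X) (hb : b ∈ X) (hc : c ∈ X) (hab : a ≠ b) (hac : a ≠ c) (hbc : b ≠ c)
    (h : WeaklyDecisive V F σ v₀ a b) : Decisive F σ v₀ a c := by
  intro i hi
  obtain ⟨-, -, -, hA, hat, hF, hμ, -⟩ := id hS
  have hle := measurableIn_voterLe hA hμ i ha hc
  have hge := measurableIn_voterLe hA hμ i hc ha
  -- The four classes: `v₀`, and the others by their preference between `a` and `c`.
  obtain ⟨j, hj⟩ := exists_profile hS hX (injective_vec hab hac hbc) (vec_mem ha hb hc)
    ![![0, 1, 2], ![1, 0, 2], ![2, 0, 1], ![1, 0, 1]] (by decide) (measurableIn_eq hat hv₀)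
    (hle.and hA (hge.not hA)) (hge.and hA (hle.not hA))
  have hj₀ := (hj v₀ hv₀).1 rfl
  have hab : SocialLt σ j a b := h j (hj₀.voterLt 0 1 (by decide)) fun v hv hne => by
    obtain ⟨-, h₁, h₂, h₃⟩ := hj v hv
    by_cases h : VoterLe F i v a c ∧ ¬ VoterLe F i v c a
    · exact (h₁ hne h).voterLt 1 0 (by decide)
    · by_cases h' : VoterLe F i v c a ∧ ¬ VoterLe F i v a c
      · exact (h₂ hne h h').voterLt 1 0 (by decide)
      · exact (h₃ hne h h').voterLt 1 0 (by decide)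
  have hbc : SocialLt σ j b c := hσ.2.1 b c j ⟨hb, hc⟩ fun v hv => by
    obtain ⟨h₀, h₁, h₂, h₃⟩ := hj v hv
    by_cases hne : v = v₀
    · exact (h₀ hne).voterLt 1 2 (by decide)
    by_cases h : VoterLe F i v a c ∧ ¬ VoterLe F i v c a
    · exact (h₁ hne h).voterLt 1 2 (by decide)
    · by_cases h' : VoterLe F i v c a ∧ ¬ VoterLe F i v a c
      · exact (h₂ hne h h').voterLt 1 2 (by decide)
      · exact (h₃ hne h h').voterLt 1 2 (by decide)
  refine hσ.lt_of_agree hF ha hc (fun v hv => ?_) (hσ.lt_of_le_of_lt hab.1 hbc)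
  obtain ⟨h₀, h₁, h₂, h₃⟩ := hj v hv
  by_cases hne : v = v₀
  · exact (hne ▸ hi).agree ((h₀ hne).voterLt 0 2 (by decide))
  by_cases h : VoterLe F i v a c ∧ ¬ VoterLe F i v c a
  · exact VoterLt.agree h ((h₁ hne h).voterLt 0 2 (by decide))
  · by_cases h' : VoterLe F i v c a ∧ ¬ VoterLe F i v a c
    · exact (VoterLt.agree h' ((h₂ hne h h').voterLt 2 0 (by decide))).symm
    · have := hF.voterLe_total i hv ha hc
      have h₃ := h₃ hne h h'
      exact ⟨iff_of_true (by tauto) ((h₃ 0 2).2 (by decide)),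
        iff_of_true (by tauto) ((h₃ 2 0).2 (by decide))⟩

/-- As for `WeaklyDecisive.decisive_right`: the voter `v₀` puts `a` between `c` and `b`, and all
others put `a` above `b` and `c`. -/
theorem WeaklyDecisive.decisive_left (hS : CountableSociety N.sets V X A F)
    (hX : X ∈ Set.range N.sets) (hσ : SocialWelfareFunction V X F σ) {v₀ : M} (hv₀ : v₀ ∈ V)
    {a b c : M} (ha : a ∈ X) (hb : b ∈ X) (hc : c ∈ X) (hab : a ≠ b) (hac : a ≠ c) (hbc : b ≠ c)
    (h : WeaklyDecisive V F σ v₀ a b) : Decisive F σ v₀ c b := by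
  intro i hi
  obtain ⟨-, -, -, hA, hat, hF, hμ, -⟩ := id hS
  have hle := measurableIn_voterLe hA hμ i hc hb
  have hge := measurableIn_voterLe hA hμ i hb hc
  obtain ⟨j, hj⟩ := exists_profile hS hX (injective_vec hab hac hbc) (vec_mem ha hb hc)
    ![![1, 2, 0], ![2, 1, 0], ![2, 0, 1], ![1, 0, 0]] (by decide) (measurableIn_eq hat hv₀)
    (hle.and hA (hge.not hA)) (hge.and hA (hle.not hA))
  have hj₀ := (hj v₀ hv₀).1 rfl
  have hab : SocialLt σ j a b := h j (hj₀.voterLt 0 1 (by decide)) fun v hv hne => by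
    obtain ⟨-, h₁, h₂, h₃⟩ := hj v hv
    by_cases h : VoterLe F i v c b ∧ ¬ VoterLe F i v b c
    · exact (h₁ hne h).voterLt 1 0 (by decide)
    · by_cases h' : VoterLe F i v b c ∧ ¬ VoterLe F i v c b
      · exact (h₂ hne h h').voterLt 1 0 (by decide)
      · exact (h₃ hne h h').voterLt 1 0 (by decide)
  have hca : SocialLt σ j c a := hσ.2.1 c a j ⟨hc, ha⟩ fun v hv => by
    obtain ⟨h₀, h₁, h₂, h₃⟩ := hj v hv
    by_cases hne : v = v₀
    · exact (h₀ hne).voterLt 2 0 (by decide)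
    by_cases h : VoterLe F i v c b ∧ ¬ VoterLe F i v b c
    · exact (h₁ hne h).voterLt 2 0 (by decide)
    · by_cases h' : VoterLe F i v b c ∧ ¬ VoterLe F i v c b
      · exact (h₂ hne h h').voterLt 2 0 (by decide)
      · exact (h₃ hne h h').voterLt 2 0 (by decide)
  refine hσ.lt_of_agree hF hc hb (fun v hv => ?_) (hσ.lt_of_le_of_lt hca.1 hab)
  obtain ⟨h₀, h₁, h₂, h₃⟩ := hj v hv
  by_cases hne : v = v₀
  · exact (hne ▸ hi).agree ((h₀ hne).voterLt 2 1 (by decide))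
  by_cases h : VoterLe F i v c b ∧ ¬ VoterLe F i v b c
  · exact VoterLt.agree h ((h₁ hne h).voterLt 2 1 (by decide))
  · by_cases h' : VoterLe F i v b c ∧ ¬ VoterLe F i v c b
    · exact (VoterLt.agree h' ((h₂ hne h h').voterLt 1 2 (by decide))).symm
    · have := hF.voterLe_total i hv hc hb
      have h₃ := h₃ hne h h'
      exact ⟨iff_of_true (by tauto) ((h₃ 2 1).2 (by decide)),
        iff_of_true (by tauto) ((h₃ 1 2).2 (by decide))⟩

/-- A voter who is weakly decisive for one pair of alternatives is decisive for all pairs. -/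
theorem WeaklyDecisive.decisive (hS : CountableSociety N.sets V X A F)
    (hX : X ∈ Set.range N.sets) (hσ : SocialWelfareFunction V X F σ) {v₀ : M} (hv₀ : v₀ ∈ V)
    {a b : M} (ha : a ∈ X) (hb : b ∈ X) (hab : a ≠ b) (h : WeaklyDecisive V F σ v₀ a b) {u w : M}
    (hu : u ∈ X) (hw : w ∈ X) (huw : u ≠ w) : Decisive F σ v₀ u w := by
  have third (s t : M) : ∃ z, z ∈ X ∧ s ≠ z ∧ t ≠ z := by
    obtain ⟨x, y, z, hx, hy, hz, hxy, hxz, hyz⟩ := hS.2.2.1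
    by_cases h₁ : s = x <;> by_cases h₂ : t = x <;> by_cases h₃ : s = y <;> by_cases h₄ : t = y <;>
      grind
  -- The alternative `a` is kept on the left first.
  have ha' (w : M) (hw : w ∈ X) (haw : a ≠ w) : Decisive F σ v₀ a w := by
    by_cases hbw : b = w
    · subst hbw
      obtain ⟨t, ht, hat, hbt⟩ := third a b
      exact (h.decisive_right hS hX hσ hv₀ ha hb ht hab hat hbt).weaklyDecisive.decisive_right
        hS hX hσ hv₀ ha ht hb hat hab hbt.symm
    · exact h.decisive_right hS hX hσ hv₀ ha hb hw hab haw hbw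
  have hu' (w : M) (hw : w ∈ X) (haw : a ≠ w) (huw : u ≠ w) : Decisive F σ v₀ u w := by
    by_cases hau : a = u
    · exact hau ▸ ha' w hw haw
    · exact (ha' w hw haw).weaklyDecisive.decisive_left hS hX hσ hv₀ ha hw hu haw hau huw.symm
  by_cases haw : a = w
  · subst haw
    obtain ⟨t, ht, hat, hut⟩ := third a u
    exact (hu' t ht hat hut).weaklyDecisive.decisive_right hS hX hσ hv₀ hu ht ha hut huw hat.symm
  · exact hu' w hw haw huw

/-! ### The pivotal voter -/

/-- In the profile with index `i`, the voters below `n` rank `x` strictly below `y`, and the others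
rank `y` strictly below `x`. -/
def SplitAt (V F : Set M) (x y i n : M) : Prop :=
  ∀ v, v ∈ V → (v < n → VoterLt F i v x y) ∧ (n ≤ v → VoterLt F i v y x)

/-- Initial segments of the set of voters are built up from singletons. -/
theorem measurableIn_lt (hA : CountableAlgebra V A) (hat : Atomic V A)
    (hVr : V ∈ Set.range N.sets) (hAr : A ∈ Set.range N.sets) (hV : Bounded V) (n : M) :
    MeasurableIn V A fun v => v < n := by
  obtain ⟨b, hb⟩ := hV
  have {β : Type} [Tuple M β] {f : β → M} [IsTerm f] : IsBdd M fun a => f a ∈ V := isBdd_mem hVr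
  have {β : Type} [Tuple M β] {f : β → M} [IsTerm f] : IsBdd M fun a => f a ∈ A := isBdd_mem hAr
  have hiff (n : M) : (MeasurableIn V A fun v => v < n) ↔
      ∃ k, ∀ v, v < b → (cpair k v ∈ A ↔ v ∈ V ∧ v < n) :=
    exists_congr fun k => ⟨fun h v _ => h v, fun h v =>
      ⟨fun hv => (h v (hb v (hA.1 k v hv))).1 hv, fun hv => (h v (hb v hv.1)).2 hv⟩⟩
  refine (hiff n).2 (sig_induction
    (P := fun n => ∃ k, ∀ v, v < b → (cpair k v ∈ A ↔ v ∈ V ∧ v < n))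
    inferInstance ((hiff 0).1 ?_) (fun n hn => (hiff _).1 ?_) n)
  · simpa only [not_lt_zero] using measurableIn_false hA
  · replace hn := (hiff n).2 hn
    simp only [lt_add_one_iff', le_iff_lt_or_eq]
    by_cases hnV : n ∈ V
    · exact hn.or hA (measurableIn_eq hat hnV)
    · obtain ⟨k, hk⟩ := hn
      refine ⟨k, fun v => (hk v).trans ⟨fun h => ⟨h.1, .inl h.2⟩, ?_⟩⟩
      rintro ⟨hv, h | rfl⟩
      exacts [⟨hv, h⟩, (hnV hv).elim]

/-- Some voter is pivotal: its change of mind turns the social preference. -/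
theorem exists_pivot (hS : CountableSociety N.sets V X A F) (hVr : V ∈ Set.range N.sets)
    (hFr : F ∈ Set.range N.sets) (hσr : σ ∈ Set.range N.sets)
    (hV : Bounded V) (hσ : SocialWelfareFunction V X F σ) {x y : M} (hx : x ∈ X) (hy : y ∈ X)
    (hex : ∀ n, ∃ i, SplitAt V F x y i n) :
    ∃ n, n ∈ V ∧ (∃ i, SplitAt V F x y i (n + 1) ∧ SocialLt σ i x y) ∧
      ∀ i, SplitAt V F x y i n → SocialLe σ i y x := by
  have hF := hS.2.2.2.2.2.1
  obtain ⟨b, hb⟩ := hV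
  obtain ⟨B, hB⟩ := exists_weakOrder_bound hS.2.1
  have {β : Type} [Tuple M β] {f : β → M} [IsTerm f] : IsBdd M fun a => f a ∈ V := isBdd_mem hVr
  have {β : Type} [Tuple M β] {f : β → M} [IsTerm f] : IsBdd M fun a => f a ∈ F := isBdd_mem hFr
  have {β : Type} [Tuple M β] {f : β → M} [IsTerm f] : IsBdd M fun a => f a ∈ σ := isBdd_mem hσr
  have {β : Type} [Tuple M β] {f g : β → M} [IsTerm f] [IsTerm g] (x y : M) :
      IsBdd M fun a => VoterLt F (f a) (g a) x y := by
    have hle (x y : M) : IsBdd M fun a => VoterLe F (f a) (g a) x y :=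
      IsBdd.congr (P := fun a => ∃ R, R < B ∧ cpair (f a) (cpair (g a) R) ∈ F ∧
        InCode (cpair x y) R) inferInstance fun a => exists_congr fun R =>
          ⟨fun h => ⟨hB R (hF.weakOrder_of_profileVal h.1), h⟩, And.right⟩
    have := hle x y
    have := hle y x
    unfold VoterLt
    infer_instance
  have {β : Type} [Tuple M β] {f : β → M} [IsTerm f] : IsBdd M fun a => SocialLt σ (f a) x y := by
    have hle (x y : M) : IsBdd M fun a => SocialLe σ (f a) x y :=
      IsBdd.congr (P := fun a => ∃ R, R < B ∧ cpair (f a) R ∈ σ ∧ InCode (cpair x y) R)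
        inferInstance fun a => exists_congr fun R => ⟨fun h => ⟨hB R (by
          obtain ⟨i', R', he, -, h'⟩ := hσ.1.1 _ h.1
          exact (cpair_inj.1 he).2 ▸ h'), h⟩, And.right⟩
    have := hle x y
    have := hle y x
    unfold SocialLt
    infer_instance
  by_contra! hno
  have hstep (n : M) : (∃ i, SplitAt V F x y i (n + 1) ∧ SocialLt σ i x y) →
      ∃ i, SplitAt V F x y i n ∧ SocialLt σ i x y := by
    rintro ⟨i, hi, h⟩
    by_cases hn : n ∈ V
    · obtain ⟨j, hj, hj'⟩ := hno n hn ⟨i, hi, h⟩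
      exact ⟨j, hj, (hσ.le_total j hx hy).resolve_right hj', hj'⟩
    · refine ⟨i, fun v hv => ⟨fun h => (hi v hv).1 (h.trans (lt_add_one n)), fun h => ?_⟩, h⟩
      have : n ≠ v := by rintro rfl; exact hn hv
      refine (hi v hv).2 (not_lt.1 fun h' => this (h.antisymm (lt_add_one_iff'.1 h')))
  -- Without a pivot, the social ranking `x < y` would persist from `b` down to `0`.
  have key (k : M) : ∃ n i, b < k ∨ n + k = b ∧ (∀ v, v < b → v ∈ V →
      (v < n → VoterLt F i v x y) ∧ (n ≤ v → VoterLt F i v y x)) ∧ SocialLt σ i x y := by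
    refine sig_induction (P := fun k => ∃ n i, b < k ∨ n + k = b ∧ (∀ v, v < b → v ∈ V →
      (v < n → VoterLt F i v x y) ∧ (n ≤ v → VoterLt F i v y x)) ∧ SocialLt σ i x y)
      inferInstance ?_ ?_ k
    · obtain ⟨i, hi⟩ := hex b
      exact ⟨b, i, .inr ⟨add_zero b, fun v _ hv => hi v hv,
        hσ.2.1 x y i ⟨hx, hy⟩ fun v hv => (hi v hv).1 (hb v hv)⟩⟩
    · rintro k ⟨n, i, hk | ⟨hn, hi, h⟩⟩
      · exact ⟨0, 0, .inl (hk.trans (lt_add_one k))⟩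
      · rcases eq_zero_or_succ n with rfl | ⟨n, rfl⟩
        · exact ⟨0, 0, .inl (by rw [← hn, zero_add]; exact lt_add_one k)⟩
        · obtain ⟨j, hj, h'⟩ := hstep n ⟨i, fun v hv => hi v (hb v hv) hv, h⟩
          exact ⟨n, j, .inr ⟨by rw [← hn]; ring, fun v _ hv => hj v hv, h'⟩⟩
  obtain ⟨n, i, h | ⟨hn, hi, h⟩⟩ := key b
  · exact lt_irrefl b h
  · obtain rfl : n = 0 := by simpa using hn
    exact h.2 (hσ.2.1 y x i ⟨hy, hx⟩ fun v hv => (hi v (hb v hv) hv).2 zero_le).1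

/-- The pivotal voter `n` for `x` and `y` is weakly decisive for `x` and any third alternative `z`.
If the voters below `n` have `x < z < y` and the others `y < x < z`, then society has `y ≲ x`, so
`y < z` by unanimity on `x < z`. In a profile in which `n` has `x < y < z`, the voters below `n`
have `z < x < y`, and those above `n` have `y < z < x`, society has `x < y` because `n` has changed
sides, and `y < z` as before; so it has `x < z` with `n` alone. -/
theorem exists_weaklyDecisive (hS : CountableSociety N.sets V X A F) (hVr : V ∈ Set.range N.sets)
    (hX : X ∈ Set.range N.sets) (hAr : A ∈ Set.range N.sets) (hFr : F ∈ Set.range N.sets)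
    (hσr : σ ∈ Set.range N.sets) (hV : Bounded V) (hσ : SocialWelfareFunction V X F σ) {x y z : M}
    (hx : x ∈ X) (hy : y ∈ X) (hz : z ∈ X) (hxy : x ≠ y) (hxz : x ≠ z) (hyz : y ≠ z) :
    ∃ v₀, v₀ ∈ V ∧ WeaklyDecisive V F σ v₀ x z := by
  obtain ⟨-, -, -, hA, hat, hF, -⟩ := id hS
  have hlt := measurableIn_lt hA hat hVr hAr hV
  have hinj := injective_vec hxy hxz hyz
  have hmem := vec_mem hx hy hz
  -- The voters below `n` have the order `x < z < y`, the others `y < x < z`.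
  have hex (n : M) : ∃ i, ∀ v, v ∈ V → (v < n → Ranks F i v ![x, y, z] ![0, 2, 1]) ∧
      (¬ v < n → Ranks F i v ![x, y, z] ![1, 0, 2]) := by
    -- The second and the third order are not used; they only have to differ from the others.
    obtain ⟨i, hi⟩ := exists_profile hS hX hinj hmem
      ![![0, 2, 1], ![0, 0, 0], ![0, 0, 1], ![1, 0, 2]] (by decide) (hlt n)
      (measurableIn_false hA) (measurableIn_false hA)
    exact ⟨i, fun v hv => ⟨(hi v hv).1, fun h => (hi v hv).2.2.2 h id id⟩⟩
  obtain ⟨n, hn, ⟨i, hi, hixy⟩, hyx⟩ := exists_pivot hS hVr hFr hσr hV hσ hx hy fun n => by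
    obtain ⟨i, hi⟩ := hex n
    exact ⟨i, fun v hv => ⟨fun h => ((hi v hv).1 h).voterLt 0 1 (by decide),
      fun h => ((hi v hv).2 h.not_gt).voterLt 1 0 (by decide)⟩⟩
  refine ⟨n, hn, fun k hk hk' => ?_⟩
  obtain ⟨j, hj⟩ := hex n
  have hjyz : SocialLt σ j y z := by
    refine hσ.lt_of_le_of_lt (hyx j fun v hv => ⟨fun h => ((hj v hv).1 h).voterLt 0 1 (by decide),
      fun h => ((hj v hv).2 h.not_gt).voterLt 1 0 (by decide)⟩)
      (hσ.2.1 x z j ⟨hx, hz⟩ fun v hv => ?_)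
    by_cases h : v < n
    · exact ((hj v hv).1 h).voterLt 0 2 (by decide)
    · exact ((hj v hv).2 h).voterLt 0 2 (by decide)
  -- The voter `n` has the order `x < y < z`, those below `z < x < y`, those above `y < z < x`.
  obtain ⟨l, hl⟩ := exists_profile hS hX hinj hmem
    ![![0, 1, 2], ![1, 2, 0], ![0, 0, 0], ![2, 0, 1]] (by decide) (measurableIn_eq hat hn)
    (hlt n) (measurableIn_false hA)
  have hl (v : M) (hv : v ∈ V) : (v = n ∧ Ranks F l v ![x, y, z] ![0, 1, 2]) ∨
      (v < n ∧ Ranks F l v ![x, y, z] ![1, 2, 0]) ∨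
      (n < v ∧ Ranks F l v ![x, y, z] ![2, 0, 1]) := by
    obtain ⟨h₀, h₁, -, h₃⟩ := hl v hv
    rcases lt_trichotomy v n with h | h | h
    exacts [.inr (.inl ⟨h, h₁ h.ne h⟩), .inl ⟨h, h₀ h⟩, .inr (.inr ⟨h, h₃ h.ne' h.not_gt id⟩)]
  have hlxy : SocialLt σ l x y := by
    refine hσ.lt_of_agree hF hx hy (fun v hv => ?_) hixy
    rcases hl v hv with ⟨h, h'⟩ | ⟨h, h'⟩ | ⟨h, h'⟩
    · exact (h'.voterLt 0 1 (by decide)).agree ((hi v hv).1 (h ▸ lt_add_one n))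
    · exact (h'.voterLt 0 1 (by decide)).agree ((hi v hv).1 (h.trans (lt_add_one n)))
    · exact ((h'.voterLt 1 0 (by decide)).agree
        ((hi v hv).2 (not_lt.1 fun h' => h.not_ge (lt_add_one_iff'.1 h')))).symm
  have hlyz : SocialLt σ l y z := by
    refine hσ.lt_of_agree hF hy hz (fun v hv => ?_) hjyz
    rcases hl v hv with ⟨h, h'⟩ | ⟨h, h'⟩ | ⟨h, h'⟩
    · exact (h'.voterLt 1 2 (by decide)).agree
        (((hj v hv).2 (h ▸ lt_irrefl n)).voterLt 1 2 (by decide))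
    · exact ((h'.voterLt 2 1 (by decide)).agree
        (((hj v hv).1 h).voterLt 2 1 (by decide))).symm
    · exact (h'.voterLt 1 2 (by decide)).agree
        (((hj v hv).2 h.not_gt).voterLt 1 2 (by decide))
  refine hσ.lt_of_agree hF hx hz (fun v hv => ?_) (hσ.lt_of_le_of_lt hlxy.1 hlyz)
  rcases hl v hv with ⟨rfl, h'⟩ | ⟨h, h'⟩ | ⟨h, h'⟩
  · exact hk.agree (h'.voterLt 0 2 (by decide))
  · exact ((hk' v hv h.ne).agree (h'.voterLt 2 0 (by decide))).symm
  · exact ((hk' v hv h.ne').agree (h'.voterLt 2 0 (by decide))).symm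

/-- Arrow's theorem in a model of `Σ⁰₁` induction. -/
theorem dictatorial (hS : CountableSociety N.sets V X A F) (hVr : V ∈ Set.range N.sets)
    (hX : X ∈ Set.range N.sets) (hAr : A ∈ Set.range N.sets) (hFr : F ∈ Set.range N.sets)
    (hσr : σ ∈ Set.range N.sets) (hV : Bounded V) (hσ : SocialWelfareFunction V X F σ) :
    ¬ NonDictatorial V X F σ := by
  intro h
  obtain ⟨x, y, z, hx, hy, hz, hxy, hxz, hyz⟩ := hS.2.2.1
  obtain ⟨v₀, hv₀, h₀⟩ := exists_weaklyDecisive hS hVr hX hAr hFr hσr hV hσ hx hy hz hxy hxz hyz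
  obtain ⟨i, u, w, hu, hw, huw, hle⟩ := h v₀ hv₀
  have hne : u ≠ w := by
    rintro rfl
    exact huw.2 huw.1
  exact (h₀.decisive hS hX hσ hv₀ hx hz hxz hu hw hne i huw).2 hle

end Arrow

end SOA

theorem theorem4p5 : SOA.Proves SOA.RCA0 SOA.arrowTheorem :=
  SOA.proves_RCA0_of_sat fun _ => SOA.arrowTheorem_sat.2
    fun _ hV _ hX _ hA _ hF _ hσ h => SOA.dictatorial h.1 hV hX hA hF hσ h.2.1 h.2.2
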